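/- Let $\mathbf U=\{z\in\mathbb C:|z|<1\}$, let $\mathbf T$ be the unit circle and $\sigma$ the normalized arc length (probability) measure on $\mathbf T$; write $\int_{\mathbf T}F=\int_{\mathbf T}F\,d\sigma$. For $1<p<\infty$, the class $\mathbf h^p$ consists of the functions $f=g+\bar h$ with $g,h$ holomorphic on $\mathbf U$ such that $$\|f\|_p:=\sup_{0<r<1}\left(\int_{\mathbf T}|f(r\zeta)|^p\,d\sigma(\zeta)\right)^{1/p}<\infty .$$ **Theorem.** Let $1<p<\infty$, let $f=g+\bar h\in\mathbf h^p$ with $g,h$ holomorphic on $\mathbf U$, and assume that $\operatorname{Re}(g(0)h(0))=0$, or that $p\le 3$ and $\operatorname{Re}(g(0)h(0))\ge 0$. Then the radial limits $F(\zeta)=\lim_{r\to1^-}F(r\zeta)$ exist for almost every $\zeta\in\mathbf T$ for each of $F=f,g,h$; with these boundary values, the functions $|f|^p$ and $(|g|^2+|h|^2)^{p/2}$ are integrable on $\mathbf T$, $\|f\|_p=\left(\int_{\mathbf T}|f|^p\right)^{1/p}$, and $$\left(\int_{\mathbf T}(|g|^2+|h|^2)^{p/2}\right)^{1/p}\le \frac{1}{\left(1-\left|\cos\frac{\pi}{p}\right|\right)^{1/2}}\left(\int_{\mathbf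 T}|g+\bar h|^p\right)^{1/p}.$$ The constant is sharp: for every $p\in(1,\infty)$ and every real $C<\left(1-\left|\cos\frac{\pi}{p}\right|\right)^{-1/2}$ there is $f=g+\bar h\in\mathbf h^p$ with $g,h$ holomorphic on $\mathbf U$ and $\operatorname{Re}(g(0)h(0))=0$ such that $$\left(\int_{\mathbf T}(|g|^2+|h|^2)^{p/2}\right)^{1/p}> C\left(\int_{\mathbf T}|f|^p\right)^{1/p}.$$ -/

import Mathlib

open Real Filter Topology Metric MeasureTheory

noncomputable section

namespace HarmonicHardy

/-- The integral mean `M_p(f, r) = (∫_𝕋 |f(rζ)|^p dσ(ζ))^{1/p}`, where `σ` is the normalized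
arc length (probability) measure on the unit circle. -/
def integralMean (p : ℝ) (f : ℂ → ℂ) (r : ℝ) : ℝ :=
  (circleAverage (fun z => ‖f z‖ ^ p) 0 r) ^ (1 / p)

/-- The Hardy norm `‖f‖_p = sup_{0<r<1} M_p(f, r)` (meaningful when the means are bounded). -/
def hardyNorm (p : ℝ) (f : ℂ → ℂ) : ℝ :=
  sSup (integralMean p f '' Set.Ioo 0 1)

/-- `f = g + h̄` on the unit disk, with `g`, `h` holomorphic there, and `f` belongs to the harmonic
Hardy class `𝐡^p`, that is, its integral means of order `p` are bounded. -/
structure IsHardy (p : ℝ) (f g h : ℂ → ℂ) : Prop where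
  holo_g : DifferentiableOn ℂ g (ball 0 1)
  holo_h : DifferentiableOn ℂ h (ball 0 1)
  eq_add_conj : ∀ z ∈ ball (0 : ℂ) 1, f z = g z + (starRingEnd ℂ) (h z)
  bddAbove_means : BddAbove (integralMean p f '' Set.Ioo 0 1)

/-- The radial boundary value `lim_{r → 1⁻} f(rζ)` (meaningful where this limit exists). -/
def boundaryValue (f : ℂ → ℂ) (ζ : ℂ) : ℂ :=
  limUnder (𝓝[<] (1 : ℝ)) (fun r : ℝ => f (r * ζ))

/-- The radial limits of `f` exist at almost every point `e^{iθ}` of the unit circle. -/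
def HasRadialLimits (f : ℂ → ℂ) : Prop :=
  ∀ᵐ θ : ℝ, ∃ w : ℂ,
    Tendsto (fun r : ℝ => f (r * circleMap 0 1 θ)) (𝓝[<] (1 : ℝ)) (𝓝 w)

/-- The boundary function `|f|^p` on the unit circle. -/
def boundaryPow (p : ℝ) (f : ℂ → ℂ) (ζ : ℂ) : ℝ :=
  ‖boundaryValue f ζ‖ ^ p

/-- The boundary function `(|g|² + |h|²)^{p/2}` on the unit circle. -/
def boundaryPairPow (p : ℝ) (g h : ℂ → ℂ) (ζ : ℂ) : ℝ :=
  (‖boundaryValue g ζ‖ ^ 2 + ‖boundaryValue h ζ‖ ^ 2) ^ (p / 2)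

/-- `(∫_𝕋 |f|^p dσ)^{1/p}` (meaningful when `boundaryPow p f` is integrable). -/
def boundaryNorm (p : ℝ) (f : ℂ → ℂ) : ℝ :=
  (circleAverage (boundaryPow p f) 0 1) ^ (1 / p)

/-- `(∫_𝕋 (|g|² + |h|²)^{p/2} dσ)^{1/p}` (meaningful when `boundaryPairPow p g h` is
integrable). -/
def boundaryPairNorm (p : ℝ) (g h : ℂ → ℂ) : ℝ :=
  (circleAverage (boundaryPairPow p g h) 0 1) ^ (1 / p)

/-- The constant `(1 - |cos(π/p)|)^{-1/2}`. -/
def rieszConst (p : ℝ) : ℝ := 1 / √(1 - |cos (π / p)|)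

end HarmonicHardy

end

open Real Filter Topology Metric MeasureTheory

noncomputable section

namespace HarmonicHardy


/-! ### Trigonometric inequalities -/

/-! The inequality follows from a pointwise one with a subharmonic correction term: for complex `z`,
`w`, `(|z|² + |w|²)^(p/2) ≤ c^p |z + w̄|^p - K V(zw)`, where `c` is `rieszConst p`, `K ≥ 0`, and `V`
is `powerSubharmonic p`, homogeneous of degree `p/2` and nonnegative on the closed right half-plane
(`exists_pow_le_sub_powerSubharmonic`). For `z = g`, `w = h` the product `gh` is holomorphic, so the
circle averages of `V(gh)` are at least `V(g(0)h(0)) ≥ 0`. Averaging gives the inequality on every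
interior circle (`IsHardy.circleAverage_pair_le`).

For the pointwise inequality, `|z + w̄|² = N (1 + Re u)` with `N = |z|² + |w|²` and `u = 2zw/N` in
the closed unit disk, so by homogeneity only `u` matters. On the unit circle this is a trigonometric
inequality with equality at angle `π/p`, measured from the positive axis for `p ≤ 2`
(`one_le_cos_rpow_sub`) and from the negative axis for `p ≥ 2` (`one_le_sin_rpow_add`). Inside the
disk, `u` is compared with the circle point of equal real part.

The sub-mean value property of `V ∘ φ`, `φ` holomorphic, rests on local support: at each `u₀ ≠ 0`,
`V` is touched from below by some `Re (C (u/u₀)^(p/2))`, which suffices for a maximum principle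
(`HasPowerSupport.le_of_le_sphere`).

The interior inequality bounds the means of `g` and `h`. A primitive of such a function extends
continuously to the circle, with a boundary function of bounded variation, hence differentiable
almost everywhere; Fatou's theorem for the differentiated Poisson kernel turns this into radial
limits. Uniform integrability gives the Poisson representation, Jensen's inequality and Fatou's
lemma identify `‖f‖_p` with the boundary norm, and Fatou's lemma carries the inequality to the
circle.

For sharpness, `g = u^γ - 1` and `h = ±g`, where `u` is the Cayley transform, imaginary on the
circle. As `γ` increases to `1/p` the region where `|u|` is large dominates, and there the ratio of
the two sides approaches the constant. -/

lemma sin_rpow_ratio_monotoneOn {p : ℝ} (hp : 2 ≤ p) :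
    MonotoneOn (fun s => sin s ^ (p - 1) * cos s / sin (p * s)) (Set.Ioo 0 (π / p)) := by
  have hp0 : 0 < p := by linarith
  have hmem : ∀ s ∈ Set.Ioo 0 (π / p), 0 < sin s ∧ 0 < cos s ∧ 0 < sin (p * s) ∧
      0 ≤ sin ((p - 2) * s) := by
    rintro s ⟨h0, h1⟩
    have h2 : p * s < π := by rwa [lt_div_iff₀ hp0, mul_comm] at h1
    have h3 : 2 * s ≤ p * s := by gcongr
    have hpi := pi_pos
    refine ⟨sin_pos_of_pos_of_lt_pi h0 (by linarith), cos_pos_of_mem_Ioo ⟨by linarith, by linarith⟩,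
      sin_pos_of_pos_of_lt_pi (by positivity) h2, sin_nonneg_of_nonneg_of_le_pi ?_ ?_⟩
    · exact mul_nonneg (by linarith) h0.le
    · nlinarith
  have hder : ∀ s ∈ Set.Ioo 0 (π / p),
      HasDerivAt (fun s => sin s ^ (p - 1) * cos s / sin (p * s))
        (sin s ^ (p - 2) * ((p / 2 - 1) * sin (p * s) + p / 2 * sin ((p - 2) * s)) /
          sin (p * s) ^ 2) s := by
    intro s hs
    obtain ⟨h1, h2, h3, h4⟩ := hmem s hs
    have hd1 := ((hasDerivAt_sin s).rpow_const (p := p - 1) (Or.inl h1.ne')).mul (hasDerivAt_cos s)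
    have hd2 : HasDerivAt (fun s => sin (p * s)) (cos (p * s) * (p * 1)) s :=
      ((hasDerivAt_id s).const_mul p).sin
    refine (hd1.div hd2 h3.ne').congr_deriv ?_
    simp only [Pi.mul_apply]
    congr 1
    have e1 : sin s ^ (p - 1) = sin s ^ (p - 2) * sin s := by
      rw [← rpow_add_one h1.ne']; congr 1; ring
    have e2 : sin ((p - 2) * s) = sin (p * s) * cos (2 * s) - cos (p * s) * sin (2 * s) := by
      rw [← sin_sub]; congr 1; ring
    rw [e1, e2, show p - 1 - 1 = p - 2 by ring, sin_two_mul, cos_two_mul]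
    have := sin_sq_add_cos_sq s
    have e3 : cos s ^ 2 = 1 - sin s ^ 2 := by linarith
    ring_nf
    rw [e3]
    ring
  refine monotoneOn_of_deriv_nonneg (convex_Ioo _ _)
    (fun s hs => (hder s hs).continuousAt.continuousWithinAt)
    (fun s hs => (hder s (interior_subset hs)).differentiableAt.differentiableWithinAt)
    (fun s hs => ?_)
  have hs' := interior_subset hs
  obtain ⟨h1, h2, h3, h4⟩ := hmem s hs'
  rw [(hder s hs').deriv]
  have : 0 ≤ p / 2 - 1 := by linarith
  positivity

/-- The derivative reduces to `(2 - p) / p * sin (p * s) ≤ sin ((2 - p) * s)`. Like its sine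
analogue, this monotone ratio locates the sign change of a derivative at a single point. -/
lemma cos_rpow_ratio_antitoneOn {p : ℝ} (hp : 1 < p) (hp2 : p ≤ 2) :
    AntitoneOn (fun s => cos s ^ (p - 1) * sin s / sin (p * s)) (Set.Ioo 0 (π / 2)) := by
  have hp0 : 0 < p := by linarith
  have hmem : ∀ s ∈ Set.Ioo 0 (π / 2), 0 < sin s ∧ 0 < cos s ∧ 0 < sin (p * s) ∧
      (2 - p) / p * sin (p * s) ≤ sin ((2 - p) * s) := by
    rintro s ⟨h0, h1⟩
    have hpi := pi_pos
    have h2 : p * s < π := by nlinarith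
    refine ⟨sin_pos_of_pos_of_lt_pi h0 (by linarith), cos_pos_of_mem_Ioo ⟨by linarith, by linarith⟩,
      sin_pos_of_pos_of_lt_pi (by positivity) h2, ?_⟩
    have hm1 : p * s ∈ Set.Icc 0 π := ⟨by positivity, h2.le⟩
    have hm2 : (0 : ℝ) ∈ Set.Icc 0 π := ⟨le_rfl, hpi.le⟩
    have hw1 : 0 ≤ (2 - p) / p := div_nonneg (by linarith) hp0.le
    have hw2 : 0 ≤ 1 - (2 - p) / p := by rw [sub_nonneg, div_le_one hp0]; linarith
    -- Concavity of the sine between `0` and `p * s`: the weight `(2 - p) / p` lands on `(2 - p) *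
    -- s`.
    have hc := strictConcaveOn_sin_Icc.concaveOn.2 hm1 hm2 hw1 hw2 (by ring)
    simp only [smul_eq_mul, sin_zero, mul_zero, add_zero] at hc
    rwa [← mul_assoc, div_mul_cancel₀ _ hp0.ne'] at hc
  have hder : ∀ s ∈ Set.Ioo 0 (π / 2),
      HasDerivAt (fun s => cos s ^ (p - 1) * sin s / sin (p * s))
        (- (cos s ^ (p - 2) * (p / 2 * (sin ((2 - p) * s) - (2 - p) / p * sin (p * s))) /
          sin (p * s) ^ 2)) s := by
    intro s hs
    obtain ⟨h1, h2, h3, h4⟩ := hmem s hs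
    have hd1 := ((hasDerivAt_cos s).rpow_const (p := p - 1) (Or.inl h2.ne')).mul (hasDerivAt_sin s)
    have hd2 : HasDerivAt (fun s => sin (p * s)) (cos (p * s) * (p * 1)) s :=
      ((hasDerivAt_id s).const_mul p).sin
    refine (hd1.div hd2 h3.ne').congr_deriv ?_
    rw [← neg_div]
    simp only [Pi.mul_apply]
    congr 1
    have e1 : cos s ^ (p - 1) = cos s ^ (p - 2) * cos s := by
      rw [← rpow_add_one h2.ne']; congr 1; ring
    have e2 : sin ((2 - p) * s) = sin (2 * s) * cos (p * s) - cos (2 * s) * sin (p * s) := by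
      rw [← sin_sub]; congr 1; ring
    rw [e1, e2, show p - 1 - 1 = p - 2 by ring, sin_two_mul, cos_two_mul]
    have := sin_sq_add_cos_sq s
    have e3 : sin s ^ 2 = 1 - cos s ^ 2 := by linarith
    field_simp
    ring_nf
    rw [e3]
    ring
  refine antitoneOn_of_deriv_nonpos (convex_Ioo _ _)
    (fun s hs => (hder s hs).continuousAt.continuousWithinAt)
    (fun s hs => (hder s (interior_subset hs)).differentiableAt.differentiableWithinAt)
    (fun s hs => ?_)
  have hs' := interior_subset hs
  obtain ⟨h1, h2, h3, h4⟩ := hmem s hs'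
  rw [(hder s hs').deriv, neg_nonpos]
  have : 0 ≤ sin ((2 - p) * s) - (2 - p) / p * sin (p * s) := by linarith
  positivity

/-- A function that decreases up to `m` and increases afterwards is minimal at `m`. -/
lemma le_of_hasDerivAt_sign {f f' : ℝ → ℝ} {a b m : ℝ} (hm : m ∈ Set.Icc a b)
    (hf : ∀ x, HasDerivAt f (f' x) x) (h1 : ∀ x ∈ Set.Ioo a m, f' x ≤ 0)
    (h2 : ∀ x ∈ Set.Ioo m b, 0 ≤ f' x) {x : ℝ} (hx : x ∈ Set.Icc a b) : f m ≤ f x := by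
  have hc : Continuous f := continuous_iff_continuousAt.2 fun x => (hf x).continuousAt
  rcases le_total x m with h | h
  · have : AntitoneOn f (Set.Icc a m) := by
      refine antitoneOn_of_deriv_nonpos (convex_Icc _ _) hc.continuousOn
        (fun s _ => (hf s).differentiableAt.differentiableWithinAt) (fun s hs => ?_)
      rw [(hf s).deriv]
      exact h1 s (by simpa using hs)
    exact this ⟨hx.1, h⟩ ⟨hm.1, le_rfl⟩ h
  · have : MonotoneOn f (Set.Icc m b) := by
      refine monotoneOn_of_deriv_nonneg (convex_Icc _ _) hc.continuousOn
        (fun s _ => (hf s).differentiableAt.differentiableWithinAt) (fun s hs => ?_)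
      rw [(hf s).deriv]
      exact h2 s (by simpa using hs)
    exact this ⟨le_rfl, hm.2⟩ ⟨h, hx.2⟩ h

/-- At `s₀` the cosine vanishes and equality holds; the coefficient `cos s₀ / sin s₀` makes `s₀`
critical. Up to a positive factor the derivative is `sin s ^ (p - 1) * cos s - sin s₀ ^ (p - 1) *
cos s₀ * sin (p * s)`, whose sign changes at `s₀` because the ratio studied above is monotone. -/
lemma one_le_sin_rpow_add {p s₀ s : ℝ} (hp : 2 ≤ p) (hs₀ : p * s₀ = π / 2)
    (hs : s ∈ Set.Icc 0 (π / p)) :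
    1 ≤ (sin s / sin s₀) ^ p + cos s₀ / sin s₀ * cos (p * s) := by
  have hp0 : 0 < p := by linarith
  have hpi := pi_pos
  have hs0 : s₀ = π / 2 / p := by field_simp; linarith
  have h0 : 0 < s₀ := by rw [hs0]; positivity
  have h1 : s₀ < π / p := by rw [hs0]; gcongr; linarith
  have h2 : π / p ≤ π / 2 := by gcongr
  have hsin0 : 0 < sin s₀ := sin_pos_of_pos_of_lt_pi h0 (by linarith)
  have hder : ∀ x, HasDerivAt (fun s => (sin s / sin s₀) ^ p + cos s₀ / sin s₀ * cos (p * s))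
      (cos x / sin s₀ * p * (sin x / sin s₀) ^ (p - 1) +
        cos s₀ / sin s₀ * (-sin (p * x) * (p * 1))) x := by
    intro x
    have hd2 : HasDerivAt (fun s => cos (p * s)) (-sin (p * x) * (p * 1)) x :=
      ((hasDerivAt_id x).const_mul p).cos
    exact (((hasDerivAt_sin x).div_const _).rpow_const (Or.inr (by linarith))).add
      (hd2.const_mul _)
  have hrw : ∀ x, 0 ≤ sin x → cos x / sin s₀ * p * (sin x / sin s₀) ^ (p - 1) +
        cos s₀ / sin s₀ * (-sin (p * x) * (p * 1)) =
        p / (sin s₀ * sin s₀ ^ (p - 1)) * (sin x ^ (p - 1) * cos x -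
          sin s₀ ^ (p - 1) * cos s₀ * sin (p * x)) := by
    intro x hx
    rw [div_rpow hx hsin0.le]
    have : 0 < sin s₀ ^ (p - 1) := by positivity
    field_simp
    ring
  have hmono := sin_rpow_ratio_monotoneOn hp
  have key := le_of_hasDerivAt_sign (m := s₀) ⟨h0.le, h1.le⟩ hder ?_ ?_ hs
  · refine le_trans (le_of_eq ?_) key
    rw [hs₀, cos_pi_div_two, div_self hsin0.ne']
    simp
  · rintro x ⟨hx0, hx1⟩
    have hsx : 0 < sin x := sin_pos_of_pos_of_lt_pi hx0 (by linarith)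
    have hspx : 0 < sin (p * x) := sin_pos_of_pos_of_lt_pi (by positivity) (by nlinarith)
    have := hmono ⟨hx0, hx1.trans h1⟩ ⟨h0, h1⟩ hx1.le
    simp only [hs₀, sin_pi_div_two, div_one] at this
    rw [div_le_iff₀ hspx] at this
    rw [hrw x hsx.le]
    exact mul_nonpos_of_nonneg_of_nonpos (by positivity) (by linarith)
  · rintro x ⟨hx0, hx1⟩
    have hsx : 0 < sin x := sin_pos_of_pos_of_lt_pi (h0.trans hx0) (by linarith)
    have hspx : 0 < sin (p * x) := sin_pos_of_pos_of_lt_pi (mul_pos hp0 (h0.trans hx0))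
      (by rwa [lt_div_iff₀ hp0, mul_comm] at hx1)
    have := hmono ⟨h0, h1⟩ ⟨h0.trans hx0, hx1⟩ hx0.le
    simp only [hs₀, sin_pi_div_two, div_one] at this
    rw [le_div_iff₀ hspx] at this
    rw [hrw x hsx.le]
    exact mul_nonneg (by positivity) (by linarith)

/-- The coefficient `sin s₀ / cos s₀` again makes `s₀` critical. The ratio now decreases, and the
terms of the derivative appear in the opposite order, so `s₀` is still the minimum. -/
lemma one_le_cos_rpow_sub {p s₀ s : ℝ} (hp : 1 < p) (hp2 : p ≤ 2) (hs₀ : p * s₀ = π / 2)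
    (hs : s ∈ Set.Icc 0 (π / 2)) :
    1 ≤ (cos s / cos s₀) ^ p - sin s₀ / cos s₀ * cos (p * s) := by
  have hp0 : 0 < p := by linarith
  have hpi := pi_pos
  have hs0 : s₀ = π / 2 / p := by field_simp; linarith
  have h0 : 0 < s₀ := by rw [hs0]; positivity
  have h1 : s₀ < π / 2 := by rw [hs0]; exact div_lt_self (by positivity) hp
  have hcos0 : 0 < cos s₀ := cos_pos_of_mem_Ioo ⟨by linarith, by linarith⟩
  have hder : ∀ x, HasDerivAt (fun s => (cos s / cos s₀) ^ p - sin s₀ / cos s₀ * cos (p * s))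
      (-sin x / cos s₀ * p * (cos x / cos s₀) ^ (p - 1) -
        sin s₀ / cos s₀ * (-sin (p * x) * (p * 1))) x := by
    intro x
    have hd2 : HasDerivAt (fun s => cos (p * s)) (-sin (p * x) * (p * 1)) x :=
      ((hasDerivAt_id x).const_mul p).cos
    exact (((hasDerivAt_cos x).div_const _).rpow_const (Or.inr (by linarith))).sub
      (hd2.const_mul _)
  have hrw : ∀ x, 0 ≤ cos x → -sin x / cos s₀ * p * (cos x / cos s₀) ^ (p - 1) -
        sin s₀ / cos s₀ * (-sin (p * x) * (p * 1)) =
        p / (cos s₀ * cos s₀ ^ (p - 1)) * (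
          cos s₀ ^ (p - 1) * sin s₀ * sin (p * x) - cos x ^ (p - 1) * sin x) := by
    intro x hx
    rw [div_rpow hx hcos0.le]
    have : 0 < cos s₀ ^ (p - 1) := by positivity
    field_simp
    ring
  have hmono := cos_rpow_ratio_antitoneOn hp hp2
  have key := le_of_hasDerivAt_sign (m := s₀) ⟨h0.le, h1.le⟩ hder ?_ ?_ hs
  · refine le_trans (le_of_eq ?_) key
    rw [hs₀, cos_pi_div_two, div_self hcos0.ne']
    simp
  · rintro x ⟨hx0, hx1⟩
    have hcx : 0 < cos x := cos_pos_of_mem_Ioo ⟨by linarith, by linarith⟩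
    have hspx : 0 < sin (p * x) := sin_pos_of_pos_of_lt_pi (by positivity) (by nlinarith)
    have := hmono ⟨hx0, hx1.trans h1⟩ ⟨h0, h1⟩ hx1.le
    simp only [hs₀, sin_pi_div_two, div_one] at this
    rw [le_div_iff₀ hspx] at this
    rw [hrw x hcx.le]
    exact mul_nonpos_of_nonneg_of_nonpos (by positivity) (by linarith)
  · rintro x ⟨hx0, hx1⟩
    have hcx : 0 < cos x := cos_pos_of_mem_Ioo ⟨by linarith, by linarith⟩
    have hspx : 0 < sin (p * x) := sin_pos_of_pos_of_lt_pi (mul_pos hp0 (h0.trans hx0))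
      (by nlinarith)
    have := hmono ⟨h0, h1⟩ ⟨h0.trans hx0, hx1⟩ hx0.le
    simp only [hs₀, sin_pi_div_two, div_one] at this
    rw [div_le_iff₀ hspx] at this
    rw [hrw x hcx.le]
    exact mul_nonneg (by positivity) (by linarith)


/-! ### Comparing a point of the disk with the circle point of equal real part -/

/-- The sign of the derivative is that of `α * sin ((α - 1) * arccos (ρ * c))`, which is why the
comparison reverses at `α = 1`. -/
lemma hasDerivAt_rpow_mul_cos_arccos {α c ρ : ℝ} (hρ : 0 < ρ) (h1 : -1 < ρ * c) (h2 : ρ * c < 1) :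
    HasDerivAt (fun ρ => ρ ^ (-α) * cos (α * arccos (ρ * c)))
      (α * ρ ^ (-α - 1) * sin ((α - 1) * arccos (ρ * c)) / sin (arccos (ρ * c))) ρ := by
  have hd1 : HasDerivAt (fun ρ : ℝ => ρ ^ (-α)) (-α * ρ ^ (-α - 1)) ρ :=
    hasDerivAt_rpow_const (Or.inl hρ.ne')
  have hd2 : HasDerivAt (fun ρ : ℝ => ρ * c) (1 * c) ρ := (hasDerivAt_id ρ).mul_const c
  have hd3 := ((hasDerivAt_arccos h1.ne' h2.ne).comp ρ hd2).const_mul α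
  refine (hd1.mul hd3.cos).congr_deriv ?_
  have hs : sin (arccos (ρ * c)) = √(1 - (ρ * c) ^ 2) := sin_arccos _
  have hpos : 0 < sin (arccos (ρ * c)) := by
    rw [hs]; apply sqrt_pos.2; nlinarith
  have e2 : sin ((α - 1) * arccos (ρ * c)) = sin (α * arccos (ρ * c)) * (ρ * c) -
      cos (α * arccos (ρ * c)) * sin (arccos (ρ * c)) := by
    rw [sub_mul, one_mul, sin_sub, cos_arccos h1.le h2.le]
  have e3 : ρ ^ (-α) = ρ ^ (-α - 1) * ρ := by
    rw [← rpow_add_one hρ.ne']; congr 1; ring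
  rw [← hs, e2]
  simp only [Function.comp]
  rw [e3]
  field_simp
  ring

/-- The function `ρ ↦ ρ ^ (-α) * cos (α * arccos (ρ * cos τ))` decreases for `α ≤ 1`, and equals
`cos (α * τ)` at `ρ = 1`. -/
lemma rpow_mul_cos_le_cos_arccos {α r τ : ℝ} (hα : 0 < α) (hα1 : α ≤ 1) (hr : 0 < r) (hr1 : r ≤ 1)
    (hτ : τ ∈ Set.Icc 0 π) : r ^ α * cos (α * τ) ≤ cos (α * arccos (r * cos τ)) := by
  have hcont : ContinuousOn (fun ρ => ρ ^ (-α) * cos (α * arccos (ρ * cos τ))) (Set.Icc r 1) := by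
    refine ContinuousOn.mul (fun x hx => (continuousAt_rpow_const _ _ (Or.inl ?_)).continuousWithinAt)
      ?_
    · exact (hr.trans_le hx.1).ne'
    · exact (continuous_cos.comp (continuous_const.mul (continuous_arccos.comp
        (continuous_id.mul continuous_const)))).continuousOn
  have hb : ∀ x ∈ Set.Ioo r 1, 0 < x ∧ -1 < x * cos τ ∧ x * cos τ < 1 := by
    rintro x ⟨h1, h2⟩
    have := neg_one_le_cos τ
    have := cos_le_one τ
    exact ⟨hr.trans h1, by nlinarith [hr.trans h1], by nlinarith [hr.trans h1]⟩
  have hanti : AntitoneOn (fun ρ => ρ ^ (-α) * cos (α * arccos (ρ * cos τ))) (Set.Icc r 1) := by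
    refine antitoneOn_of_deriv_nonpos (convex_Icc _ _) hcont (fun s hs => ?_) (fun s hs => ?_)
    · obtain ⟨h1, h2, h3⟩ := hb s (by simpa using hs)
      exact (hasDerivAt_rpow_mul_cos_arccos h1 h2 h3).differentiableAt.differentiableWithinAt
    · obtain ⟨h1, h2, h3⟩ := hb s (by simpa using hs)
      rw [(hasDerivAt_rpow_mul_cos_arccos h1 h2 h3).deriv]
      have h4 : 0 ≤ sin (arccos (s * cos τ)) := by rw [sin_arccos]; positivity
      have h5 : sin ((α - 1) * arccos (s * cos τ)) ≤ 0 := by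
        rw [show (α - 1) * arccos (s * cos τ) = -((1 - α) * arccos (s * cos τ)) by ring, sin_neg,
          neg_nonpos]
        have ha := arccos_nonneg (s * cos τ)
        have hb := arccos_le_pi (s * cos τ)
        exact sin_nonneg_of_nonneg_of_le_pi (mul_nonneg (by linarith) ha) (by nlinarith)
      exact div_nonpos_of_nonpos_of_nonneg (mul_nonpos_of_nonneg_of_nonpos (by positivity) h5) h4
  have := hanti ⟨le_rfl, hr1⟩ ⟨hr1, le_rfl⟩ hr1
  simp only [one_mul, one_rpow, arccos_cos hτ.1 hτ.2] at this
  have h7 : 0 < r ^ α := by positivity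
  calc r ^ α * cos (α * τ) ≤ r ^ α * (r ^ (-α) * cos (α * arccos (r * cos τ))) := by gcongr
    _ = _ := by rw [rpow_neg hr.le]; field_simp

lemma cos_arccos_le_rpow_mul_cos {α r τ : ℝ} (hα : 1 ≤ α) (hr : 0 < r) (hr1 : r ≤ 1)
    (hτ : τ ∈ Set.Icc 0 π) (h : α * τ ≤ π) (h' : α * arccos (r * cos τ) ≤ π) :
    cos (α * arccos (r * cos τ)) ≤ r ^ α * cos (α * τ) := by
  have hcont : ContinuousOn (fun ρ => ρ ^ (-α) * cos (α * arccos (ρ * cos τ))) (Set.Icc r 1) := by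
    refine ContinuousOn.mul (fun x hx => (continuousAt_rpow_const _ _ (Or.inl ?_)).continuousWithinAt)
      ?_
    · exact (hr.trans_le hx.1).ne'
    · exact (continuous_cos.comp (continuous_const.mul (continuous_arccos.comp
        (continuous_id.mul continuous_const)))).continuousOn
  have hb : ∀ x ∈ Set.Ioo r 1, 0 < x ∧ -1 < x * cos τ ∧ x * cos τ < 1 := by
    rintro x ⟨h1, h2⟩
    have := neg_one_le_cos τ
    have := cos_le_one τ
    exact ⟨hr.trans h1, by nlinarith [hr.trans h1], by nlinarith [hr.trans h1]⟩
  have hmono : MonotoneOn (fun ρ => ρ ^ (-α) * cos (α * arccos (ρ * cos τ))) (Set.Icc r 1) := by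
    refine monotoneOn_of_deriv_nonneg (convex_Icc _ _) hcont (fun s hs => ?_) (fun s hs => ?_)
    · obtain ⟨h1, h2, h3⟩ := hb s (by simpa using hs)
      exact (hasDerivAt_rpow_mul_cos_arccos h1 h2 h3).differentiableAt.differentiableWithinAt
    · have hs' : s ∈ Set.Ioo r 1 := by simpa using hs
      obtain ⟨h1, h2, h3⟩ := hb s hs'
      rw [(hasDerivAt_rpow_mul_cos_arccos h1 h2 h3).deriv]
      have h4 : 0 ≤ sin (arccos (s * cos τ)) := by rw [sin_arccos]; positivity
      have ha := arccos_nonneg (s * cos τ)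
      -- The angle at an intermediate radius is at most the larger of the two end angles, which are
      -- controlled by `h` and `h'`.
      have hle : α * arccos (s * cos τ) ≤ π := by
        rcases le_total 0 (cos τ) with hc | hc
        · exact le_trans (by gcongr; exact hs'.1.le) h'
        · have : arccos (s * cos τ) ≤ arccos (cos τ) :=
            antitone_arccos (by nlinarith [hs'.2])
          rw [arccos_cos hτ.1 hτ.2] at this
          exact le_trans (by gcongr) h
      have h5 : 0 ≤ sin ((α - 1) * arccos (s * cos τ)) :=
        sin_nonneg_of_nonneg_of_le_pi (mul_nonneg (by linarith) ha) (by nlinarith)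
      positivity
  have := hmono ⟨le_rfl, hr1⟩ ⟨hr1, le_rfl⟩ hr1
  simp only [one_mul, one_rpow, arccos_cos hτ.1 hτ.2] at this
  have h7 : 0 < r ^ α := by positivity
  calc cos (α * arccos (r * cos τ)) = r ^ α * (r ^ (-α) * cos (α * arccos (r * cos τ))) := by
        rw [rpow_neg hr.le]; field_simp
    _ ≤ _ := by gcongr

lemma cos_pi_div_nonneg {p : ℝ} (hp : 2 ≤ p) : 0 ≤ cos (π / p) :=
  cos_nonneg_of_neg_pi_div_two_le_of_le
    (by have := pi_pos; have : 0 ≤ π / p := by positivity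
        linarith)
    (by gcongr)

lemma cos_pi_div_nonpos {p : ℝ} (hp : 1 < p) (hp2 : p ≤ 2) : cos (π / p) ≤ 0 := by
  have hpi := pi_pos
  refine cos_nonpos_of_pi_div_two_le_of_le (by gcongr) ?_
  have : π / p ≤ π := div_le_self hpi.le hp.le
  linarith

lemma abs_cos_pi_div_lt_one {p : ℝ} (hp : 1 < p) : |cos (π / p)| < 1 := by
  have hpi := pi_pos
  have h1 : 0 < π / p := by positivity
  have h2 : π / p < π := div_lt_self hpi hp
  rw [abs_lt]
  constructor
  · rw [← cos_pi]; exact cos_lt_cos_of_nonneg_of_le_pi h1.le le_rfl h2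
  · rw [← cos_zero]; exact cos_lt_cos_of_nonneg_of_le_pi le_rfl h2.le h1

/-- On the unit circle, the pointwise inequality for exponents `p ≥ 2`. -/
lemma one_le_one_sub_cos_rpow_add {p x : ℝ} (hp : 2 ≤ p) (hx : x ∈ Set.Icc 0 π) :
    1 ≤ ((1 - cos x) / (1 - |cos (π / p)|)) ^ (p / 2) +
      cos (π / 2 / p) / sin (π / 2 / p) * cos (p / 2 * min x (2 * π / p)) := by
  have hp0 : 0 < p := by linarith
  have hpi := pi_pos
  have hden := abs_cos_pi_div_lt_one (show 1 < p by linarith)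
  have h2p : 2 * π / p ≤ π := by rw [div_le_iff₀ hp0]; nlinarith
  have base : ∀ x ∈ Set.Icc 0 (2 * π / p), 1 ≤ ((1 - cos x) / (1 - |cos (π / p)|)) ^ (p / 2) +
      cos (π / 2 / p) / sin (π / 2 / p) * cos (p / 2 * x) := by
    rintro x ⟨hx0, hx1⟩
    have := one_le_sin_rpow_add (s₀ := π / 2 / p) (s := x / 2) hp (by field_simp)
      ⟨by positivity, by rw [div_le_iff₀ (by norm_num)]; convert hx1 using 1; ring⟩
    convert this using 2
    · have e1 : (1 - cos x) / (1 - |cos (π / p)|) = (sin (x / 2) / sin (π / 2 / p)) ^ 2 := by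
        rw [abs_of_nonneg (cos_pi_div_nonneg hp)]
        rw [div_pow, sin_sq_eq_half_sub, sin_sq_eq_half_sub]
        rw [show 2 * (x / 2) = x by ring, show 2 * (π / 2 / p) = π / p by ring]
        rw [← mul_div_mul_left _ (1 - cos (π / p)) (show (1 / 2 : ℝ) ≠ 0 by norm_num)]
        congr 1 <;> ring
      have hpp : 0 ≤ sin (x / 2) / sin (π / 2 / p) := by
        refine div_nonneg (sin_nonneg_of_nonneg_of_le_pi (by positivity) (by linarith))
          (sin_nonneg_of_nonneg_of_le_pi (by positivity) ?_)
        rw [div_le_iff₀ hp0]; nlinarith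
      rw [e1, ← rpow_natCast, ← rpow_mul hpp]
      congr 1; push_cast; ring
    · ring_nf
  -- Beyond `2 * π / p` the cosine term is frozen while `1 - cos x` still grows.
  rcases le_total x (2 * π / p) with h | h
  · rw [min_eq_left h]; exact base x ⟨hx.1, h⟩
  · rw [min_eq_right h]
    refine (base _ ⟨by positivity, le_rfl⟩).trans ?_
    have : cos x ≤ cos (2 * π / p) := cos_le_cos_of_nonneg_of_le_pi (by positivity) hx.2 h
    have h3 := cos_le_one (2 * π / p)
    gcongr

/-- The pointwise inequality for exponents `p ≥ 2`, in polar coordinates in the unit disk. -/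
lemma one_le_one_sub_mul_cos_rpow_add {p x r : ℝ} (hp : 2 ≤ p) (hx : x ∈ Set.Icc 0 π)
    (hr : r ∈ Set.Icc 0 1) :
    1 ≤ ((1 - r * cos x) / (1 - |cos (π / p)|)) ^ (p / 2) +
      cos (π / 2 / p) / sin (π / 2 / p) * (r ^ (p / 2) * cos (p / 2 * min x (2 * π / p))) := by
  have hp0 : 0 < p := by linarith
  have hpi := pi_pos
  have hden := abs_cos_pi_div_lt_one (show 1 < p by linarith)
  have h2p : 2 * π / p ≤ π := by rw [div_le_iff₀ hp0]; nlinarith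
  have hK : 0 ≤ cos (π / 2 / p) / sin (π / 2 / p) := by
    have h0 : 0 ≤ π / 2 / p := by positivity
    have h1 : π / 2 / p ≤ π / 2 := div_le_self (by positivity) (by linarith)
    exact div_nonneg (cos_nonneg_of_neg_pi_div_two_le_of_le (by linarith) h1)
      (sin_nonneg_of_nonneg_of_le_pi h0 (by linarith))
  rcases hr.1.eq_or_lt with h0 | h0
  · subst h0
    rw [zero_rpow (by positivity)]
    simp only [zero_mul, sub_zero, mul_zero, add_zero]
    refine one_le_rpow ?_ (by positivity)
    rw [le_div_iff₀ (by linarith)]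
    have := abs_nonneg (cos (π / p))
    linarith
  have main : ∀ x ∈ Set.Icc 0 (2 * π / p), 1 ≤ ((1 - r * cos x) / (1 - |cos (π / p)|)) ^ (p / 2) +
      cos (π / 2 / p) / sin (π / 2 / p) * (r ^ (p / 2) * cos (p / 2 * x)) := by
    rintro x ⟨hx0, hx1⟩
    have hxpi : x ∈ Set.Icc 0 π := ⟨hx0, hx1.trans h2p⟩
    have h1 := neg_one_le_cos x
    have h2 := cos_le_one x
    -- The circle point at angle `arccos (r * cos x)` has the same real part as the given point of
    -- the disk.
    have hcc : cos (arccos (r * cos x)) = r * cos x :=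
      cos_arccos (by nlinarith [hr.2]) (by nlinarith [hr.2])
    have key := one_le_one_sub_cos_rpow_add hp (x := arccos (r * cos x))
      ⟨arccos_nonneg _, arccos_le_pi _⟩
    rw [hcc] at key
    refine key.trans ?_
    gcongr
    rcases le_total (arccos (r * cos x)) (2 * π / p) with h | h
    · rw [min_eq_left h]
      refine cos_arccos_le_rpow_mul_cos (by linarith) h0 hr.2 hxpi ?_ ?_
      · calc p / 2 * x ≤ p / 2 * (2 * π / p) := by gcongr
          _ = π := by field_simp
      · calc p / 2 * arccos (r * cos x) ≤ p / 2 * (2 * π / p) := by gcongr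
          _ = π := by field_simp
    -- Here the frozen cosine has the value `-1`, below which `r ^ (p / 2) * cos (p / 2 * x)` cannot
    -- fall.
    · rw [min_eq_right h, show p / 2 * (2 * π / p) = π by field_simp, cos_pi]
      have h3 := neg_one_le_cos (p / 2 * x)
      have h4 : r ^ (p / 2) ≤ 1 := rpow_le_one h0.le hr.2 (by positivity)
      have h5 : 0 ≤ r ^ (p / 2) := by positivity
      nlinarith
  rcases le_total x (2 * π / p) with h | h
  · rw [min_eq_left h]; exact main x ⟨hx.1, h⟩
  · rw [min_eq_right h]
    refine (main _ ⟨by positivity, le_rfl⟩).trans ?_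
    have : cos x ≤ cos (2 * π / p) := cos_le_cos_of_nonneg_of_le_pi (by positivity) hx.2 h
    have h3 := cos_le_one (2 * π / p)
    have h4 := neg_one_le_cos (2 * π / p)
    gcongr
    · exact div_nonneg (by nlinarith [hr.2]) (by linarith)

/-- The pointwise inequality for exponents `p ≤ 2`, in polar coordinates in the unit disk. -/
lemma one_le_one_add_mul_cos_rpow_sub {p τ r : ℝ} (hp : 1 < p) (hp2 : p ≤ 2)
    (hτ : τ ∈ Set.Icc 0 π) (hr : r ∈ Set.Icc 0 1) :
    1 ≤ ((1 + r * cos τ) / (1 - |cos (π / p)|)) ^ (p / 2) -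
      sin (π / 2 / p) / cos (π / 2 / p) * (r ^ (p / 2) * cos (p / 2 * τ)) := by
  have hp0 : 0 < p := by linarith
  have hpi := pi_pos
  have hden := abs_cos_pi_div_lt_one hp
  have h0' : 0 ≤ π / 2 / p := by positivity
  have h1' : π / 2 / p ≤ π / 2 := div_le_self (by positivity) (by linarith)
  have hcos : 0 ≤ cos (π / 2 / p) := cos_nonneg_of_neg_pi_div_two_le_of_le (by linarith) h1'
  have hK : 0 ≤ sin (π / 2 / p) / cos (π / 2 / p) :=
    div_nonneg (sin_nonneg_of_nonneg_of_le_pi h0' (by linarith)) hcos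
  rcases hr.1.eq_or_lt with h0 | h0
  · subst h0
    rw [zero_rpow (by positivity)]
    simp only [zero_mul, add_zero, mul_zero, sub_zero]
    refine one_le_rpow ?_ (by positivity)
    rw [le_div_iff₀ (by linarith)]
    have := abs_nonneg (cos (π / p))
    linarith
  have base : ∀ x ∈ Set.Icc 0 π, 1 ≤ ((1 + cos x) / (1 - |cos (π / p)|)) ^ (p / 2) -
      sin (π / 2 / p) / cos (π / 2 / p) * cos (p / 2 * x) := by
    rintro x ⟨hx0, hx1⟩
    have := one_le_cos_rpow_sub (s₀ := π / 2 / p) (s := x / 2) hp hp2 (by field_simp)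
      ⟨by positivity, by linarith⟩
    convert this using 2
    · have e1 : (1 + cos x) / (1 - |cos (π / p)|) = (cos (x / 2) / cos (π / 2 / p)) ^ 2 := by
        rw [abs_of_nonpos (cos_pi_div_nonpos hp hp2)]
        rw [div_pow, cos_sq, cos_sq]
        rw [show 2 * (x / 2) = x by ring, show 2 * (π / 2 / p) = π / p by ring]
        rw [← mul_div_mul_left _ (1 - -cos (π / p)) (show (1 / 2 : ℝ) ≠ 0 by norm_num)]
        congr 1 <;> ring
      have hpp : 0 ≤ cos (x / 2) / cos (π / 2 / p) :=
        div_nonneg (cos_nonneg_of_neg_pi_div_two_le_of_le (by linarith) (by linarith)) hcos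
      rw [e1, ← rpow_natCast, ← rpow_mul hpp]
      congr 1; push_cast; ring
    · ring_nf
  have h1 := neg_one_le_cos τ
  have h2 := cos_le_one τ
  have hcc : cos (arccos (r * cos τ)) = r * cos τ :=
    cos_arccos (by nlinarith [hr.2]) (by nlinarith [hr.2])
  have key := base (arccos (r * cos τ)) ⟨arccos_nonneg _, arccos_le_pi _⟩
  rw [hcc] at key
  refine key.trans ?_
  gcongr
  exact rpow_mul_cos_le_cos_arccos (by linarith) (by linarith) h0 hr.2 hτ


/-! ### Sub-mean value property -/

/-- Trigonometric polynomials are uniformly dense on the circle, and each is `Q₁ + conj Q₂` with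
`Q₁`, `Q₂` entire. This solves the Dirichlet problem approximately. -/
lemma exists_re_approx {F : ℂ → ℝ} {R : ℝ} (hR : 0 < R) (hF : ContinuousOn F (sphere 0 R)) {ε : ℝ}
    (hε : 0 < ε) :
    ∃ Q : ℂ → ℂ, Differentiable ℂ Q ∧ ∀ z ∈ sphere (0 : ℂ) R, |(Q z).re - F z| ≤ ε := by
  have : Fact (0 < 2 * π) := ⟨two_pi_pos⟩
  have hmem : ∀ x : AddCircle (2 * π), (R * (AddCircle.toCircle x : ℂ)) ∈ sphere (0 : ℂ) R := by
    intro x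
    rw [mem_sphere_zero_iff_norm, norm_mul, Circle.norm_coe, Complex.norm_real, norm_eq_abs,
      abs_of_pos hR, mul_one]
  let b : C(AddCircle (2 * π), ℂ) :=
    ⟨fun x => (F (R * (AddCircle.toCircle x : ℂ)) : ℂ), by
      refine Complex.continuous_ofReal.comp (hF.comp_continuous ?_ hmem)
      exact continuous_const.mul (continuous_subtype_val.comp AddCircle.continuous_toCircle)⟩
  have hb : b ∈ (Submodule.span ℂ (Set.range (@fourier (2 * π)))).topologicalClosure := by
    rw [span_fourier_closure_eq_top]; trivial
  rw [← SetLike.mem_coe, Submodule.topologicalClosure_coe, Metric.mem_closure_iff] at hb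
  obtain ⟨T, hT, hdist⟩ := hb ε hε
  have hQ : ∃ Q₁ Q₂ : ℂ → ℂ, Differentiable ℂ Q₁ ∧ Differentiable ℂ Q₂ ∧
      ∀ x : AddCircle (2 * π), T x = Q₁ (R * (AddCircle.toCircle x : ℂ)) +
        (starRingEnd ℂ) (Q₂ (R * (AddCircle.toCircle x : ℂ))) := by
    have hRc : (R : ℂ) ≠ 0 := by exact_mod_cast hR.ne'
    clear hdist
    induction hT using Submodule.span_induction with
    | mem f hf =>
      obtain ⟨n, rfl⟩ := hf
      have key : ∀ (k : ℕ) (x : AddCircle (2 * π)),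
          (R * (AddCircle.toCircle x : ℂ) / R) ^ k = (AddCircle.toCircle x : ℂ) ^ k := by
        intro k x
        rw [mul_div_cancel_left₀ _ hRc]
      rcases n.eq_nat_or_neg with ⟨k, rfl | rfl⟩
      · refine ⟨fun z => (z / R) ^ k, fun _ => 0, by fun_prop, by fun_prop, fun x => ?_⟩
        simp only [key]
        simp [fourier_apply, AddCircle.toCircle_nsmul]
      · refine ⟨fun _ => 0, fun z => (z / R) ^ k, by fun_prop, by fun_prop, fun x => ?_⟩
        simp only [key]
        simp [fourier_apply, AddCircle.toCircle_nsmul, AddCircle.toCircle_neg,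
          ← Circle.coe_inv_eq_conj]
    | zero => exact ⟨fun _ => 0, fun _ => 0, by fun_prop, by fun_prop, by simp⟩
    | add f g _ _ hf hg =>
      obtain ⟨A, B, hA, hB, h1⟩ := hf
      obtain ⟨A', B', hA', hB', h2⟩ := hg
      refine ⟨A + A', B + B', hA.add hA', hB.add hB', fun x => ?_⟩
      simp only [ContinuousMap.add_apply, h1, h2, Pi.add_apply, map_add]
      ring
    | smul c f _ hf =>
      obtain ⟨A, B, hA, hB, h1⟩ := hf
      refine ⟨fun z => c * A z, fun z => (starRingEnd ℂ) c * B z, by fun_prop, by fun_prop,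
        fun x => ?_⟩
      simp only [ContinuousMap.smul_apply, h1, smul_eq_mul, map_mul, Complex.conj_conj]
      ring
  obtain ⟨Q₁, Q₂, h1, h2, h3⟩ := hQ
  -- Conjugating `Q₂` does not change its real part.
  refine ⟨fun z => Q₁ z + Q₂ z, h1.add h2, fun z hz => ?_⟩
  obtain ⟨x, rfl⟩ : ∃ x : AddCircle (2 * π), z = R * (AddCircle.toCircle x : ℂ) := by
    refine ⟨((z.arg : ℝ) : AddCircle (2 * π)), ?_⟩
    have hz' : ‖z‖ = R := by simpa using hz
    rw [AddCircle.toCircle_apply_mk, div_self two_pi_pos.ne', one_mul, Circle.coe_exp, ← hz',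
      Complex.norm_mul_exp_arg_mul_I]
  have h4 : ‖T x - b x‖ ≤ ε := by
    have := (ContinuousMap.norm_coe_le_norm (T - b) x)
    rw [← dist_eq_norm, dist_comm] at this
    exact this.trans hdist.le
  refine le_trans (le_of_eq ?_) ((Complex.abs_re_le_norm _).trans h4)
  rw [h3]
  simp [b]

/-- `V` has, at every point other than the origin, a local support function from below that is the
real part of a branch of a power. -/
def HasPowerSupport (α : ℝ) (V : ℂ → ℝ) : Prop :=
  ∀ u₀ : ℂ, u₀ ≠ 0 → ∃ C : ℂ, C.re = V u₀ ∧ ∀ᶠ u in 𝓝 u₀, (C * (u / u₀) ^ (α : ℂ)).re ≤ V u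

/-- Used to pass from a maximum point to another one of larger modulus. -/
lemma exists_norm_gt_of_eventually {z₀ : ℂ} {P : ℂ → Prop} (h : ∀ᶠ z in 𝓝 z₀, P z) :
    ∃ z, P z ∧ ‖z₀‖ < ‖z‖ := by
  obtain ⟨v, hv⟩ : ∃ v : ℂ, ∀ t : ℝ, 0 < t → ‖z₀‖ < ‖z₀ + t * v‖ := by
    rcases eq_or_ne z₀ 0 with rfl | h0
    · exact ⟨1, fun t ht => by simpa using ht.ne'⟩
    · refine ⟨z₀, fun t ht => ?_⟩
      have : z₀ + t * z₀ = ((1 + t : ℝ) : ℂ) * z₀ := by push_cast; ring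
      rw [this, norm_mul, Complex.norm_real, norm_eq_abs, abs_of_pos (by linarith)]
      have := norm_pos_iff.2 h0
      nlinarith
  have hc : Tendsto (fun t : ℝ => z₀ + t * v) (𝓝[>] 0) (𝓝 z₀) := by
    have : Tendsto (fun t : ℝ => z₀ + t * v) (𝓝 0) (𝓝 (z₀ + (0 : ℝ) * v)) :=
      Continuous.tendsto (by fun_prop) 0
    simp only [Complex.ofReal_zero, zero_mul, add_zero] at this
    exact this.mono_left nhdsWithin_le_nhds
  obtain ⟨t, ht, ht0⟩ := ((hc.eventually h).and self_mem_nhdsWithin).exists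
  exact ⟨_, ht, hv t ht0⟩

/-- A maximum principle: near a point where `φ ≠ 0`, the function `V ∘ φ - Re Q` is supported from
below by the real part of a holomorphic function. Zeros of `φ`, where no support is given, are ruled
out as maximum points by a factor `(‖φ‖ / M) ^ δ`, with `δ → 0` at the end. -/
lemma HasPowerSupport.le_of_le_sphere {α : ℝ} {V : ℂ → ℝ} (hV : HasPowerSupport α V)
    (hVc : Continuous V) {φ Q : ℂ → ℂ} {R ε : ℝ} (hR1 : R < 1)
    (hφ : DifferentiableOn ℂ φ (ball 0 1)) (hQ : Differentiable ℂ Q)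
    (hb : ∀ z ∈ sphere (0 : ℂ) R, V (φ z) - (Q z).re ≤ ε) {z : ℂ} (hz : z ∈ closedBall (0 : ℂ) R)
    (hφz : φ z ≠ 0) : V (φ z) - (Q z).re ≤ ε := by
  have hsub : closedBall (0 : ℂ) R ⊆ ball 0 1 := closedBall_subset_ball hR1
  have hφc : ContinuousOn φ (closedBall 0 R) := hφ.continuousOn.mono hsub
  have hK := isCompact_closedBall (0 : ℂ) R
  obtain ⟨M, hM⟩ := hK.exists_bound_of_continuousOn hφc
  have hMpos : 0 < M := (norm_pos_iff.2 hφz).trans_le (hM z hz)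
  have claim : ∀ δ : ℝ, 0 < δ → ∀ z ∈ closedBall (0 : ℂ) R,
      exp (V (φ z) - (Q z).re) * (‖φ z‖ / M) ^ δ ≤ exp ε := by
    intro δ hδ
    set E : ℂ → ℝ := fun z => exp (V (φ z) - (Q z).re) * (‖φ z‖ / M) ^ δ with hE
    have hEc : ContinuousOn E (closedBall 0 R) := by
      refine ContinuousOn.mul (continuous_exp.comp_continuousOn ((hVc.comp_continuousOn hφc).sub
        (Complex.continuous_re.comp hQ.continuous).continuousOn)) ?_
      exact (hφc.norm.div_const _).rpow_const fun _ _ => Or.inr hδ.le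
    obtain ⟨z₁, hz₁, hmax⟩ := hK.exists_isMaxOn ⟨z, hz⟩ hEc
    by_contra! hcon
    obtain ⟨z₂, hz₂, hz₂'⟩ := hcon
    have hm : exp ε < E z₁ := hz₂'.trans_le (hmax hz₂)
    -- A maximum point of largest modulus is chosen; the argument below produces one still farther
    -- out.
    set S := closedBall (0 : ℂ) R ∩ E ⁻¹' {E z₁}
    have hS : IsCompact S :=
      hK.of_isClosed_subset (hEc.preimage_isClosed_of_isClosed isClosed_closedBall
        isClosed_singleton) Set.inter_subset_left
    obtain ⟨z₀, ⟨hz₀, hEz₀⟩, hfar⟩ := hS.exists_isMaxOn ⟨z₁, hz₁, rfl⟩ continuous_norm.continuousOn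
    have hEz₀ : E z₀ = E z₁ := hEz₀
    have hz₀R : ‖z₀‖ < R := by
      refine lt_of_le_of_ne (by simpa using hz₀) fun heq => ?_
      have h1 := hb z₀ (by simpa using heq)
      have h2 : (‖φ z₀‖ / M) ^ δ ≤ 1 :=
        rpow_le_one (by positivity) ((div_le_one hMpos).2 (hM z₀ hz₀)) hδ.le
      have h3 : E z₀ ≤ exp ε * 1 := by
        simp only [hE]; gcongr
      linarith
    have hφ0 : φ z₀ ≠ 0 := by
      intro h0
      have : E z₀ = 0 := by simp [hE, h0, zero_rpow hδ.ne']
      have := exp_pos ε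
      linarith
    obtain ⟨C, hC, hCle⟩ := hV (φ z₀) hφ0
    have hnhds : ball (0 : ℂ) 1 ∈ 𝓝 z₀ := isOpen_ball.mem_nhds (hsub hz₀)
    have hφat : ContinuousAt φ z₀ := hφ.continuousOn.continuousAt hnhds
    -- Near `z₀` this function is holomorphic, since `φ z / φ z₀` is close to `1`; its modulus is at
    -- most `E` there and equals `E` at `z₀`.
    set ψ : ℂ → ℂ := fun z => Complex.exp (C * (φ z / φ z₀) ^ (α : ℂ) - Q z) *
      ((φ z / φ z₀) ^ (δ : ℂ) * ((‖φ z₀‖ / M) ^ δ : ℝ)) with hψ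
    have hψn : ∀ z, ‖ψ z‖ = exp ((C * (φ z / φ z₀) ^ (α : ℂ)).re - (Q z).re) *
        (‖φ z‖ / M) ^ δ := by
      intro z
      simp only [hψ]
      rw [norm_mul, Complex.norm_exp, Complex.sub_re, norm_mul, Complex.norm_cpow_real,
        Complex.norm_real, norm_eq_abs, abs_of_nonneg (by positivity), norm_div,
        ← mul_rpow (by positivity) (by positivity)]
      congr 2
      field_simp [norm_ne_zero_iff.2 hφ0]
    have hψle : ∀ᶠ z in 𝓝 z₀, ‖ψ z‖ ≤ E z := by
      filter_upwards [hφat.eventually hCle] with z hz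
      rw [hψn]
      simp only [hE]
      gcongr
    have hψ0 : ‖ψ z₀‖ = E z₀ := by
      rw [hψn, div_self hφ0, Complex.one_cpow, mul_one, hC]
    have hin : ∀ᶠ z in 𝓝 z₀, z ∈ closedBall (0 : ℂ) R :=
      Filter.mem_of_superset (isOpen_ball.mem_nhds (by simpa using hz₀R)) ball_subset_closedBall
    have hlm : IsLocalMax (norm ∘ ψ) z₀ := by
      filter_upwards [hψle, hin] with z h1 h2
      simp only [Function.comp]
      rw [hψ0, hEz₀]
      exact h1.trans (hmax h2)
    have hslit : ∀ᶠ z in 𝓝 z₀, φ z / φ z₀ ∈ Complex.slitPlane := by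
      have : ContinuousAt (fun z => φ z / φ z₀) z₀ := hφat.div_const _
      refine this.eventually (Complex.isOpen_slitPlane.mem_nhds ?_)
      simp only [div_self hφ0]
      exact Complex.one_mem_slitPlane
    have hdiff : ∀ᶠ z in 𝓝 z₀, DifferentiableAt ℂ ψ z := by
      filter_upwards [hslit, isOpen_ball.mem_nhds (hsub hz₀)] with z h1 h2
      have hd : DifferentiableAt ℂ (fun z => φ z / φ z₀) z :=
        (hφ.differentiableAt (isOpen_ball.mem_nhds h2)).div_const _
      have hdQ := hQ z
      have hp : ∀ c : ℂ, DifferentiableAt ℂ (fun z => (φ z / φ z₀) ^ c) z := fun c =>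
        hd.cpow_const h1
      exact (((hp α).const_mul C).sub hdQ).cexp.mul ((hp δ).mul_const _)
    -- By the maximum modulus principle `‖ψ‖` is constant near `z₀`, which forces `E` to attain its
    -- maximum at all nearby points.
    have heq := Complex.norm_eventually_eq_of_isLocalMax hdiff hlm
    obtain ⟨w, ⟨h1, h2, h3⟩, h4⟩ := exists_norm_gt_of_eventually (heq.and (hψle.and hin))
    have hw : w ∈ S := ⟨h3, le_antisymm (hmax h3) (by
      rw [← hEz₀, ← hψ0, ← h1]; exact h2)⟩
    exact absurd (hfar hw) (not_le.2 h4)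
  have hlim : Tendsto (fun δ : ℝ => exp (V (φ z) - (Q z).re) * (‖φ z‖ / M) ^ δ) (𝓝[>] 0)
      (𝓝 (exp (V (φ z) - (Q z).re) * (‖φ z‖ / M) ^ (0 : ℝ))) := by
    refine Tendsto.const_mul _ ?_
    exact ((continuousAt_const_rpow (div_pos (norm_pos_iff.2 hφz) hMpos).ne').tendsto).mono_left
      nhdsWithin_le_nhds
  rw [rpow_zero, mul_one] at hlim
  have := le_of_tendsto hlim (by
    filter_upwards [self_mem_nhdsWithin] with δ hδ using claim δ hδ z hz)
  exact exp_le_exp.1 this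

/-- `Re Q` is close to `V ∘ φ` on the circle, dominates it inside up to the error, and has the exact
mean value property. -/
lemma HasPowerSupport.le_circleAverage {α : ℝ} {V : ℂ → ℝ} (hV : HasPowerSupport α V)
    (hVc : Continuous V) {φ : ℂ → ℂ} {R : ℝ} (hR : 0 < R) (hR1 : R < 1)
    (hφ : DifferentiableOn ℂ φ (ball 0 1)) :
    V (φ 0) ≤ circleAverage (fun z => V (φ z)) 0 R := by
  have hsub : closedBall (0 : ℂ) R ⊆ ball 0 1 := closedBall_subset_ball hR1
  have hφc : ContinuousOn φ (closedBall 0 R) := hφ.continuousOn.mono hsub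
  have hVφc : ContinuousOn (fun z => V (φ z)) (closedBall 0 R) := hVc.comp_continuousOn hφc
  have h0 : (0 : ℂ) ∈ ball (0 : ℂ) 1 := by simp
  by_cases hfreq : ∃ᶠ z in 𝓝 (0 : ℂ), φ z ≠ 0
  · refine le_of_forall_pos_le_add fun ε hε => ?_
    obtain ⟨Q, hQ, hQF⟩ := exists_re_approx hR (hVφc.mono sphere_subset_closedBall)
      (half_pos hε)
    have h1 : V (φ 0) - (Q 0).re ≤ ε / 2 := by
      have hc : ContinuousAt (fun z => V (φ z) - (Q z).re) 0 :=
        (hVφc.continuousAt (closedBall_mem_nhds 0 hR)).sub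
          (Complex.continuous_re.comp hQ.continuous).continuousAt
      have hcl : IsClosed (Set.Iic (ε / 2)) := isClosed_Iic
      -- The maximum principle applies where `φ ≠ 0`; the centre is reached as a limit of such
      -- points.
      refine hcl.mem_of_frequently_of_tendsto ?_ hc.tendsto
      refine (hfreq.and_eventually (closedBall_mem_nhds (0 : ℂ) hR)).mono ?_
      rintro z ⟨h1, h2⟩
      exact hV.le_of_le_sphere hVc hR1 hφ hQ
        (fun w hw => by have := abs_le.1 (hQF w hw); linarith) h2 h1
    have hQre : circleAverage (fun z => (Q z).re) 0 R = (Q 0).re := by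
      have hQd : DiffContOnCl ℂ Q (ball 0 |R|) := hQ.diffContOnCl
      have := Complex.reCLM.circleAverage_comp_comm (f := Q) (c := 0) (R := R)
        (hQ.continuous.continuousOn.circleIntegrable')
      rw [hQd.circleAverage] at this
      exact this
    have hi1 : CircleIntegrable (fun z => (Q z).re) 0 R :=
      (Complex.continuous_re.comp hQ.continuous).continuousOn.circleIntegrable'
    have hi2 : CircleIntegrable (fun z => V (φ z)) 0 R :=
      (hVφc.mono sphere_subset_closedBall).circleIntegrable hR.le
    have h2 : circleAverage (fun z => (Q z).re) 0 R ≤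
        circleAverage (fun z => V (φ z) + ε / 2) 0 R := by
      refine circleAverage_mono hi1 (hi2.add (circleIntegrable_const _ _ _)) fun z hz => ?_
      rw [abs_of_pos hR] at hz
      have := abs_le.1 (hQF z hz)
      linarith
    rw [circleAverage_fun_add hi2 (circleIntegrable_const _ _ _), circleAverage_const, hQre] at h2
    linarith
  -- In the remaining case `φ` vanishes identically, by the identity theorem.
  · have hz : ∀ᶠ z in 𝓝 (0 : ℂ), φ z = 0 := by simpa [Filter.not_frequently] using hfreq
    have han : AnalyticOnNhd ℂ φ (ball 0 1) := hφ.analyticOnNhd isOpen_ball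
    have hzero := han.eqOn_zero_of_preconnected_of_eventuallyEq_zero
      (convex_ball _ _).isPreconnected h0 hz
    have : circleAverage (fun z => V (φ z)) 0 R = V 0 := by
      refine circleAverage_const_on_circle fun z hz => ?_
      rw [abs_of_pos hR] at hz
      rw [hzero (hsub (sphere_subset_closedBall hz))]
      rfl
    rw [this, hzero h0]
    exact le_rfl


/-! ### The subharmonic majorant -/

/-- The angular part of the subharmonic function used in the pointwise inequality. -/
def angularPart (p τ : ℝ) : ℝ :=
  if p ≤ 2 then cos (p / 2 * τ) else -cos (p / 2 * min (π - τ) (2 * π / p))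

/-- A subharmonic function, homogeneous of degree `p / 2`. -/
def powerSubharmonic (p : ℝ) (u : ℂ) : ℝ :=
  ‖u‖ ^ (p / 2) * angularPart p (arccos (u.re / ‖u‖))

lemma continuous_angularPart (p : ℝ) : Continuous (angularPart p) := by
  unfold angularPart
  split_ifs
  · fun_prop
  · fun_prop

lemma abs_angularPart_le_one (p τ : ℝ) : |angularPart p τ| ≤ 1 := by
  unfold angularPart
  split_ifs
  · exact abs_cos_le_one _
  · rw [abs_neg]; exact abs_cos_le_one _

lemma angularPart_nonneg {p τ : ℝ} (hp : 1 < p) (hτ : τ ∈ Set.Icc 0 (π / 2)) :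
    0 ≤ angularPart p τ := by
  have hpi := pi_pos
  unfold angularPart
  split_ifs with h
  · have h1 := hτ.1
    refine cos_nonneg_of_neg_pi_div_two_le_of_le ?_ ?_
    · have : 0 ≤ p / 2 * τ := by positivity
      linarith
    · nlinarith [hτ.2]
  · push Not at h
    have hp0 : 0 < p := by linarith
    rw [neg_nonneg]
    have e : p / 2 * (2 * π / p) = π := by field_simp
    refine cos_nonpos_of_pi_div_two_le_of_le ?_ ?_
    · rw [mul_min_of_nonneg _ _ (by positivity), e]
      refine le_min ?_ (by linarith)
      nlinarith [hτ.2]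
    · rw [mul_min_of_nonneg _ _ (by positivity), e]
      exact (min_le_right _ _).trans (by linarith)

lemma continuous_powerSubharmonic {p : ℝ} (hp : 1 < p) : Continuous (powerSubharmonic p) := by
  refine continuous_iff_continuousAt.2 fun u => ?_
  rcases eq_or_ne u 0 with rfl | hu
  · have h1 : Tendsto (fun u : ℂ => ‖u‖ ^ (p / 2)) (𝓝 0) (𝓝 0) := by
      have : Continuous (fun u : ℂ => ‖u‖ ^ (p / 2)) :=
        continuous_norm.rpow_const fun _ => Or.inr (by linarith)
      have h := this.tendsto 0
      rwa [norm_zero, zero_rpow (by linarith)] at h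
    have h0 : powerSubharmonic p 0 = 0 := by
      simp [powerSubharmonic, zero_rpow (show p / 2 ≠ 0 by linarith)]
    rw [ContinuousAt, h0]
    refine squeeze_zero_norm (fun u => ?_) h1
    rw [powerSubharmonic, norm_mul, norm_eq_abs, norm_eq_abs, abs_of_nonneg (by positivity)]
    exact mul_le_of_le_one_right (by positivity) (abs_angularPart_le_one _ _)
  · have hn : ‖u‖ ≠ 0 := norm_ne_zero_iff.2 hu
    refine ContinuousAt.mul (continuous_norm.continuousAt.rpow_const (Or.inl hn)) ?_
    refine (continuous_angularPart p).continuousAt.comp (continuous_arccos.continuousAt.comp ?_)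
    exact Complex.continuous_re.continuousAt.div continuous_norm.continuousAt hn

/-- This is where the sign of `Re (g(0)h(0))` enters. -/
lemma powerSubharmonic_nonneg {p : ℝ} (hp : 1 < p) {u : ℂ} (hu : 0 ≤ u.re) :
    0 ≤ powerSubharmonic p u := by
  refine mul_nonneg (by positivity) (angularPart_nonneg hp ⟨arccos_nonneg _, ?_⟩)
  rw [arccos_le_pi_div_two]
  positivity

lemma powerSubharmonic_smul {p : ℝ} {t : ℝ} (ht : 0 < t) (u : ℂ) :
    powerSubharmonic p (t * u) = t ^ (p / 2) * powerSubharmonic p u := by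
  unfold powerSubharmonic
  rw [norm_mul, Complex.norm_real, norm_eq_abs, abs_of_pos ht, Complex.re_ofReal_mul,
    mul_div_mul_left _ _ ht.ne', mul_rpow ht.le (norm_nonneg _), mul_assoc]

/-- The witness `K` is the tangent of `π / 2 / p` for `p ≤ 2` and its cotangent for `p > 2`, the
slopes found in the trigonometric inequalities. -/
lemma exists_one_le_sub_powerSubharmonic {p : ℝ} (hp : 1 < p) : ∃ K : ℝ, 0 ≤ K ∧
    ∀ u : ℂ, ‖u‖ ≤ 1 →
      1 ≤ ((1 + u.re) / (1 - |cos (π / p)|)) ^ (p / 2) - K * powerSubharmonic p u := by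
  have hpi := pi_pos
  have hp0 : 0 < p := by linarith
  have h0 : 0 ≤ π / 2 / p := by positivity
  have h1 : π / 2 / p ≤ π / 2 := div_le_self (by positivity) (by linarith)
  have hc : 0 ≤ cos (π / 2 / p) := cos_nonneg_of_neg_pi_div_two_le_of_le (by linarith) h1
  have hs : 0 ≤ sin (π / 2 / p) := sin_nonneg_of_nonneg_of_le_pi h0 (by linarith)
  have hre : ∀ u : ℂ, ‖u‖ * cos (arccos (u.re / ‖u‖)) = u.re := by
    intro u
    rcases eq_or_ne u 0 with rfl | hu
    · simp
    have hn : 0 < ‖u‖ := norm_pos_iff.2 hu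
    have := abs_le.1 (Complex.abs_re_le_norm u)
    rw [cos_arccos (by rw [le_div_iff₀ hn]; linarith) (by rw [div_le_iff₀ hn]; linarith)]
    field_simp
  by_cases h : p ≤ 2
  · refine ⟨_, div_nonneg hs hc, fun u hu => ?_⟩
    have := one_le_one_add_mul_cos_rpow_sub hp h
      (τ := arccos (u.re / ‖u‖)) ⟨arccos_nonneg _, arccos_le_pi _⟩ ⟨norm_nonneg u, hu⟩
    rw [hre] at this
    simpa only [powerSubharmonic, angularPart, if_pos h] using this
  · refine ⟨_, div_nonneg hc hs, fun u hu => ?_⟩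
    -- Measuring the angle from the negative real axis turns `1 + Re u` into `1 - r * cos x`.
    have := one_le_one_sub_mul_cos_rpow_add (p := p) (by linarith)
      (x := π - arccos (u.re / ‖u‖)) ⟨by linarith [arccos_le_pi (u.re / ‖u‖)],
        by linarith [arccos_nonneg (u.re / ‖u‖)]⟩ ⟨norm_nonneg u, hu⟩
    rw [cos_pi_sub, mul_neg, hre] at this
    simp only [powerSubharmonic, angularPart, if_neg h]
    convert this using 1
    · ring_nf

lemma rieszConst_rpow {p : ℝ} (hp : 1 < p) :
    rieszConst p ^ p = (1 / (1 - |cos (π / p)|)) ^ (p / 2) := by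
  have h := abs_cos_pi_div_lt_one hp
  have h1 : 0 < 1 - |cos (π / p)| := by linarith
  rw [rieszConst, sqrt_eq_rpow, one_div (1 - _), inv_rpow h1.le, one_div (_ ^ _),
    inv_rpow (by positivity), ← rpow_mul h1.le]
  congr 2; ring

/-- The pointwise inequality behind the Riesz type inequality. -/
lemma exists_pow_le_sub_powerSubharmonic {p : ℝ} (hp : 1 < p) : ∃ K : ℝ, 0 ≤ K ∧ ∀ z w : ℂ,
    (‖z‖ ^ 2 + ‖w‖ ^ 2) ^ (p / 2) ≤ rieszConst p ^ p * ‖z + (starRingEnd ℂ) w‖ ^ p -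
      K * powerSubharmonic p (z * w) := by
  obtain ⟨K, hK, h⟩ := exists_one_le_sub_powerSubharmonic hp
  -- Homogeneity at `(2 / N) z w` releases `(2 / N) ^ (p / 2)`, whose numerator joins the constant.
  refine ⟨K * 2 ^ (p / 2), by positivity, fun z w => ?_⟩
  set N := ‖z‖ ^ 2 + ‖w‖ ^ 2 with hN
  have hN0 : 0 ≤ N := by positivity
  rcases hN0.eq_or_lt with h0 | h0
  · have hz : z = 0 := by
      rw [← norm_eq_zero]; nlinarith [sq_nonneg ‖z‖, sq_nonneg ‖w‖]
    have hw : w = 0 := by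
      rw [← norm_eq_zero]; nlinarith [sq_nonneg ‖z‖, sq_nonneg ‖w‖]
    have : p / 2 ≠ 0 := by linarith
    simp [← h0, hz, hw, powerSubharmonic, this, show p ≠ 0 by linarith]
  -- The bound is `2‖z‖‖w‖ ≤ ‖z‖² + ‖w‖²`.
  have hu : ‖((2 / N : ℝ) : ℂ) * (z * w)‖ ≤ 1 := by
    rw [norm_mul, Complex.norm_real, norm_eq_abs, abs_of_pos (by positivity), norm_mul,
      div_mul_eq_mul_div, div_le_one h0]
    nlinarith [sq_nonneg (‖z‖ - ‖w‖)]
  have key := h _ hu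
  rw [powerSubharmonic_smul (by positivity), Complex.re_ofReal_mul] at key
  have hnorm : ‖z + (starRingEnd ℂ) w‖ ^ 2 = N * (1 + 2 / N * (z * w).re) := by
    rw [← Complex.normSq_eq_norm_sq, Complex.normSq_add, Complex.conj_conj, Complex.normSq_conj,
      Complex.normSq_eq_norm_sq, Complex.normSq_eq_norm_sq]
    field_simp
    rw [hN]
  have hpos : 0 ≤ 1 + 2 / N * (z * w).re := by
    have : 0 ≤ N * (1 + 2 / N * (z * w).re) := hnorm ▸ sq_nonneg _
    exact nonneg_of_mul_nonneg_right this h0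
  have hc := abs_cos_pi_div_lt_one hp
  have hpow : ‖z + (starRingEnd ℂ) w‖ ^ p = N ^ (p / 2) * (1 + 2 / N * (z * w).re) ^ (p / 2) := by
    rw [← mul_rpow hN0 hpos, ← hnorm, ← rpow_natCast, ← rpow_mul (norm_nonneg _)]
    congr 1; push_cast; ring
  rw [hpow, rieszConst_rpow hp]
  rw [div_eq_mul_one_div, mul_rpow hpos (by
    have : 0 ≤ 1 - |cos (π / p)| := by linarith
    positivity), div_rpow (by norm_num) hN0] at key
  have hNp : 0 < N ^ (p / 2) := by positivity
  have := mul_le_mul_of_nonneg_left key hNp.le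
  rw [mul_one] at this
  refine this.trans (le_of_eq ?_)
  field_simp

/-! ### Local support of the majorant by branches of powers -/

lemma arccos_cos_of_abs_le {φ : ℝ} (h : |φ| ≤ π) : arccos (cos φ) = |φ| := by
  rw [← cos_abs, arccos_cos (abs_nonneg _) h]

/-- For `|φ| ≥ π` the difference of the two sides is `2 * sin (α * π) * sin (α * (|φ| - π))`. So a
branch continued across the negative real axis stays below the reflected function. -/
lemma cos_mul_le_cos_mul_arccos {α φ : ℝ} (hα : 1 / 2 < α) (hα1 : α ≤ 1) (hφ : |φ| ≤ 2 * π) :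
    cos (α * φ) ≤ cos (α * arccos (cos φ)) := by
  have hpi := pi_pos
  rcases le_total |φ| π with h | h
  · rw [arccos_cos_of_abs_le h, ← cos_abs (α * φ), abs_mul, abs_of_pos (by linarith)]
  · have h1 : arccos (cos φ) = 2 * π - |φ| := by
      rw [← cos_abs, ← cos_two_pi_sub, arccos_cos (by linarith) (by linarith)]
    rw [h1, ← cos_abs (α * φ), abs_mul, abs_of_pos (show 0 < α by linarith), ← sub_nonneg,
      cos_sub_cos]
    have e1 : (α * (2 * π - |φ|) + α * |φ|) / 2 = α * π := by ring
    have e2 : (α * (2 * π - |φ|) - α * |φ|) / 2 = -(α * (|φ| - π)) := by ring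
    rw [e1, e2, sin_neg]
    have h2 : 0 ≤ sin (α * π) := sin_nonneg_of_nonneg_of_le_pi (by positivity) (by nlinarith)
    have h3 : 0 ≤ sin (α * (|φ| - π)) :=
      sin_nonneg_of_nonneg_of_le_pi (mul_nonneg (by linarith) (by linarith)) (by nlinarith)
    nlinarith [mul_nonneg h2 h3]

/-- The supports are sinusoids of frequency `p / 2`, the angular factors of harmonic functions
homogeneous of that degree. For `p ≤ 2` the branch through `θ` is continued across the negative
axis; for `p > 2` the truncation replaces a sinusoid by its maximal value `1`, so the sinusoid stays
below. -/
lemma exists_angular_support {p θ : ℝ} (hp : 1 < p) (hθ : θ ∈ Set.Ioc (-π) π) :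
    ∃ κ ψ : ℝ, κ * cos ψ = angularPart p (arccos (cos θ)) ∧
      ∀ᶠ t in 𝓝 (0 : ℝ), κ * cos (ψ + p / 2 * t) ≤ angularPart p (arccos (cos (θ + t))) := by
  have hpi := pi_pos
  have hp0 : 0 < p := by linarith
  have habs : |θ| ≤ π := abs_le.2 ⟨hθ.1.le, hθ.2⟩
  by_cases h : p ≤ 2
  · refine ⟨1, p / 2 * θ, ?_, ?_⟩
    · rw [angularPart, if_pos h, one_mul, arccos_cos_of_abs_le habs, ← cos_abs (p / 2 * θ), abs_mul,
        abs_of_pos (by positivity)]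
    · have hnear : ∀ᶠ t in 𝓝 (0 : ℝ), |t| < π := by
        have : Tendsto (fun t : ℝ => |t|) (𝓝 0) (𝓝 |(0:ℝ)|) := continuous_abs.tendsto 0
        rw [abs_zero] at this
        exact this.eventually_lt_const hpi
      filter_upwards [hnear] with t ht
      rw [angularPart, if_pos h, one_mul, ← mul_add]
      refine cos_mul_le_cos_mul_arccos (by linarith) (by linarith) ?_
      linarith [abs_add_le θ t]
  push Not at h
  have hlt : 2 * π / p < π := by rw [div_lt_iff₀ hp0]; nlinarith
  have e : p / 2 * (2 * π / p) = π := by field_simp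
  -- `φ` is a signed angle from the negative real axis.
  obtain ⟨φ, hφ, hφc⟩ : ∃ φ : ℝ, |φ| ≤ π ∧ ∀ t, cos (θ + t) = -cos (φ - t) := by
    rcases le_total 0 θ with h0 | h0
    · refine ⟨π - θ, abs_le.2 ⟨by linarith [hθ.2], by linarith⟩, fun t => ?_⟩
      rw [← cos_pi_sub]; congr 1; ring
    · refine ⟨-π - θ, abs_le.2 ⟨by linarith, by linarith [hθ.1]⟩, fun t => ?_⟩
      rw [← cos_add_pi, ← cos_neg]; congr 1; ring
  have hval : ∀ t, angularPart p (arccos (cos (θ + t))) =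
      -cos (p / 2 * min (arccos (cos (φ - t))) (2 * π / p)) := by
    intro t
    rw [angularPart, if_neg (not_le.2 h), hφc, arccos_neg]
    congr 4
    ring
  have hval0 := hval 0
  rw [add_zero, sub_zero] at hval0
  rw [hval0, arccos_cos_of_abs_le hφ]
  rcases le_or_gt |φ| (2 * π / p) with hle | hgt
  · refine ⟨-1, -(p / 2 * φ), ?_, ?_⟩
    · rw [min_eq_left hle, cos_neg, ← cos_abs (p / 2 * φ), abs_mul, abs_of_pos (by positivity)]
      ring
    · have hnear : ∀ᶠ t in 𝓝 (0 : ℝ), |φ - t| < π := by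
        have : Tendsto (fun t : ℝ => |φ - t|) (𝓝 0) (𝓝 |φ - 0|) :=
          Continuous.tendsto (by fun_prop) 0
        rw [sub_zero] at this
        exact this.eventually_lt_const (hle.trans_lt hlt)
      filter_upwards [hnear] with t ht
      rw [hval, arccos_cos_of_abs_le ht.le]
      have e3 : cos (-(p / 2 * φ) + p / 2 * t) = cos (p / 2 * |φ - t|) := by
        rw [← cos_abs, ← cos_abs (p / 2 * |φ - t|), abs_mul, abs_abs, ← abs_mul]
        rw [← abs_neg]; congr 2; ring
      rw [e3]
      rcases le_total |φ - t| (2 * π / p) with h1 | h1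
      · rw [min_eq_left h1]; linarith
      · rw [min_eq_right h1, e, cos_pi]
        linarith [neg_one_le_cos (p / 2 * |φ - t|)]
  -- On the plateau the angular part is constantly `1`.
  · refine ⟨1, 0, ?_, ?_⟩
    · rw [min_eq_right hgt.le, e]; simp
    · have hnear : ∀ᶠ t in 𝓝 (0 : ℝ), 2 * π / p < arccos (cos (φ - t)) := by
        have hc : Continuous (fun t : ℝ => arccos (cos (φ - t))) :=
          continuous_arccos.comp (by fun_prop)
        have : Tendsto (fun t : ℝ => arccos (cos (φ - t))) (𝓝 0) (𝓝 (arccos (cos (φ - 0)))) :=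
          hc.tendsto 0
        rw [sub_zero, arccos_cos_of_abs_le hφ] at this
        exact this.eventually_const_lt hgt
      filter_upwards [hnear] with t ht
      rw [hval, min_eq_right ht.le, e, cos_pi]
      linarith [cos_le_one (0 + p / 2 * t)]

/-- Multiplied by `‖u‖ ^ (p / 2)`, the angular support is the real part of a multiple of `(u / u₀) ^
(p / 2)`, with `arg (u / u₀)` as the angular increment. -/
lemma hasPowerSupport_powerSubharmonic {p : ℝ} (hp : 1 < p) :
    HasPowerSupport (p / 2) (powerSubharmonic p) := by
  intro u₀ hu₀
  have hn : ‖u₀‖ ≠ 0 := norm_ne_zero_iff.2 hu₀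
  have hre : ∀ u : ℂ, u ≠ 0 → u.re / ‖u‖ = cos u.arg := fun u hu => (Complex.cos_arg hu).symm
  obtain ⟨κ, ψ, h1, h2⟩ := exists_angular_support hp (θ := u₀.arg)
    ⟨Complex.neg_pi_lt_arg _, Complex.arg_le_pi _⟩
  refine ⟨((‖u₀‖ ^ (p / 2) * κ : ℝ) : ℂ) * Complex.exp (ψ * Complex.I), ?_, ?_⟩
  · rw [Complex.re_ofReal_mul, Complex.exp_ofReal_mul_I_re, powerSubharmonic, hre _ hu₀, ← h1]
    ring
  · have hq : Tendsto (fun u : ℂ => u / u₀) (𝓝 u₀) (𝓝 1) := by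
      have : Tendsto (fun u : ℂ => u / u₀) (𝓝 u₀) (𝓝 (u₀ / u₀)) :=
        (continuous_id.div_const u₀).tendsto u₀
      rwa [div_self hu₀] at this
    have harg : Tendsto (fun u : ℂ => (u / u₀).arg) (𝓝 u₀) (𝓝 0) := by
      have := (Complex.continuousAt_arg Complex.one_mem_slitPlane).tendsto.comp hq
      rwa [Complex.arg_one] at this
    filter_upwards [harg.eventually h2, isOpen_ne.mem_nhds hu₀] with u hu hu0
    have hne : u / u₀ ≠ 0 := div_ne_zero hu0 hu₀
    have hang : cos u.arg = cos (u₀.arg + (u / u₀).arg) := by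
      rw [← Real.Angle.cos_coe, ← Real.Angle.cos_coe, Real.Angle.coe_add,
        Complex.arg_div_coe_angle hu0 hu₀]
      congr 1
      abel
    rw [powerSubharmonic, hre _ hu0, hang]
    have hpow : (u / u₀) ^ ((p / 2 : ℝ) : ℂ) = ((‖u / u₀‖ ^ (p / 2) : ℝ) : ℂ) *
        Complex.exp ((p / 2 * (u / u₀).arg : ℝ) * Complex.I) := by
      rw [Complex.cpow_ofReal, Complex.exp_mul_I, mul_comm (Complex.arg _)]
      push_cast
      rfl
    rw [hpow]
    have e : ((‖u₀‖ ^ (p / 2) * κ : ℝ) : ℂ) * Complex.exp (ψ * Complex.I) *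
        (((‖u / u₀‖ ^ (p / 2) : ℝ) : ℂ) * Complex.exp ((p / 2 * (u / u₀).arg : ℝ) * Complex.I)) =
        ((‖u₀‖ ^ (p / 2) * ‖u / u₀‖ ^ (p / 2) * κ : ℝ) : ℂ) *
          Complex.exp ((ψ + p / 2 * (u / u₀).arg : ℝ) * Complex.I) := by
      rw [Complex.ofReal_add ψ, add_mul, Complex.exp_add]
      push_cast
      ring
    rw [e, Complex.re_ofReal_mul, Complex.exp_ofReal_mul_I_re, ← mul_rpow (norm_nonneg _)
      (norm_nonneg _), norm_div, mul_div_cancel₀ _ hn, mul_assoc]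
    gcongr


/-! ### The differentiated Poisson kernel -/

/-- The derivative of the Poisson kernel of the unit disk with respect to the angle, up to sign. -/
def poissonDeriv (r s : ℝ) : ℝ :=
  2 * r * (1 - r ^ 2) * sin s / (1 - 2 * r * cos s + r ^ 2) ^ 2

lemma poissonDenom_pos {r : ℝ} (hr : r ∈ Set.Ioo 0 1) (s : ℝ) : 0 < 1 - 2 * r * cos s + r ^ 2 := by
  have h1 := cos_le_one s
  nlinarith [hr.1, hr.2, mul_nonneg hr.1.le (sub_nonneg.2 h1), sq_pos_of_pos (sub_pos.2 hr.2)]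

lemma continuous_poissonDeriv {r : ℝ} (hr : r ∈ Set.Ioo 0 1) : Continuous (poissonDeriv r) := by
  unfold poissonDeriv
  refine Continuous.div (by fun_prop) (by fun_prop) fun s => ?_
  exact (pow_pos (poissonDenom_pos hr s) 2).ne'

lemma poissonDeriv_mul_sin_nonneg {r : ℝ} (hr : r ∈ Set.Ioo 0 1) (s : ℝ) :
    0 ≤ poissonDeriv r s * sin s := by
  have h := hr.1
  have h2 : 0 < 1 - r ^ 2 := by nlinarith [hr.1, hr.2]
  have : poissonDeriv r s * sin s =
      2 * r * (1 - r ^ 2) * sin s ^ 2 / (1 - 2 * r * cos s + r ^ 2) ^ 2 := by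
    unfold poissonDeriv; ring
  rw [this]
  positivity

/-- The first term is the kernel of Cauchy's formula for the derivative; the second, its reflection,
integrates to zero against holomorphic functions. Their difference is a real kernel times `-i`. -/
lemma cauchy_kernel_sub_eq {r s : ℝ} (hr : r ∈ Set.Ioo 0 1) {e : ℂ}
    (he : e = Complex.exp (s * Complex.I)) :
    r * e / (e - r) ^ 2 - r * e / (1 - r * e) ^ 2 = -Complex.I * poissonDeriv r s := by
  have he0 : e ≠ 0 := by rw [he]; exact Complex.exp_ne_zero _
  have hinv : e⁻¹ = Complex.exp (-(s * Complex.I)) := by rw [he, Complex.exp_neg]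
  have hcos : 2 * Complex.cos s = e + e⁻¹ := by
    rw [Complex.two_cos, hinv, he, neg_mul]
  have hsin : 2 * Complex.sin s = (e⁻¹ - e) * Complex.I := by
    rw [Complex.two_sin, hinv, he, neg_mul]
  have hD : ((1 - 2 * r * cos s + r ^ 2 : ℝ) : ℂ) = (e - r) * (1 - r * e) / e := by
    push_cast
    rw [show (2 * (r : ℂ) * Complex.cos s) = r * (2 * Complex.cos s) by ring, hcos]
    field_simp
    ring
  have hD0 : ((1 - 2 * r * cos s + r ^ 2 : ℝ) : ℂ) ≠ 0 := by
    exact_mod_cast (poissonDenom_pos hr s).ne'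
  have h12 : (e - r) * (1 - r * e) ≠ 0 := by
    intro h
    rw [hD, h, zero_div] at hD0
    exact hD0 rfl
  have h1 : e - r ≠ 0 := left_ne_zero_of_mul h12
  have h2 : 1 - r * e ≠ 0 := right_ne_zero_of_mul h12
  unfold poissonDeriv
  rw [Complex.ofReal_div, Complex.ofReal_pow, hD]
  push_cast
  rw [show 2 * (r : ℂ) * (1 - r ^ 2) * Complex.sin s = r * (1 - r ^ 2) * (2 * Complex.sin s)
    by ring, hsin]
  field_simp
  ring_nf
  rw [Complex.I_sq]
  ring

lemma circleMap_zero_one_add (θ s : ℝ) :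
    circleMap 0 1 (s + θ) = Complex.exp (s * Complex.I) * circleMap 0 1 θ := by
  simp only [circleMap, zero_add, Complex.ofReal_one, one_mul, Complex.ofReal_add, add_mul,
    Complex.exp_add]

/-- The derivative of a holomorphic function on the disk through its boundary values. -/
lemma mul_deriv_eq_integral_poissonDeriv {U : Set ℂ} (hU : IsOpen U) (hsub : closedBall 0 1 ⊆ U)
    {H : ℂ → ℂ} (hH : DifferentiableOn ℂ H U) {r : ℝ} (hr : r ∈ Set.Ioo 0 1) (θ : ℝ) :
    circleMap 0 r θ * deriv H (circleMap 0 r θ) =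
      (2 * π)⁻¹ • ∫ s in -π..π, (-Complex.I * poissonDeriv r s) * H (circleMap 0 1 (s + θ)) := by
  set z := circleMap 0 r θ with hz
  have hznorm : ‖z‖ = r := by rw [hz, norm_circleMap_zero, abs_of_pos hr.1]
  have hzball : z ∈ ball (0 : ℂ) 1 := by simpa [hznorm] using hr.2
  have hHc : ContinuousOn H (closedBall 0 1) := hH.continuousOn.mono hsub
  have hHs : ContinuousOn H (sphere 0 1) := hHc.mono sphere_subset_closedBall
  have hne : ∀ ζ ∈ sphere (0 : ℂ) 1, ζ - z ≠ 0 := by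
    intro ζ hζ h
    have h1 : ‖ζ‖ = 1 := by simpa using hζ
    rw [sub_eq_zero.1 h, hznorm] at h1
    exact hr.2.ne h1
  have hne2 : ∀ ζ ∈ closedBall (0 : ℂ) 1, 1 - (starRingEnd ℂ) z * ζ ≠ 0 := by
    intro ζ hζ h
    have h1 : ‖ζ‖ ≤ 1 := by simpa using hζ
    have h2 : ‖(starRingEnd ℂ) z * ζ‖ = 1 := by rw [← sub_eq_zero.1 h, norm_one]
    rw [norm_mul, Complex.norm_conj, hznorm] at h2
    nlinarith [hr.1, hr.2]
  have e1 : circleAverage (fun ζ => z * ζ / (ζ - z) ^ 2 * H ζ) 0 1 = z * deriv H z := by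
    rw [circleAverage_eq_circleIntegral one_ne_zero,
      ← Complex.two_pi_I_inv_smul_circleIntegral_sub_sq_inv_smul_of_differentiable hU hsub hH hzball,
      mul_smul_comm, ← circleIntegral.integral_const_mul]
    congr 1
    refine circleIntegral.integral_congr zero_le_one fun ζ hζ => ?_
    have hζ0 : ζ ≠ 0 := by rintro rfl; simp at hζ
    have := hne ζ hζ
    simp only [smul_eq_mul, sub_zero]
    field_simp
  -- The mean value property applies: the pole lies outside the closed disk and the function
  -- vanishes at `0`.
  have e2 : circleAverage
      (fun ζ => (starRingEnd ℂ) z * ζ / (1 - (starRingEnd ℂ) z * ζ) ^ 2 * H ζ) 0 1 = 0 := by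
    have hd : DiffContOnCl ℂ
        (fun ζ => (starRingEnd ℂ) z * ζ / (1 - (starRingEnd ℂ) z * ζ) ^ 2 * H ζ)
        (ball 0 |(1 : ℝ)|) := by
      rw [abs_one]
      refine DifferentiableOn.diffContOnCl ?_
      rw [closure_ball _ one_ne_zero]
      refine DifferentiableOn.mul (DifferentiableOn.div (by fun_prop) (by fun_prop) ?_)
        (hH.mono hsub)
      exact fun ζ hζ => pow_ne_zero 2 (hne2 ζ hζ)
    rw [hd.circleAverage]
    simp
  have i1 : CircleIntegrable (fun ζ => z * ζ / (ζ - z) ^ 2 * H ζ) 0 1 :=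
    (ContinuousOn.mul (ContinuousOn.div (by fun_prop) (by fun_prop)
      fun ζ hζ => pow_ne_zero 2 (hne ζ hζ)) hHs).circleIntegrable zero_le_one
  have i2 : CircleIntegrable
      (fun ζ => (starRingEnd ℂ) z * ζ / (1 - (starRingEnd ℂ) z * ζ) ^ 2 * H ζ) 0 1 :=
    (ContinuousOn.mul (ContinuousOn.div (by fun_prop) (by fun_prop)
      fun ζ hζ => pow_ne_zero 2 (hne2 ζ (sphere_subset_closedBall hζ))) hHs).circleIntegrable
      zero_le_one
  have e3 := circleAverage_fun_sub i1 i2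
  rw [e1, e2, sub_zero] at e3
  rw [← e3, circleAverage_eq_integral_add θ]
  congr 1
  have hper : Function.Periodic (fun s : ℝ => (fun ζ => z * ζ / (ζ - z) ^ 2 * H ζ -
      (starRingEnd ℂ) z * ζ / (1 - (starRingEnd ℂ) z * ζ) ^ 2 * H ζ) (circleMap 0 1 (s + θ)))
      (2 * π) := by
    intro s
    have : circleMap 0 1 (s + 2 * π + θ) = circleMap 0 1 (s + θ) := by
      rw [show s + 2 * π + θ = s + θ + 2 * π by ring, periodic_circleMap]
    simp only [this]
  have hshift := hper.intervalIntegral_add_eq 0 (-π)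
  rw [zero_add, show -π + 2 * π = π by ring] at hshift
  rw [hshift]
  refine intervalIntegral.integral_congr fun s _ => ?_
  have hk := cauchy_kernel_sub_eq (s := s) hr rfl
  simp only
  rw [← hk, ← sub_mul]
  congr 1
  rw [circleMap_zero_one_add θ s]
  set e := Complex.exp (s * Complex.I)
  set c := circleMap 0 1 θ with hc
  have hzc : z = r * c := by simp [hz, hc, circleMap]
  have hcc : (starRingEnd ℂ) c * c = 1 := by
    rw [mul_comm, Complex.mul_conj, Complex.normSq_eq_norm_sq, hc, norm_circleMap_zero]
    simp
  have hc0 : c ≠ 0 := by rw [hc]; exact circleMap_ne_center one_ne_zero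
  have hzz : (starRingEnd ℂ) z * (e * c) = r * e := by
    rw [hzc, map_mul, Complex.conj_ofReal, mul_assoc, mul_left_comm ((starRingEnd ℂ) c), hcc,
      mul_one]
  rw [hzz, hzc]
  congr 1
  rw [show r * c * (e * c) = r * e * c ^ 2 by ring, show (e * c - r * c) ^ 2 = (e - r) ^ 2 * c ^ 2
    by ring, mul_div_mul_right _ _ (pow_ne_zero 2 hc0)]

lemma integral_poissonDeriv {r : ℝ} (hr : r ∈ Set.Ioo 0 1) :
    ∫ s in -π..π, (-Complex.I * poissonDeriv r s) = 0 := by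
  have := mul_deriv_eq_integral_poissonDeriv isOpen_univ (Set.subset_univ _)
    (differentiableOn_const (1 : ℂ)) hr 0
  simp only [deriv_const, mul_zero, mul_one] at this
  have h := smul_eq_zero.1 this.symm
  refine h.resolve_left ?_
  exact inv_ne_zero two_pi_pos.ne'

/-- This is the representation for the identity function at angle `0`, after taking real parts. -/
lemma integral_poissonDeriv_mul_sin {r : ℝ} (hr : r ∈ Set.Ioo 0 1) :
    ∫ s in -π..π, poissonDeriv r s * sin s = 2 * π * r := by
  have := mul_deriv_eq_integral_poissonDeriv isOpen_univ (Set.subset_univ _)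
    (differentiableOn_id (𝕜 := ℂ)) hr 0
  have hc : Continuous fun s : ℝ => (-Complex.I * poissonDeriv r s) * id (circleMap 0 1 (s + 0)) := by
    have := continuous_poissonDeriv hr
    have h2 := continuous_circleMap 0 1
    simp only [id, add_zero]
    fun_prop
  have h2 := congrArg Complex.re this
  have h3 := Complex.reCLM.intervalIntegral_comp_comm (hc.intervalIntegrable (-π) π) (μ := volume)
  simp only [Complex.reCLM_apply] at h3
  rw [Complex.smul_re, ← h3] at h2
  have h4 : ∀ s : ℝ, ((-Complex.I * poissonDeriv r s) * id (circleMap 0 1 (s + 0))).re =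
      poissonDeriv r s * sin s := by
    intro s
    simp [circleMap, Complex.exp_ofReal_mul_I_im]
  simp only [h4, deriv_id, mul_one] at h2
  have h5 : (circleMap 0 r 0).re = r := by simp [circleMap]
  rw [h5, smul_eq_mul] at h2
  have := two_pi_pos
  field_simp at h2
  linarith

/-- **Fatou's theorem** for differentiated Poisson integrals. -/
lemma tendsto_integral_poissonDeriv {Γ : ℝ → ℂ} (hΓ : Continuous Γ) {θ : ℝ} {m : ℂ}
    (hm : HasDerivAt Γ m θ) :
    Tendsto (fun r => (2 * π)⁻¹ • ∫ s in -π..π, (-Complex.I * poissonDeriv r s) * Γ (s + θ))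
      (𝓝[<] (1 : ℝ)) (𝓝 (-Complex.I * m)) := by
  have hpi := pi_pos
  -- The linear part is written with `sin s`, whose moment against the kernel is known exactly; the
  -- remainder is `o(sin s)` when `m` is the derivative.
  set Δ : ℝ → ℂ := fun s => Γ (s + θ) - Γ θ - m * sin s with hΔ
  have hΔc : Continuous Δ := by fun_prop
  have hlo : Δ =o[𝓝 0] (fun s : ℝ => sin s) := by
    have h1 : (fun s : ℝ => Γ (s + θ) - Γ θ - m * s) =o[𝓝 0] (fun s : ℝ => s) := by
      have := hasDerivAt_iff_isLittleO_nhds_zero.1 hm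
      refine this.congr_left fun s => ?_
      rw [add_comm θ s, Complex.real_smul, mul_comm]
    have h2 : (fun s : ℝ => sin s - s) =o[𝓝 0] (fun s : ℝ => s) := by
      have := hasDerivAt_iff_isLittleO_nhds_zero.1 (hasDerivAt_sin 0)
      refine this.congr_left fun s => ?_
      simp
    have h3 : (fun s : ℝ => m * ((sin s - s : ℝ) : ℂ)) =o[𝓝 0] (fun s : ℝ => s) := by
      refine Asymptotics.IsLittleO.const_mul_left ?_ m
      exact (Asymptotics.isLittleO_norm_left.1 (by
        simpa only [Complex.norm_real] using h2.norm_left))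
    have h4 : (fun s : ℝ => s) =O[𝓝 0] (fun s : ℝ => sin s) := by
      have : (fun s : ℝ => sin s - s + s) =O[𝓝 0] (fun s : ℝ => s) := by
        exact h2.isBigO.add (Asymptotics.isBigO_refl _ _)
      have h5 := h2.right_isBigO_add
      simpa using h5
    have h5 := (h1.sub h3).trans_isBigO h4
    refine h5.congr_left fun s => ?_
    simp only [hΔ]
    push_cast
    ring
  obtain ⟨M, hM⟩ := (isCompact_Icc (a := -π) (b := π)).exists_bound_of_continuousOn
    hΔc.continuousOn
  have hM0 : 0 ≤ M := (norm_nonneg _).trans (hM 0 ⟨by linarith, hpi.le⟩)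
  have hident : ∀ r ∈ Set.Ioo (0 : ℝ) 1,
      (2 * π)⁻¹ • ∫ s in -π..π, (-Complex.I * poissonDeriv r s) * Γ (s + θ) =
      (2 * π)⁻¹ • (∫ s in -π..π, (-Complex.I * poissonDeriv r s) * Δ s) + -Complex.I * m * r := by
    intro r hr
    have hKc := continuous_poissonDeriv hr
    have hsplit : ∀ s : ℝ, (-Complex.I * poissonDeriv r s) * Γ (s + θ) =
        (-Complex.I * poissonDeriv r s) * Δ s + ((-Complex.I * poissonDeriv r s) * Γ θ +
          (-Complex.I * m) * ((poissonDeriv r s * sin s : ℝ) : ℂ)) := by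
      intro s; simp only [hΔ]; push_cast; ring
    simp only [hsplit]
    rw [intervalIntegral.integral_add (Continuous.intervalIntegrable (by fun_prop) _ _)
      (Continuous.intervalIntegrable (by fun_prop) _ _),
      intervalIntegral.integral_add (Continuous.intervalIntegrable (by fun_prop) _ _)
      (Continuous.intervalIntegrable (by fun_prop) _ _),
      intervalIntegral.integral_mul_const, integral_poissonDeriv hr,
      intervalIntegral.integral_const_mul, intervalIntegral.integral_ofReal,
      integral_poissonDeriv_mul_sin hr, zero_mul, zero_add, smul_add]
    congr 1
    rw [Complex.real_smul]
    push_cast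
    have : (π : ℂ) ≠ 0 := by exact_mod_cast hpi.ne'
    field_simp
  have hzero : Tendsto (fun r => (2 * π)⁻¹ • ∫ s in -π..π, (-Complex.I * poissonDeriv r s) * Δ s)
      (𝓝[<] (1 : ℝ)) (𝓝 0) := by
    rw [Metric.tendsto_nhds]
    intro ε hε
    obtain ⟨δ, hδ, hδb⟩ := Metric.eventually_nhds_iff.1 (hlo.bound (half_pos hε))
    set d := min (δ / 2) π with hd
    have hd0 : 0 < d := lt_min (by linarith) hpi
    have hcd : cos d < 1 := by
      rw [← cos_zero]; exact cos_lt_cos_of_nonneg_of_le_pi le_rfl (min_le_right _ _) hd0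
    -- Near `0` the remainder is absorbed by the nonnegative kernel `poissonDeriv r s * sin s`, of
    -- total mass `2πr`; away from `0` the differentiated kernel tends to `0` uniformly.
    have hbound : ∀ r ∈ Set.Ioo (1 / 2 : ℝ) 1, ∀ s ∈ Set.Icc (-π) π,
        ‖(-Complex.I * poissonDeriv r s) * Δ s‖ ≤ ε / 2 * (poissonDeriv r s * sin s) +
          2 * (1 - r ^ 2) / (1 - cos d) ^ 2 * M := by
      intro r hr s hs
      have hr' : r ∈ Set.Ioo (0 : ℝ) 1 := ⟨by linarith [hr.1], hr.2⟩
      have hK := poissonDeriv_mul_sin_nonneg hr' s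
      have hr2 : 0 < 1 - r ^ 2 := by nlinarith [hr.1, hr.2]
      have hn : ‖(-Complex.I * poissonDeriv r s) * Δ s‖ = |poissonDeriv r s| * ‖Δ s‖ := by
        simp
      rw [hn]
      rcases lt_or_ge |s| d with h | h
      · have h1 : ‖Δ s‖ ≤ ε / 2 * |sin s| := by
          have := hδb (y := s) (by
            rw [dist_zero_right, norm_eq_abs]
            linarith [min_le_left (δ / 2) π])
          simpa using this
        have h2 : 0 ≤ 2 * (1 - r ^ 2) / (1 - cos d) ^ 2 * M := by positivity
        calc |poissonDeriv r s| * ‖Δ s‖ ≤ |poissonDeriv r s| * (ε / 2 * |sin s|) := by gcongr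
          _ = ε / 2 * (poissonDeriv r s * sin s) := by
            rw [← abs_of_nonneg hK, abs_mul]; ring
          _ ≤ _ := by linarith
      · have h1 : |poissonDeriv r s| ≤ 2 * (1 - r ^ 2) / (1 - cos d) ^ 2 := by
          have hcs : cos s ≤ cos d := by
            rw [← cos_abs s]
            exact cos_le_cos_of_nonneg_of_le_pi hd0.le (abs_le.2 hs) h
          -- The denominator is `(1 - r)² + 2 * r * (1 - cos s)`, and `r > 1/2`.
          have hD : 1 - cos d ≤ 1 - 2 * r * cos s + r ^ 2 := by
            nlinarith [hr.1, sq_nonneg (1 - r)]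
          have hD0 : 0 < 1 - cos d := by linarith
          have hD1 := hD0.trans_le hD
          unfold poissonDeriv
          rw [abs_div, abs_of_pos (pow_pos hD1 2), abs_mul,
            abs_of_pos (mul_pos (mul_pos two_pos hr'.1) hr2)]
          have hsin := abs_sin_le_one s
          refine div_le_div₀ (by positivity) ?_ (by positivity) (by gcongr)
          calc 2 * r * (1 - r ^ 2) * |sin s| ≤ 2 * 1 * (1 - r ^ 2) * 1 := by
                gcongr; exact hr.2.le
            _ = 2 * (1 - r ^ 2) := by ring
        have h2 := mul_le_mul h1 (hM s hs) (norm_nonneg _) (by positivity)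
        have h3 : 0 ≤ ε / 2 * (poissonDeriv r s * sin s) := by positivity
        linarith
    have hlim : Tendsto (fun r : ℝ => ε / 2 * r + 2 * (1 - r ^ 2) / (1 - cos d) ^ 2 * M) (𝓝[<] 1)
        (𝓝 (ε / 2 * 1 + 2 * (1 - 1 ^ 2) / (1 - cos d) ^ 2 * M)) := by
      have : Continuous (fun r : ℝ => ε / 2 * r + 2 * (1 - r ^ 2) / (1 - cos d) ^ 2 * M) := by
        fun_prop
      exact (this.tendsto 1).mono_left nhdsWithin_le_nhds
    have hlt : ε / 2 * 1 + 2 * (1 - 1 ^ 2) / (1 - cos d) ^ 2 * M < ε := by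
      norm_num; linarith
    filter_upwards [hlim.eventually_lt_const hlt,
      Ioo_mem_nhdsLT (show (1 / 2 : ℝ) < 1 by norm_num)] with r h1 hr
    have hr' : r ∈ Set.Ioo (0 : ℝ) 1 := ⟨by linarith [hr.1], hr.2⟩
    have hKc := continuous_poissonDeriv hr'
    rw [dist_zero_right, norm_smul, norm_eq_abs, abs_of_pos (by positivity)]
    refine lt_of_le_of_lt ?_ h1
    have h2 : ‖∫ s in -π..π, (-Complex.I * poissonDeriv r s) * Δ s‖ ≤
        ∫ s in -π..π, (ε / 2 * (poissonDeriv r s * sin s) +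
          2 * (1 - r ^ 2) / (1 - cos d) ^ 2 * M) := by
      refine intervalIntegral.norm_integral_le_of_norm_le (by linarith) ?_
        (Continuous.intervalIntegrable (by fun_prop) _ _)
      exact Eventually.of_forall fun s hs => hbound r hr s ⟨hs.1.le, hs.2⟩
    rw [intervalIntegral.integral_add (Continuous.intervalIntegrable (by fun_prop) _ _)
      (Continuous.intervalIntegrable (by fun_prop) _ _), intervalIntegral.integral_const_mul,
      integral_poissonDeriv_mul_sin hr', intervalIntegral.integral_const, smul_eq_mul] at h2
    rw [inv_mul_le_iff₀ (by positivity)]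
    refine h2.trans (le_of_eq ?_)
    ring
  have hfin : Tendsto (fun r : ℝ => (2 * π)⁻¹ • (∫ s in -π..π, (-Complex.I * poissonDeriv r s) * Δ s)
      + -Complex.I * m * r) (𝓝[<] 1) (𝓝 (0 + -Complex.I * m * (1 : ℝ))) := by
    refine hzero.add ?_
    have : Continuous (fun r : ℝ => -Complex.I * m * (r : ℂ)) := by fun_prop
    exact (this.tendsto 1).mono_left nhdsWithin_le_nhds
  simp only [zero_add, Complex.ofReal_one, mul_one] at hfin
  refine hfin.congr' ?_
  filter_upwards [Ioo_mem_nhdsLT (show (0 : ℝ) < 1 by norm_num)] with r hr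
  exact (hident r hr).symm


/-! ### Poisson averages -/

lemma poissonKernel_nonneg {w ζ : ℂ} (h : ‖w‖ ≤ ‖ζ‖) : 0 ≤ poissonKernel 0 w ζ := by
  rw [poissonKernel_def, sub_zero, sub_zero]
  have : ‖w‖ ^ 2 ≤ ‖ζ‖ ^ 2 := by gcongr
  exact div_nonneg (by linarith) (by positivity)

lemma poissonKernel_le {w ζ : ℂ} (h : ‖w‖ < ‖ζ‖) :
    poissonKernel 0 w ζ ≤ (‖ζ‖ + ‖w‖) / (‖ζ‖ - ‖w‖) := by
  rw [poissonKernel_def, sub_zero, sub_zero]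
  have h1 : 0 < ‖ζ‖ - ‖w‖ := by linarith
  have h2 : ‖ζ‖ - ‖w‖ ≤ ‖ζ - w‖ := norm_sub_norm_le ζ w
  have h3 : (‖ζ‖ + ‖w‖) / (‖ζ‖ - ‖w‖) = (‖ζ‖ ^ 2 - ‖w‖ ^ 2) / (‖ζ‖ - ‖w‖) ^ 2 := by
    field_simp
    ring
  rw [h3]
  have h4 : 0 ≤ ‖ζ‖ ^ 2 - ‖w‖ ^ 2 := by nlinarith [norm_nonneg w]
  gcongr

lemma continuousOn_poissonKernel {R : ℝ} {w : ℂ} (hw : ‖w‖ < R) :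
    ContinuousOn (poissonKernel 0 w) (sphere 0 R) := by
  have : poissonKernel 0 w = fun ζ => (‖ζ‖ ^ 2 - ‖w‖ ^ 2) / ‖ζ - w‖ ^ 2 := by
    ext ζ; simp [poissonKernel_def]
  rw [this]
  refine ContinuousOn.div (by fun_prop) (by fun_prop) fun ζ hζ => pow_ne_zero 2 ?_
  rw [norm_ne_zero_iff, sub_ne_zero]
  rintro rfl
  exact hw.ne (by simpa using hζ)

lemma circleAverage_poissonKernel {R : ℝ} {w : ℂ} (hw : ‖w‖ < R) :
    circleAverage (poissonKernel 0 w) 0 R = 1 := by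
  have := (InnerProductSpace.harmonicOnNhd_const (1 : ℝ) :
    InnerProductSpace.HarmonicOnNhd (fun _ : ℂ => (1 : ℝ)) (closedBall 0 R)).circleAverage_poissonKernel_smul
    (w := w) (by simpa using hw)
  refine Eq.trans ?_ this
  congr 1
  ext ζ
  simp

/-- Jensen's inequality for weighted circle averages. -/
lemma circleAverage_mul_rpow_le {p : ℝ} (hp : 1 < p) {k φ : ℂ → ℝ} {c : ℂ} {R : ℝ}
    (hk : ∀ z ∈ sphere c |R|, 0 ≤ k z) (hφ : ∀ z ∈ sphere c |R|, 0 ≤ φ z)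
    (hk1 : circleAverage k c R = 1) (ik : CircleIntegrable k c R)
    (ikφ : CircleIntegrable (fun z => k z * φ z) c R)
    (ikp : CircleIntegrable (fun z => k z * φ z ^ p) c R) :
    circleAverage (fun z => k z * φ z) c R ^ p ≤ circleAverage (fun z => k z * φ z ^ p) c R := by
  set m := circleAverage (fun z => k z * φ z) c R with hm
  have hm0 : 0 ≤ m := circleAverage_nonneg_of_nonneg fun z hz => mul_nonneg (hk z hz) (hφ z hz)
  have hp0 : 0 < p := by linarith
  rcases hm0.eq_or_lt with h0 | h0
  · rw [← h0, zero_rpow hp0.ne']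
    exact circleAverage_nonneg_of_nonneg fun z hz =>
      mul_nonneg (hk z hz) (rpow_nonneg (hφ z hz) p)
  -- The graph of `x ^ p` lies above its tangent at the mean `m`; weighting by `k` and averaging
  -- gives the claim.
  have hpt : ∀ z ∈ sphere c |R|, m ^ p * (1 - p) * k z + p * m ^ (p - 1) * (k z * φ z) ≤
      k z * φ z ^ p := by
    intro z hz
    have hb := one_add_mul_self_le_rpow_one_add (s := φ z / m - 1) (p := p)
      (by have := div_nonneg (hφ z hz) hm0; linarith) hp.le
    have h1 : 1 + (φ z / m - 1) = φ z / m := by ring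
    rw [h1, div_rpow (hφ z hz) hm0, le_div_iff₀ (by positivity)] at hb
    have h2 : (1 + p * (φ z / m - 1)) * m ^ p = m ^ p * (1 - p) + p * m ^ (p - 1) * φ z := by
      have : m ^ p = m ^ (p - 1) * m := by rw [← rpow_add_one h0.ne']; congr 1; ring
      rw [this]; field_simp; ring
    rw [h2] at hb
    have := mul_le_mul_of_nonneg_left hb (hk z hz)
    linarith
  have i1 : CircleIntegrable (fun z => m ^ p * (1 - p) * k z) c R := ik.const_smul (a := m ^ p * (1 - p))
  have i2 : CircleIntegrable (fun z => p * m ^ (p - 1) * (k z * φ z)) c R :=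
    ikφ.const_smul (a := p * m ^ (p - 1))
  have h3 := circleAverage_mono (i1.add i2) ikp hpt
  rw [circleAverage_add i1 i2] at h3
  have e1 : circleAverage (fun z => m ^ p * (1 - p) * k z) c R = m ^ p * (1 - p) := by
    have := circleAverage_fun_smul (a := m ^ p * (1 - p)) (f := k) (c := c) (R := R)
    simp only [smul_eq_mul, hk1, mul_one] at this
    exact this
  have e2 : circleAverage (fun z => p * m ^ (p - 1) * (k z * φ z)) c R = p * m ^ (p - 1) * m := by
    have := circleAverage_fun_smul (a := p * m ^ (p - 1)) (f := fun z => k z * φ z) (c := c) (R := R)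
    simp only [smul_eq_mul, ← hm] at this
    exact this
  rw [e1, e2] at h3
  have : m ^ p = m ^ (p - 1) * m := by rw [← rpow_add_one h0.ne']; congr 1; ring
  refine le_trans (le_of_eq ?_) h3
  rw [this]
  ring

lemma norm_circleAverage_le {F : ℂ → ℂ} {c : ℂ} {R : ℝ} :
    ‖circleAverage F c R‖ ≤ circleAverage (fun z => ‖F z‖) c R := by
  rw [circleAverage_def, circleAverage_def, norm_smul, norm_eq_abs,
    abs_of_pos (inv_pos.2 two_pi_pos), smul_eq_mul]
  have := inv_pos.2 two_pi_pos
  gcongr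
  exact intervalIntegral.norm_integral_le_integral_norm two_pi_pos.le

/-! ### Holomorphic functions with bounded means -/

/-- `g` is holomorphic on the disk and the averages of `‖g‖ ^ p` on concentric circles are at most
`A`. -/
structure HasBoundedMeans (p A : ℝ) (g : ℂ → ℂ) : Prop where
  holo : DifferentiableOn ℂ g (ball 0 1)
  le : ∀ r ∈ Set.Ioo (0 : ℝ) 1, circleAverage (fun z => ‖g z‖ ^ p) 0 r ≤ A

lemma sphere_subset_ball_one {r : ℝ} (hr : r ∈ Set.Ioo (0 : ℝ) 1) :
    sphere (0 : ℂ) r ⊆ ball 0 1 := fun z hz => by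
  have : ‖z‖ = r := by simpa using hz
  simpa [this] using hr.2

lemma HasBoundedMeans.nonneg {p A : ℝ} {g : ℂ → ℂ} (hg : HasBoundedMeans p A g) : 0 ≤ A :=
  (circleAverage_nonneg_of_nonneg (fun z _ => by positivity)).trans
    (hg.le (1 / 2) ⟨by norm_num, by norm_num⟩)

/-- Poisson's formula on a circle around `z`'s radius, followed by Jensen's inequality and the upper
bound for the kernel. -/
lemma HasBoundedMeans.norm_rpow_le {p A : ℝ} (hp : 1 < p) {g : ℂ → ℂ} (hg : HasBoundedMeans p A g)
    {z : ℂ} (hz : ‖z‖ < 1) : ‖g z‖ ^ p ≤ 4 * A / (1 - ‖z‖) := by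
  -- Halfway to the unit circle the kernel is at most `(1 + 3‖z‖) / (1 - ‖z‖)`.
  set R := (1 + ‖z‖) / 2 with hRdef
  have hz0 := norm_nonneg z
  have hR : R ∈ Set.Ioo (0 : ℝ) 1 := ⟨by positivity, by rw [hRdef]; linarith⟩
  have hzR : ‖z‖ < R := by rw [hRdef]; linarith
  have hgs : ContinuousOn g (sphere 0 R) := hg.holo.continuousOn.mono (sphere_subset_ball_one hR)
  have hK := continuousOn_poissonKernel hzR
  have hdiff : DiffContOnCl ℂ g (ball 0 R) := by
    refine DifferentiableOn.diffContOnCl ?_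
    rw [closure_ball _ hR.1.ne']
    exact hg.holo.mono (closedBall_subset_ball hR.2)
  have hrep := hdiff.circleAverage_poissonKernel_smul (w := z) (by simpa using hzR)
  have hKnn : ∀ ζ ∈ sphere (0 : ℂ) |R|, 0 ≤ poissonKernel 0 z ζ := by
    intro ζ hζ
    rw [abs_of_pos hR.1] at hζ
    exact poissonKernel_nonneg (by rw [show ‖ζ‖ = R by simpa using hζ]; exact hzR.le)
  have hgp : ContinuousOn (fun ζ => ‖g ζ‖ ^ p) (sphere 0 R) :=
    hgs.norm.rpow_const fun _ _ => Or.inr (by linarith)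
  have h1 : ‖g z‖ ≤ circleAverage (fun ζ => poissonKernel 0 z ζ * ‖g ζ‖) 0 R := by
    rw [← hrep]
    refine norm_circleAverage_le.trans (le_of_eq (circleAverage_congr_sphere fun ζ hζ => ?_))
    simp only [Pi.smul_apply', norm_smul, norm_eq_abs]
    rw [abs_of_nonneg (hKnn ζ hζ)]
  have h2 := circleAverage_mul_rpow_le hp (k := poissonKernel 0 z) (φ := fun ζ => ‖g ζ‖) hKnn
    (fun _ _ => norm_nonneg _) (circleAverage_poissonKernel hzR) (hK.circleIntegrable hR.1.le)
    ((hK.mul hgs.norm).circleIntegrable hR.1.le) ((hK.mul hgp).circleIntegrable hR.1.le)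
  have h3 : circleAverage (fun ζ => poissonKernel 0 z ζ * ‖g ζ‖ ^ p) 0 R ≤
      circleAverage (fun ζ => (4 / (1 - ‖z‖)) • ‖g ζ‖ ^ p) 0 R := by
    refine circleAverage_mono ((hK.mul hgp).circleIntegrable hR.1.le)
      (CircleIntegrable.const_smul (a := 4 / (1 - ‖z‖)) (hgp.circleIntegrable hR.1.le)) fun ζ hζ => ?_
    rw [abs_of_pos hR.1] at hζ
    have hζn : ‖ζ‖ = R := by simpa using hζ
    rw [smul_eq_mul]
    gcongr
    refine (poissonKernel_le (by rw [hζn]; exact hzR)).trans ?_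
    rw [hζn, hRdef, div_le_div_iff₀ (by linarith) (by linarith)]
    nlinarith
  rw [circleAverage_fun_smul, smul_eq_mul] at h3
  have h4 : 0 ≤ 4 / (1 - ‖z‖) := div_nonneg (by norm_num) (by linarith)
  calc ‖g z‖ ^ p ≤ _ := rpow_le_rpow (norm_nonneg _) h1 (by linarith)
    _ ≤ _ := h2
    _ ≤ _ := h3
    _ ≤ 4 / (1 - ‖z‖) * A := by gcongr; exact hg.le R hR
    _ = _ := by ring

/-- Since `p > 1`, the growth exponent `-1 / p` is integrable along radii, so primitives have
boundary values. -/
lemma HasBoundedMeans.norm_le {p A : ℝ} (hp : 1 < p) {g : ℂ → ℂ} (hg : HasBoundedMeans p A g)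
    {z : ℂ} (hz : ‖z‖ < 1) : ‖g z‖ ≤ (4 * A) ^ (1 / p) * (1 - ‖z‖) ^ (-1 / p) := by
  have h := hg.norm_rpow_le hp hz
  have hp0 : 0 < p := by linarith
  have h1 : 0 < 1 - ‖z‖ := by linarith
  have hA := hg.nonneg
  have h2 := rpow_le_rpow (by positivity) h (show 0 ≤ 1 / p by positivity)
  rw [← rpow_mul (norm_nonneg _), mul_one_div_cancel hp0.ne', rpow_one,
    div_rpow (by positivity) h1.le] at h2
  rwa [neg_div, rpow_neg h1.le, ← div_eq_mul_inv]

lemma circleMap_zero_eq (r θ : ℝ) : circleMap 0 r θ = r * circleMap 0 1 θ := by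
  simp [circleMap]

lemma circleMap_mem_ball_one {r : ℝ} (hr : r ∈ Set.Ico (0 : ℝ) 1) (θ : ℝ) :
    circleMap 0 r θ ∈ ball (0 : ℂ) 1 := by
  rw [mem_ball_zero_iff, norm_circleMap_zero, abs_of_nonneg hr.1]
  exact hr.2

/-- A primitive of a function with bounded means extends continuously to the boundary. -/
lemma HasBoundedMeans.exists_boundary_primitive {p A : ℝ} (hp : 1 < p) {g G : ℂ → ℂ}
    (hg : HasBoundedMeans p A g) (hG : ∀ z ∈ ball (0 : ℂ) 1, HasDerivAt G (g z) z) :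
    ∃ (Γ : ℝ → ℂ) (B : ℝ), ∀ r ∈ Set.Ioo (0 : ℝ) 1, ∀ θ,
      ‖G (circleMap 0 r θ) - Γ θ‖ ≤ B * (1 - r) ^ (1 - 1 / p) := by
  have hp0 : 0 < p := by linarith
  set γ := 1 - 1 / p with hγ
  have hγ0 : 0 < γ := by rw [hγ, sub_pos, div_lt_one hp0]; exact hp
  have hA := hg.nonneg
  set D := (4 * A) ^ (1 / p)
  have hD0 : 0 ≤ D := by positivity
  -- The constant comes from integrating `D * (1 - t) ^ (-1 / p)`.
  set B := D / γ with hB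
  have hB0 : 0 ≤ B := by positivity
  have key : ∀ θ : ℝ, ∀ r ∈ Set.Ioo (0 : ℝ) 1, ∀ s ∈ Set.Ico r 1,
      ‖G (circleMap 0 s θ) - G (circleMap 0 r θ)‖ ≤ B * (1 - r) ^ γ := by
    intro θ r hr s hs
    have hmem : ∀ t ∈ Set.Icc r s, t ∈ Set.Ico (0 : ℝ) 1 := fun t ht =>
      ⟨hr.1.le.trans ht.1, ht.2.trans_lt hs.2⟩
    have hd : ∀ t ∈ Set.Icc r s, HasDerivAt (fun t : ℝ => G (circleMap 0 t θ) - G (circleMap 0 r θ))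
        (g (circleMap 0 t θ) * circleMap 0 1 θ) t := by
      intro t ht
      have h1 : HasDerivAt (fun t : ℝ => circleMap 0 t θ) (circleMap 0 1 θ) t := by
        have : HasDerivAt (fun t : ℝ => (t : ℂ) * circleMap 0 1 θ) (1 * circleMap 0 1 θ) t :=
          (Complex.ofRealCLM.hasDerivAt (x := t)).mul_const _
        simpa only [← circleMap_zero_eq, one_mul] using this
      exact ((hG _ (circleMap_mem_ball_one (hmem t ht) θ)).comp t h1).sub_const _
    have hBd : ∀ t ∈ Set.Icc r s, HasDerivAt (fun t : ℝ => B * ((1 - r) ^ γ - (1 - t) ^ γ))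
        (D * (1 - t) ^ (-1 / p)) t := by
      intro t ht
      have ht1 : 0 < 1 - t := by linarith [(hmem t ht).2]
      have h1 : HasDerivAt (fun t : ℝ => 1 - t) (-1) t := (hasDerivAt_id t).const_sub 1
      have h2 := ((h1.rpow_const (p := γ) (Or.inl ht1.ne')).const_sub ((1 - r) ^ γ)).const_mul B
      refine h2.congr_deriv ?_
      have e : γ - 1 = -1 / p := by rw [hγ]; ring
      rw [e, hB]
      field_simp
    have := image_norm_le_of_norm_deriv_right_le_deriv_boundary'
      (fun t ht => (hd t ht).continuousAt.continuousWithinAt)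
      (fun t ht => (hd t (Set.Ico_subset_Icc_self ht)).hasDerivWithinAt)
      (B := fun t : ℝ => B * ((1 - r) ^ γ - (1 - t) ^ γ)) (by simp)
      (fun t ht => (hBd t ht).continuousAt.continuousWithinAt)
      (fun t ht => (hBd t (Set.Ico_subset_Icc_self ht)).hasDerivWithinAt)
      (fun t ht => by
        have ht' := hmem t (Set.Ico_subset_Icc_self ht)
        have hb := circleMap_mem_ball_one ht' θ
        have hn : ‖circleMap 0 t θ‖ = t := by rw [norm_circleMap_zero, abs_of_nonneg ht'.1]
        rw [norm_mul, norm_circleMap_zero, abs_one, mul_one]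
        have := hg.norm_le hp (z := circleMap 0 t θ) (by rw [hn]; exact ht'.2)
        rwa [hn] at this) (x := s) ⟨hs.1, le_rfl⟩
    refine this.trans ?_
    gcongr
    have : 0 ≤ (1 - s) ^ γ := rpow_nonneg (by linarith [hs.2]) _
    linarith
  have hseq : ∀ θ, ∃ w, Tendsto (fun r : ℝ => G (circleMap 0 r θ)) (𝓝[<] 1) (𝓝 w) := by
    intro θ
    refine CompleteSpace.complete (cauchy_map_iff.2 ⟨inferInstance, ?_⟩)
    rw [Metric.uniformity_basis_dist.tendsto_right_iff]
    intro ε hε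
    have hlim : Tendsto (fun r : ℝ => B * (1 - r) ^ γ) (𝓝[<] 1) (𝓝 0) := by
      have : ContinuousAt (fun r : ℝ => B * (1 - r) ^ γ) 1 := by
        refine continuousAt_const.mul (ContinuousAt.rpow_const (by fun_prop) (Or.inr hγ0.le))
      have h := this.tendsto
      rw [sub_self, zero_rpow hγ0.ne', mul_zero] at h
      exact h.mono_left nhdsWithin_le_nhds
    obtain ⟨r, hr1, hr2⟩ := ((hlim.eventually_lt_const (half_pos hε)).and
      (Ioo_mem_nhdsLT (show (0 : ℝ) < 1 by norm_num))).exists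
    have hmem : Set.Ioo r 1 ∈ 𝓝[<] (1 : ℝ) := Ioo_mem_nhdsLT hr2.2
    filter_upwards [prod_mem_prod hmem hmem] with x hx
    obtain ⟨h1, h2⟩ := hx
    have e1 := key θ r hr2 x.1 ⟨h1.1.le, h1.2⟩
    have e2 := key θ r hr2 x.2 ⟨h2.1.le, h2.2⟩
    rw [← dist_eq_norm] at e1 e2
    show dist _ _ < ε
    calc dist (G (circleMap 0 x.1 θ)) (G (circleMap 0 x.2 θ)) ≤ _ :=
          dist_triangle_right _ _ (G (circleMap 0 r θ))
      _ < ε := by linarith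
  choose Γ hΓ using hseq
  refine ⟨Γ, B, fun r hr θ => ?_⟩
  have hlim : Tendsto (fun s : ℝ => ‖G (circleMap 0 s θ) - G (circleMap 0 r θ)‖) (𝓝[<] 1)
      (𝓝 ‖Γ θ - G (circleMap 0 r θ)‖) := ((hΓ θ).sub_const _).norm
  rw [norm_sub_rev]
  refine le_of_tendsto hlim ?_
  filter_upwards [Ioo_mem_nhdsLT hr.2] with s hs using key θ r hr s ⟨hs.1.le, hs.2⟩


/-! ### Bounded variation of the boundary primitive, and radial limits -/

lemma HasBoundedMeans.circleAverage_norm_le {p A : ℝ} (hp : 1 < p) {g : ℂ → ℂ}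
    (hg : HasBoundedMeans p A g) {r : ℝ} (hr : r ∈ Set.Ioo (0 : ℝ) 1) :
    circleAverage (fun z => ‖g z‖) 0 r ≤ 1 + A := by
  have hgs : ContinuousOn g (sphere 0 r) := hg.holo.continuousOn.mono (sphere_subset_ball_one hr)
  have i1 : CircleIntegrable (fun z => ‖g z‖) 0 r := hgs.norm.circleIntegrable hr.1.le
  have i2 : CircleIntegrable (fun z => ‖g z‖ ^ p) 0 r :=
    (hgs.norm.rpow_const fun _ _ => Or.inr (by linarith)).circleIntegrable hr.1.le
  have h := circleAverage_mono i1 ((circleIntegrable_const (1 : ℝ) 0 r).add i2) fun z _ => by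
    simp only [Pi.add_apply]
    rcases le_total ‖g z‖ 1 with h | h
    · have : 0 ≤ ‖g z‖ ^ p := by positivity
      linarith
    · have := self_le_rpow_of_one_le h hp.le
      linarith
  rw [circleAverage_add (circleIntegrable_const _ _ _) i2, circleAverage_const] at h
  linarith [hg.le r hr]

lemma eVariationOn_le_of_norm_sub_le {f : ℝ → ℂ} {Φ : ℝ → ℝ}
    (h : ∀ x y, x ≤ y → ‖f y - f x‖ ≤ Φ y - Φ x) (a b : ℝ) :
    eVariationOn f (Set.univ ∩ Set.Icc a b) ≤ ENNReal.ofReal (Φ b - Φ a) := by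
  have hmono : Monotone Φ := fun x y hxy => by
    have := (norm_nonneg _).trans (h x y hxy); linarith
  rw [← (hmono.monotoneOn Set.univ).eVariationOn_eq (Set.mem_univ a) (Set.mem_univ b)]
  refine iSup_le fun q => le_trans ?_ (le_iSup _ q)
  refine Finset.sum_le_sum fun i _ => ?_
  have hle : (q.2 : ℕ → ℝ) i ≤ (q.2 : ℕ → ℝ) (i + 1) := q.2.2.1 (Nat.le_succ i)
  rw [edist_dist, edist_dist]
  refine ENNReal.ofReal_le_ofReal ?_
  rw [dist_eq_norm, dist_eq_norm, norm_eq_abs]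
  exact (h _ _ hle).trans (le_abs_self _)

/-- On the circle of radius `r` the variation of `G` is at most the integral of `‖g‖`, bounded
uniformly in `r`; variation is lower semicontinuous under pointwise limits. -/
lemma HasBoundedMeans.locallyBoundedVariationOn {p A : ℝ} (hp : 1 < p) {g G : ℂ → ℂ}
    (hg : HasBoundedMeans p A g) (hG : ∀ z ∈ ball (0 : ℂ) 1, HasDerivAt G (g z) z) {Γ : ℝ → ℂ}
    (hΓ : ∀ θ, Tendsto (fun r : ℝ => G (circleMap 0 r θ)) (𝓝[<] 1) (𝓝 (Γ θ))) :
    LocallyBoundedVariationOn Γ Set.univ := by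
  intro a b _ _
  -- `N` periods cover `[a, b]`, each contributing at most `2π(1 + A)`.
  obtain ⟨N, hN⟩ := exists_nat_ge ((b - a) / (2 * π))
  have hbN : b ≤ a + (N : ℤ) • (2 * π) := by
    rw [div_le_iff₀ two_pi_pos] at hN
    simp only [zsmul_eq_mul, Int.cast_natCast]
    linarith
  have hA := hg.nonneg
  refine ne_top_of_le_ne_top (b := ENNReal.ofReal (N * (2 * π * (1 + A)))) ENNReal.ofReal_ne_top ?_
  by_contra! hcon
  have hev := eVariationOn.lowerSemicontinuous_aux (F := fun (r : ℝ) θ => G (circleMap 0 r θ))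
    (p := 𝓝[<] (1 : ℝ)) (fun θ _ => hΓ θ) hcon
  obtain ⟨r, h1, hr⟩ := (hev.and (Ioo_mem_nhdsLT (show (0 : ℝ) < 1 by norm_num))).exists
  refine absurd h1 (not_lt.2 ?_)
  have hcont : Continuous fun t : ℝ => g (circleMap 0 r t) :=
    hg.holo.continuousOn.comp_continuous (continuous_circleMap 0 r)
      fun t => circleMap_mem_ball_one ⟨hr.1.le, hr.2⟩ t
  have hder : ∀ t : ℝ, HasDerivAt (fun θ => G (circleMap 0 r θ))
      (g (circleMap 0 r t) * (circleMap 0 r t * Complex.I)) t := fun t =>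
    (hG _ (circleMap_mem_ball_one ⟨hr.1.le, hr.2⟩ t)).comp t (hasDerivAt_circleMap 0 r t)
  have hcn : Continuous fun t : ℝ => ‖g (circleMap 0 r t)‖ := hcont.norm
  have hI : ∀ x y : ℝ, IntervalIntegrable (fun t : ℝ => ‖g (circleMap 0 r t)‖) volume x y :=
    fun x y => hcn.intervalIntegrable x y
  have hbd : ∀ x y : ℝ, x ≤ y → ‖G (circleMap 0 r y) - G (circleMap 0 r x)‖ ≤
      (∫ t in (0 : ℝ)..y, ‖g (circleMap 0 r t)‖) - ∫ t in (0 : ℝ)..x, ‖g (circleMap 0 r t)‖ := by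
    intro x y hxy
    have hcm := continuous_circleMap 0 r
    rw [intervalIntegral.integral_interval_sub_left (hI _ _) (hI _ _),
      ← intervalIntegral.integral_eq_sub_of_hasDerivAt (fun t _ => hder t)
      ((hcont.mul (hcm.mul continuous_const)).intervalIntegrable x y)]
    refine intervalIntegral.norm_integral_le_of_norm_le hxy ?_ (hI x y)
    refine Eventually.of_forall fun t _ => ?_
    rw [norm_mul, norm_mul, Complex.norm_I, mul_one, norm_circleMap_zero, abs_of_pos hr.1]
    exact mul_le_of_le_one_right (norm_nonneg _) hr.2.le
  refine (eVariationOn_le_of_norm_sub_le hbd a b).trans (ENNReal.ofReal_le_ofReal ?_)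
  rw [intervalIntegral.integral_interval_sub_left (hI _ _) (hI _ _)]
  rcases le_total a b with hab | hab
  swap
  · have : ∫ t in a..b, ‖g (circleMap 0 r t)‖ ≤ 0 := by
      rw [intervalIntegral.integral_symm, neg_nonpos]
      exact intervalIntegral.integral_nonneg hab fun _ _ => norm_nonneg _
    refine this.trans ?_
    have := pi_pos
    positivity
  have hper : Function.Periodic (fun t : ℝ => ‖g (circleMap 0 r t)‖) (2 * π) := fun t => by
    simp only [periodic_circleMap 0 r t]
  calc ∫ t in a..b, ‖g (circleMap 0 r t)‖
      ≤ ∫ t in a..(a + (N : ℤ) • (2 * π)), ‖g (circleMap 0 r t)‖ :=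
        intervalIntegral.integral_mono_interval le_rfl hab hbN
          (Eventually.of_forall fun _ => norm_nonneg _) (hI _ _)
    _ = N * ∫ t in (0 : ℝ)..2 * π, ‖g (circleMap 0 r t)‖ := by
        rw [hper.intervalIntegral_add_zsmul_eq N a hI, hper.intervalIntegral_add_eq a 0, zero_add]
        simp
    _ ≤ N * (2 * π * (1 + A)) := by
        have h := hg.circleAverage_norm_le hp hr
        rw [circleAverage_def, smul_eq_mul, inv_mul_le_iff₀ two_pi_pos] at h
        gcongr

/-- A holomorphic function with bounded means of order `p > 1` has radial limits. -/
theorem HasBoundedMeans.hasRadialLimits {p A : ℝ} (hp : 1 < p) {g : ℂ → ℂ}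
    (hg : HasBoundedMeans p A g) : HasRadialLimits g := by
  have hp0 : 0 < p := by linarith
  obtain ⟨G, hG⟩ := hg.holo.isExactOn_ball
  obtain ⟨Γ, B, hB⟩ := hg.exists_boundary_primitive hp hG
  have hγ0 : 0 < 1 - 1 / p := by rw [sub_pos, div_lt_one hp0]; exact hp
  have hlim0 : Tendsto (fun r : ℝ => B * (1 - r) ^ (1 - 1 / p)) (𝓝[<] 1) (𝓝 0) := by
    have : ContinuousAt (fun r : ℝ => B * (1 - r) ^ (1 - 1 / p)) 1 := by
      refine continuousAt_const.mul (ContinuousAt.rpow_const (by fun_prop) (Or.inr hγ0.le))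
    have h := this.tendsto
    rw [sub_self, zero_rpow hγ0.ne', mul_zero] at h
    exact h.mono_left nhdsWithin_le_nhds
  have hI : Set.Ioo (0 : ℝ) 1 ∈ 𝓝[<] (1 : ℝ) := Ioo_mem_nhdsLT (by norm_num)
  have hGc : ContinuousOn G (ball 0 1) := fun z hz => (hG z hz).continuousAt.continuousWithinAt
  have hGr : ∀ r ∈ Set.Ioo (0 : ℝ) 1, Continuous fun θ : ℝ => G (circleMap 0 r θ) := fun r hr =>
    hGc.comp_continuous (continuous_circleMap 0 r) fun t => circleMap_mem_ball_one ⟨hr.1.le, hr.2⟩ t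
  have hunif : TendstoUniformly (fun (r : ℝ) θ => G (circleMap 0 r θ)) Γ (𝓝[<] 1) := by
    rw [Metric.tendstoUniformly_iff]
    intro ε hε
    filter_upwards [hlim0.eventually_lt_const hε, hI] with r h1 h2 θ
    rw [dist_comm, dist_eq_norm]
    exact (hB r h2 θ).trans_lt h1
  have hΓc : Continuous Γ := hunif.continuous (Eventually.frequently (by
    filter_upwards [hI] with r hr using hGr r hr))
  have hΓl : ∀ θ, Tendsto (fun r : ℝ => G (circleMap 0 r θ)) (𝓝[<] 1) (𝓝 (Γ θ)) :=
    fun θ => hunif.tendsto_at θ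
  -- The derivative formula holds for the dilates `G(ρ ·)`, holomorphic beyond the closed disk;
  -- letting `ρ → 1` puts `Γ` in place of `G`.
  have hformula : ∀ θ : ℝ, ∀ r ∈ Set.Ioo (0 : ℝ) 1, circleMap 0 r θ * g (circleMap 0 r θ) =
      (2 * π)⁻¹ • ∫ s in -π..π, (-Complex.I * poissonDeriv r s) * Γ (s + θ) := by
    intro θ r hr
    have hKc := continuous_poissonDeriv hr
    have hz : circleMap 0 r θ ∈ ball (0 : ℂ) 1 := circleMap_mem_ball_one ⟨hr.1.le, hr.2⟩ θ
    have hρ : ∀ ρ ∈ Set.Ioo (0 : ℝ) 1, circleMap 0 r θ * (g (ρ * circleMap 0 r θ) * ρ) =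
        (2 * π)⁻¹ • ∫ s in -π..π, (-Complex.I * poissonDeriv r s) * G (circleMap 0 ρ (s + θ)) := by
      intro ρ hρ
      have hsub : closedBall (0 : ℂ) 1 ⊆ ball 0 ρ⁻¹ :=
        closedBall_subset_ball ((one_lt_inv₀ hρ.1).2 hρ.2)
      have hin : ∀ z ∈ ball (0 : ℂ) ρ⁻¹, (ρ : ℂ) * z ∈ ball (0 : ℂ) 1 := by
        intro z hz
        rw [mem_ball_zero_iff] at hz ⊢
        rw [norm_mul, Complex.norm_real, norm_eq_abs, abs_of_pos hρ.1]
        calc ρ * ‖z‖ < ρ * ρ⁻¹ := by gcongr; exact hρ.1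
          _ = 1 := mul_inv_cancel₀ hρ.1.ne'
      have hd : ∀ z ∈ ball (0 : ℂ) ρ⁻¹, HasDerivAt (fun z => G (ρ * z)) (g (ρ * z) * ρ) z := by
        intro z hz
        have h1 : HasDerivAt (fun z : ℂ => (ρ : ℂ) * z) ρ z := by
          simpa using (hasDerivAt_id z).const_mul (ρ : ℂ)
        exact (hG _ (hin z hz)).comp z h1
      have := mul_deriv_eq_integral_poissonDeriv isOpen_ball hsub
        (fun z hz => (hd z hz).differentiableAt.differentiableWithinAt) hr θ
      rw [(hd _ (hsub (ball_subset_closedBall hz))).deriv] at this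
      simpa only [← circleMap_zero_eq] using this
    have hL : Tendsto (fun ρ : ℝ => circleMap 0 r θ * (g (ρ * circleMap 0 r θ) * ρ)) (𝓝[<] 1)
        (𝓝 (circleMap 0 r θ * (g (circleMap 0 r θ)))) := by
      have hgat : ContinuousAt g (((1 : ℝ) : ℂ) * circleMap 0 r θ) := by
        rw [Complex.ofReal_one, one_mul]
        exact hg.holo.continuousOn.continuousAt (isOpen_ball.mem_nhds hz)
      have h1 : ContinuousAt (fun ρ : ℝ => (ρ : ℂ) * circleMap 0 r θ) 1 := by fun_prop
      have h2 : ContinuousAt (fun ρ : ℝ => g (ρ * circleMap 0 r θ)) 1 :=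
        ContinuousAt.comp (f := fun ρ : ℝ => (ρ : ℂ) * circleMap 0 r θ) hgat h1
      have h3 : ContinuousAt (fun ρ : ℝ => circleMap 0 r θ * (g (ρ * circleMap 0 r θ) * ρ)) 1 := by
        fun_prop
      have := h3.tendsto
      simp only [Complex.ofReal_one, one_mul, mul_one] at this
      exact this.mono_left nhdsWithin_le_nhds
    have hR : Tendsto (fun ρ : ℝ => (2 * π)⁻¹ • ∫ s in -π..π,
        (-Complex.I * poissonDeriv r s) * G (circleMap 0 ρ (s + θ))) (𝓝[<] 1)
        (𝓝 ((2 * π)⁻¹ • ∫ s in -π..π, (-Complex.I * poissonDeriv r s) * Γ (s + θ))) := by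
      refine Tendsto.const_smul ?_ _
      refine intervalIntegral.tendsto_integral_filter_of_dominated_convergence
        (fun s => |poissonDeriv r s| * (‖Γ (s + θ)‖ + 1)) ?_ ?_ ?_ ?_
      · filter_upwards [hI] with ρ hρ
        have : Continuous fun s => G (circleMap 0 ρ (s + θ)) :=
          (hGr ρ hρ).comp (continuous_add_const θ)
        exact ((continuous_const.mul (Complex.continuous_ofReal.comp hKc)).mul
          this).aestronglyMeasurable
      · filter_upwards [hI, hlim0.eventually_lt_const one_pos] with ρ hρ h1
        refine Eventually.of_forall fun s _ => ?_
        have h2 := (hB ρ hρ (s + θ)).trans h1.le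
        have h3 : ‖G (circleMap 0 ρ (s + θ))‖ ≤ ‖Γ (s + θ)‖ + 1 := by
          have := norm_sub_norm_le (G (circleMap 0 ρ (s + θ))) (Γ (s + θ))
          linarith
        rw [norm_mul, norm_mul, norm_neg, Complex.norm_I, one_mul, Complex.norm_real, norm_eq_abs]
        gcongr
      · exact Continuous.intervalIntegrable (by fun_prop) _ _
      · exact Eventually.of_forall fun s _ => (hΓl _).const_mul _
    refine tendsto_nhds_unique (hL.congr' ?_) hR
    filter_upwards [hI] with ρ hρ' using hρ ρ hρ'
  -- Bounded variation gives differentiability almost everywhere; at such `θ`, `z * g z` tends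
  -- radially to `-i Γ'(θ)`.
  have hae := (hg.locallyBoundedVariationOn hp hG hΓl).ae_differentiableAt
  filter_upwards [hae] with θ hθ
  have h1 := tendsto_integral_poissonDeriv hΓc hθ.hasDerivAt
  refine ⟨-Complex.I * deriv Γ θ / circleMap 0 1 θ, ?_⟩
  have h2 : Tendsto (fun r : ℝ => circleMap 0 r θ) (𝓝[<] 1) (𝓝 (circleMap 0 1 θ)) := by
    have : Continuous fun r : ℝ => circleMap 0 r θ := by
      simp only [circleMap]; fun_prop
    exact (this.tendsto 1).mono_left nhdsWithin_le_nhds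
  refine (h1.div h2 (circleMap_ne_center one_ne_zero)).congr' ?_
  filter_upwards [hI] with r hr
  rw [Pi.div_apply, ← hformula θ r hr, mul_div_cancel_left₀ _ (circleMap_ne_center hr.1.ne'),
    ← circleMap_zero_eq]


/-! ### Boundary values -/

lemma HasRadialLimits.tendsto_boundaryValue {f : ℂ → ℂ} (hf : HasRadialLimits f) :
    ∀ᵐ θ : ℝ, Tendsto (fun r : ℝ => f (r * circleMap 0 1 θ)) (𝓝[<] 1)
      (𝓝 (boundaryValue f (circleMap 0 1 θ))) := by
  filter_upwards [hf] with θ hθ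
  exact tendsto_nhds_limUnder hθ

/-- A sequence of radii increasing to `1`. -/
def radius (n : ℕ) : ℝ := 1 - 1 / ((n : ℝ) + 2)

lemma radius_mem (n : ℕ) : radius n ∈ Set.Ioo (0 : ℝ) 1 := by
  have h : (0 : ℝ) < (n : ℝ) + 2 := by positivity
  have h1 : 1 / ((n : ℝ) + 2) < 1 := by
    rw [div_lt_one h]
    have : (0 : ℝ) ≤ n := n.cast_nonneg
    linarith
  have h2 : 0 < 1 / ((n : ℝ) + 2) := by positivity
  exact ⟨by unfold radius; linarith, by unfold radius; linarith⟩

lemma tendsto_radius : Tendsto radius atTop (𝓝[<] 1) := by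
  refine tendsto_nhdsWithin_iff.2 ⟨?_, Eventually.of_forall fun n => (radius_mem n).2⟩
  have h1 : Tendsto (fun n : ℕ => (n : ℝ) + 2) atTop atTop :=
    tendsto_atTop_add_const_right _ _ tendsto_natCast_atTop_atTop
  have h2 := (h1.const_div_atTop 1).const_sub 1
  rw [sub_zero] at h2
  exact h2

lemma HasRadialLimits.tendsto_radius {f : ℂ → ℂ} (hf : HasRadialLimits f) :
    ∀ᵐ θ : ℝ, Tendsto (fun n => f (circleMap 0 (radius n) θ)) atTop
      (𝓝 (boundaryValue f (circleMap 0 1 θ))) := by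
  filter_upwards [hf.tendsto_boundaryValue] with θ hθ
  simp only [circleMap_zero_eq (radius _)]
  exact hθ.comp HarmonicHardy.tendsto_radius

lemma continuous_comp_circleMap {E : Type*} [TopologicalSpace E] {F : ℂ → E}
    (hF : ContinuousOn F (ball 0 1)) {r : ℝ} (hr : r ∈ Set.Ioo (0 : ℝ) 1) :
    Continuous fun θ : ℝ => F (circleMap 0 r θ) :=
  hF.comp_continuous (continuous_circleMap 0 r) fun t => circleMap_mem_ball_one ⟨hr.1.le, hr.2⟩ t

lemma circleIntegrable_iff_integrable {E : Type*} [NormedAddCommGroup E] {F : ℂ → E} {r : ℝ} :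
    CircleIntegrable F 0 r ↔
      Integrable (fun θ : ℝ => F (circleMap 0 r θ)) (volume.restrict (Set.Ioc 0 (2 * π))) := by
  rw [CircleIntegrable, intervalIntegrable_iff_integrableOn_Ioc_of_le two_pi_pos.le, IntegrableOn]

lemma circleAverage_eq_integral_restrict {E : Type*} [NormedAddCommGroup E] [NormedSpace ℝ E]
    {F : ℂ → E} {r : ℝ} : circleAverage F 0 r =
      (2 * π)⁻¹ • ∫ θ in Set.Ioc 0 (2 * π), F (circleMap 0 r θ) := by
  rw [circleAverage_def, intervalIntegral.integral_of_le two_pi_pos.le]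

/-- Fatou's lemma for circle averages. -/
lemma circleIntegrable_of_tendsto {Ψ ψ : ℂ → ℝ} {B : ℝ} (hΨ : ContinuousOn Ψ (ball 0 1))
    (hΨ0 : ∀ z, 0 ≤ Ψ z) (hψ0 : ∀ z, 0 ≤ ψ z)
    (hlim : ∀ᵐ θ : ℝ, Tendsto (fun n => Ψ (circleMap 0 (radius n) θ)) atTop
      (𝓝 (ψ (circleMap 0 1 θ))))
    (hB : ∀ r ∈ Set.Ioo (0 : ℝ) 1, circleAverage Ψ 0 r ≤ B) :
    CircleIntegrable ψ 0 1 ∧ circleAverage ψ 0 1 ≤ B := by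
  set μ : Measure ℝ := volume.restrict (Set.Ioc 0 (2 * π)) with hμ
  have hlim' : ∀ᵐ θ ∂μ, Tendsto (fun n => Ψ (circleMap 0 (radius n) θ)) atTop
      (𝓝 (ψ (circleMap 0 1 θ))) := ae_restrict_of_ae hlim
  have hc : ∀ n, Continuous fun θ : ℝ => Ψ (circleMap 0 (radius n) θ) := fun n =>
    continuous_comp_circleMap hΨ (radius_mem n)
  have hmeas : AEStronglyMeasurable (fun θ : ℝ => ψ (circleMap 0 1 θ)) μ :=
    aestronglyMeasurable_of_tendsto_ae atTop (fun n => (hc n).aestronglyMeasurable) hlim'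
  have hint : ∀ n, Integrable (fun θ : ℝ => Ψ (circleMap 0 (radius n) θ)) μ := fun n =>
    ((hc n).intervalIntegrable 0 (2 * π)).1
  -- Fatou's lemma in `[0, ∞]` yields integrability of the limit and the bound at once.
  have hle : ∫⁻ θ, ENNReal.ofReal (ψ (circleMap 0 1 θ)) ∂μ ≤ ENNReal.ofReal (2 * π * B) := by
    have h1 : ∫⁻ θ, ENNReal.ofReal (ψ (circleMap 0 1 θ)) ∂μ =
        ∫⁻ θ, liminf (fun n => ENNReal.ofReal (Ψ (circleMap 0 (radius n) θ))) atTop ∂μ := by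
      refine lintegral_congr_ae ?_
      filter_upwards [hlim'] with θ hθ
      exact ((ENNReal.continuous_ofReal.tendsto _).comp hθ).liminf_eq.symm
    rw [h1]
    refine (lintegral_liminf_le fun n => ((hc n).measurable.ennreal_ofReal)).trans ?_
    refine liminf_le_of_le (by isBoundedDefault) fun b hb => ?_
    obtain ⟨n, hn⟩ := hb.exists
    refine hn.trans ?_
    rw [← ofReal_integral_eq_lintegral_ofReal (hint n) (Eventually.of_forall fun _ => hΨ0 _)]
    refine ENNReal.ofReal_le_ofReal ?_
    have := hB (radius n) (radius_mem n)
    rw [circleAverage_eq_integral_restrict, smul_eq_mul, inv_mul_le_iff₀ two_pi_pos] at this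
    exact this
  have hnn : 0 ≤ᵐ[μ] fun θ : ℝ => ψ (circleMap 0 1 θ) := Eventually.of_forall fun _ => hψ0 _
  have hI : Integrable (fun θ : ℝ => ψ (circleMap 0 1 θ)) μ := by
    refine ⟨hmeas, ?_⟩
    rw [hasFiniteIntegral_iff_ofReal hnn]
    exact hle.trans_lt ENNReal.ofReal_lt_top
  refine ⟨circleIntegrable_iff_integrable.2 hI, ?_⟩
  have hB0 : 0 ≤ B := (circleAverage_nonneg_of_nonneg fun z _ => hΨ0 z).trans
    (hB _ (radius_mem 0))
  rw [circleAverage_eq_integral_restrict, smul_eq_mul, inv_mul_le_iff₀ two_pi_pos]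
  rw [← ofReal_integral_eq_lintegral_ofReal hI hnn] at hle
  exact (ENNReal.ofReal_le_ofReal_iff (by have := pi_pos; positivity)).1 hle

/-- Dilations of a function with bounded means converge in mean to its boundary values. -/
lemma HasBoundedMeans.tendsto_integral_sub {p A : ℝ} (hp : 1 < p) {g : ℂ → ℂ}
    (hg : HasBoundedMeans p A g) : CircleIntegrable (boundaryValue g) 0 1 ∧
      Tendsto (fun n => ∫ θ in Set.Ioc 0 (2 * π),
        ‖g (circleMap 0 (radius n) θ) - boundaryValue g (circleMap 0 1 θ)‖) atTop (𝓝 0) := by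
  set μ : Measure ℝ := volume.restrict (Set.Ioc 0 (2 * π)) with hμ
  have hp0 : 0 < p := by linarith
  have hA := hg.nonneg
  have hlim : ∀ᵐ θ ∂μ, Tendsto (fun n => g (circleMap 0 (radius n) θ)) atTop
      (𝓝 (boundaryValue g (circleMap 0 1 θ))) :=
    ae_restrict_of_ae (hg.hasRadialLimits hp).tendsto_radius
  have hc : ∀ n, Continuous fun θ : ℝ => g (circleMap 0 (radius n) θ) := fun n =>
    continuous_comp_circleMap hg.holo.continuousOn (radius_mem n)
  -- Where `‖g‖ ≥ C` one has `‖g‖ ≤ C ^ (1 - p) * ‖g‖ ^ p`, and `C ^ (1 - p) → 0` as `p > 1`.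
  -- Vitali's theorem then gives convergence in mean.
  have hUI : UniformIntegrable (fun n (θ : ℝ) => g (circleMap 0 (radius n) θ)) 1 μ := by
    refine uniformIntegrable_of le_rfl ENNReal.one_ne_top
      (fun n => (hc n).aestronglyMeasurable) fun ε hε => ?_
    have hCe : ∃ C : NNReal, 0 < C ∧ (C : ℝ) ^ (1 - p) * (2 * π * A) ≤ ε := by
      have h1 : Tendsto (fun x : ℝ => x ^ (1 - p) * (2 * π * A)) atTop (𝓝 (0 * (2 * π * A))) := by
        have := tendsto_rpow_neg_atTop (show 0 < p - 1 by linarith)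
        rw [neg_sub] at this
        exact this.mul_const _
      rw [zero_mul] at h1
      obtain ⟨x, hx1, hx2⟩ := ((h1.eventually_le_const hε).and (eventually_gt_atTop 0)).exists
      exact ⟨⟨x, hx2.le⟩, hx2, hx1⟩
    obtain ⟨C, hC0, hC⟩ := hCe
    refine ⟨C, fun n => ?_⟩
    rw [eLpNorm_one_eq_lintegral_enorm]
    have hgp : Continuous fun θ : ℝ => ‖g (circleMap 0 (radius n) θ)‖ ^ p :=
      (hc n).norm.rpow_const fun _ => Or.inr hp0.le
    have hint : Integrable (fun θ : ℝ => (C : ℝ) ^ (1 - p) * ‖g (circleMap 0 (radius n) θ)‖ ^ p) μ :=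
      ((continuous_const.mul hgp).intervalIntegrable 0 (2 * π)).1
    calc ∫⁻ θ, ‖({x : ℝ | C ≤ ‖g (circleMap 0 (radius n) x)‖₊}.indicator
            (fun θ : ℝ => g (circleMap 0 (radius n) θ))) θ‖ₑ ∂μ
        ≤ ∫⁻ θ, ENNReal.ofReal ((C : ℝ) ^ (1 - p) * ‖g (circleMap 0 (radius n) θ)‖ ^ p) ∂μ := by
          refine lintegral_mono fun θ => ?_
          by_cases h : θ ∈ {x : ℝ | C ≤ ‖g (circleMap 0 (radius n) x)‖₊}
          · rw [Set.indicator_of_mem h, ← ofReal_norm]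
            refine ENNReal.ofReal_le_ofReal ?_
            have h' : (C : ℝ) ≤ ‖g (circleMap 0 (radius n) θ)‖ := h
            have hCr : (0 : ℝ) < C := hC0
            set t := ‖g (circleMap 0 (radius n) θ)‖
            have ht : 0 < t := hCr.trans_le h'
            have e : t = t ^ (1 - p) * t ^ p := by rw [← rpow_add ht]; simp
            calc t = t ^ (1 - p) * t ^ p := e
              _ ≤ (C : ℝ) ^ (1 - p) * t ^ p := by
                gcongr ?_ * _
                exact rpow_le_rpow_of_nonpos hCr h' (by linarith)
          · rw [Set.indicator_of_notMem h]; simp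
      _ = ENNReal.ofReal (∫ θ, (C : ℝ) ^ (1 - p) * ‖g (circleMap 0 (radius n) θ)‖ ^ p ∂μ) := by
          rw [ofReal_integral_eq_lintegral_ofReal hint (Eventually.of_forall fun _ => by positivity)]
      _ ≤ ENNReal.ofReal ε := by
          refine ENNReal.ofReal_le_ofReal (le_trans ?_ hC)
          rw [integral_const_mul]
          have := hg.le (radius n) (radius_mem n)
          rw [circleAverage_eq_integral_restrict, smul_eq_mul, inv_mul_le_iff₀ two_pi_pos] at this
          gcongr
  have hmem := hUI.memLp_of_ae_tendsto hlim
  have hint := memLp_one_iff_integrable.1 hmem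
  refine ⟨circleIntegrable_iff_integrable.2 hint, ?_⟩
  have hconv := tendsto_Lp_finite_of_tendsto_ae le_rfl ENNReal.one_ne_top hUI.1 hmem
    hUI.unifIntegrable hlim
  have h2 := (ENNReal.tendsto_toReal ENNReal.zero_ne_top).comp hconv
  simp only [ENNReal.toReal_zero] at h2
  refine h2.congr fun n => ?_
  have hi : Integrable (fun θ : ℝ => g (circleMap 0 (radius n) θ) -
      boundaryValue g (circleMap 0 1 θ)) μ :=
    (((hc n).intervalIntegrable 0 (2 * π)).1 : Integrable _ μ).sub hint
  rw [Function.comp, eLpNorm_one_eq_lintegral_enorm, integral_norm_eq_lintegral_enorm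
    hi.aestronglyMeasurable]
  rfl

/-! ### Poisson representation by boundary values -/

lemma CircleIntegrable.poissonKernel_smul {E : Type*} [NormedAddCommGroup E] [NormedSpace ℝ E]
    {F : ℂ → E} (hF : CircleIntegrable F 0 1) {z : ℂ} (hz : ‖z‖ < 1) :
    CircleIntegrable (fun ζ => poissonKernel 0 z ζ • F ζ) 0 1 :=
  IntervalIntegrable.continuousOn_smul hF
    (((continuousOn_poissonKernel hz).comp_continuous (continuous_circleMap 0 1)
      fun θ => by simp).continuousOn)

/-- The Poisson representation of a function with bounded means by its boundary values. -/
lemma HasBoundedMeans.eq_circleAverage {p A : ℝ} (hp : 1 < p) {g : ℂ → ℂ}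
    (hg : HasBoundedMeans p A g) {z : ℂ} (hz : ‖z‖ < 1) :
    g z = circleAverage (fun ζ => poissonKernel 0 z ζ • boundaryValue g ζ) 0 1 := by
  obtain ⟨hint, hconv⟩ := hg.tendsto_integral_sub hp
  have hzb : z ∈ ball (0 : ℂ) 1 := by simpa using hz
  -- The formula is classical for dilates; it passes to the limit because the kernel is bounded for
  -- fixed `z`.
  have hrep : ∀ n, circleAverage (fun ζ => poissonKernel 0 z ζ • g (radius n * ζ)) 0 1 =
      g (radius n * z) := by
    intro n
    have hr := radius_mem n
    have hd : DiffContOnCl ℂ (fun ζ => g (radius n * ζ)) (ball 0 1) := by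
      refine DifferentiableOn.diffContOnCl ?_
      rw [closure_ball _ one_ne_zero]
      refine hg.holo.comp (by fun_prop) fun ζ hζ => ?_
      rw [mem_closedBall_zero_iff] at hζ
      rw [mem_ball_zero_iff, norm_mul, Complex.norm_real, norm_eq_abs, abs_of_pos hr.1]
      nlinarith [hr.1, hr.2]
    exact hd.circleAverage_poissonKernel_smul hzb
  have h1 : Tendsto (fun n => g (radius n * z)) atTop (𝓝 (g z)) := by
    have hgat : ContinuousAt g z := hg.holo.continuousOn.continuousAt (isOpen_ball.mem_nhds hzb)
    have h : Tendsto (fun n => (radius n : ℂ) * z) atTop (𝓝 z) := by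
      have := ((Complex.continuous_ofReal.tendsto 1).comp
        (tendsto_nhdsWithin_iff.1 tendsto_radius).1).mul_const z
      simpa using this
    exact hgat.tendsto.comp h
  refine tendsto_nhds_unique h1 ?_
  rw [tendsto_iff_norm_sub_tendsto_zero]
  set M := (1 + ‖z‖) / (1 - ‖z‖) with hM
  have hz1 : 0 < 1 - ‖z‖ := by linarith
  have hbound : Tendsto (fun n => (2 * π)⁻¹ * (M * ∫ θ in Set.Ioc 0 (2 * π),
        ‖g (circleMap 0 (radius n) θ) - boundaryValue g (circleMap 0 1 θ)‖)) atTop (𝓝 0) := by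
    have := (hconv.const_mul M).const_mul (2 * π)⁻¹
    simpa using this
  refine squeeze_zero (fun n => norm_nonneg _) (fun n => ?_) hbound
  have hr := radius_mem n
  have hcont : Continuous fun θ : ℝ => g (circleMap 0 (radius n) θ) :=
    continuous_comp_circleMap hg.holo.continuousOn hr
  have ig : CircleIntegrable (fun ζ => g (radius n * ζ)) 0 1 := by
    have : Continuous fun θ : ℝ => (fun ζ => g (radius n * ζ)) (circleMap 0 1 θ) := by
      simpa only [← circleMap_zero_eq] using hcont
    exact this.intervalIntegrable _ _
  have i1 : CircleIntegrable (fun ζ => poissonKernel 0 z ζ • g (radius n * ζ)) 0 1 :=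
    CircleIntegrable.poissonKernel_smul ig hz
  have i2 : CircleIntegrable (fun ζ => poissonKernel 0 z ζ • boundaryValue g ζ) 0 1 :=
    CircleIntegrable.poissonKernel_smul hint hz
  rw [← hrep n, ← circleAverage_fun_sub i1 i2]
  refine norm_circleAverage_le.trans ?_
  have i3 := (circleIntegrable_iff_integrable.1 (i1.sub i2)).norm
  have i4 := (circleIntegrable_iff_integrable.1 (ig.sub hint)).norm.const_mul M
  rw [circleAverage_eq_integral_restrict, smul_eq_mul, ← integral_const_mul M]
  have := inv_pos.2 two_pi_pos
  refine mul_le_mul_of_nonneg_left ?_ this.le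
  refine integral_mono i3 (by simpa [← circleMap_zero_eq] using i4) fun θ => ?_
  simp only
  rw [← smul_sub, norm_smul, norm_eq_abs, ← circleMap_zero_eq]
  have hn : ‖circleMap 0 1 θ‖ = 1 := by simp
  refine mul_le_mul_of_nonneg_right ?_ (norm_nonneg _)
  rw [abs_of_nonneg (poissonKernel_nonneg (by rw [hn]; exact hz.le))]
  refine (poissonKernel_le (by rw [hn]; exact hz)).trans ?_
  rw [hn]

/-- This symmetry lets the kernel be integrated over the interior variable instead of the boundary
one. -/
lemma poissonKernel_circleMap_comm {r : ℝ} (θ t : ℝ) :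
    poissonKernel 0 (circleMap 0 r θ) (circleMap 0 1 t) =
      poissonKernel 0 (circleMap 0 r t) (circleMap 0 1 θ) := by
  simp only [poissonKernel_def, sub_zero, norm_circleMap_zero]
  congr 1
  rw [← Complex.normSq_eq_norm_sq, ← Complex.normSq_eq_norm_sq, Complex.normSq_sub,
    Complex.normSq_sub]
  simp only [Complex.normSq_eq_norm_sq, norm_circleMap_zero]
  congr 2
  rw [← Complex.conj_re, map_mul, Complex.conj_conj, circleMap_zero_eq r θ, circleMap_zero_eq r t,
    map_mul, Complex.conj_ofReal]
  ring_nf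

/-- Poisson integrals contract `L^p` norms. -/
lemma circleAverage_rpow_le_of_poisson {p : ℝ} (hp : 1 < p) {f F : ℂ → ℂ}
    (hf : ContinuousOn f (ball 0 1)) (hF : CircleIntegrable F 0 1)
    (hFp : CircleIntegrable (fun ζ => ‖F ζ‖ ^ p) 0 1)
    (hrep : ∀ z, ‖z‖ < 1 → f z = circleAverage (fun ζ => poissonKernel 0 z ζ • F ζ) 0 1)
    {r : ℝ} (hr : r ∈ Set.Ioo (0 : ℝ) 1) :
    circleAverage (fun z => ‖f z‖ ^ p) 0 r ≤ circleAverage (fun ζ => ‖F ζ‖ ^ p) 0 1 := by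
  set μ : Measure ℝ := volume.restrict (Set.Ioc 0 (2 * π)) with hμ
  set k : ℝ → ℝ → ℝ := fun θ t => poissonKernel 0 (circleMap 0 r θ) (circleMap 0 1 t) with hk
  have hnr : ∀ θ, ‖circleMap 0 r θ‖ = r := fun θ => by rw [norm_circleMap_zero, abs_of_pos hr.1]
  have hn1 : ∀ θ, ‖circleMap 0 1 θ‖ = 1 := fun θ => by simp
  have hlt : ∀ θ, ‖circleMap 0 r θ‖ < 1 := fun θ => by rw [hnr]; exact hr.2
  have hk0 : ∀ θ t, 0 ≤ k θ t := fun θ t => poissonKernel_nonneg (by rw [hn1]; exact (hlt θ).le)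
  have hkM : ∀ θ t, k θ t ≤ (1 + r) / (1 - r) := fun θ t => by
    have := poissonKernel_le (w := circleMap 0 r θ) (ζ := circleMap 0 1 t)
      (by rw [hn1]; exact hlt θ)
    rwa [hn1, hnr] at this
  have hkc : Continuous (Function.uncurry k) := by
    have h1 := continuous_circleMap 0 r
    have h2 := continuous_circleMap 0 1
    have e : Function.uncurry k = fun q : ℝ × ℝ => (‖circleMap 0 1 q.2‖ ^ 2 -
        ‖circleMap 0 r q.1‖ ^ 2) / ‖circleMap 0 1 q.2 - circleMap 0 r q.1‖ ^ 2 := by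
      ext q; simp only [hk, Function.uncurry, poissonKernel_def, sub_zero]
    rw [e]
    refine Continuous.div (by fun_prop) (by fun_prop) fun q => pow_ne_zero 2 ?_
    rw [norm_ne_zero_iff, sub_ne_zero]
    intro h
    have := hlt q.1
    rw [← h, hn1] at this
    exact lt_irrefl _ this
  have hk1 : ∀ t, ∫ θ, k θ t ∂μ = 2 * π := by
    intro t
    have h := circleAverage_poissonKernel (hlt t)
    rw [circleAverage_eq_integral_restrict, smul_eq_mul, inv_mul_eq_iff_eq_mul₀ two_pi_pos.ne',
      mul_one] at h
    rw [← h]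
    refine integral_congr_ae (Eventually.of_forall fun θ => ?_)
    exact poissonKernel_circleMap_comm θ t
  have hFi := circleIntegrable_iff_integrable.1 hFp
  have hprod : Integrable (Function.uncurry fun θ t => k θ t * ‖F (circleMap 0 1 t)‖ ^ p)
      (μ.prod μ) := by
    have h1 : Integrable (fun q : ℝ × ℝ => ‖F (circleMap 0 1 q.2)‖ ^ p) (μ.prod μ) :=
      hFi.comp_snd μ
    refine h1.bdd_mul (c := (1 + r) / (1 - r)) hkc.aestronglyMeasurable
      (Eventually.of_forall fun q => ?_)
    rw [norm_eq_abs]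
    exact (abs_of_nonneg (hk0 q.1 q.2)).le.trans (hkM q.1 q.2)
  have hpt : ∀ θ : ℝ, ‖f (circleMap 0 r θ)‖ ^ p ≤
      (2 * π)⁻¹ * ∫ t, k θ t * ‖F (circleMap 0 1 t)‖ ^ p ∂μ := by
    intro θ
    have iF : CircleIntegrable (fun ζ => ‖F ζ‖) 0 1 := hF.norm
    have ik : CircleIntegrable (poissonKernel 0 (circleMap 0 r θ)) 0 1 :=
      (continuousOn_poissonKernel (hlt θ)).circleIntegrable zero_le_one
    have h1 := circleAverage_mul_rpow_le hp (k := poissonKernel 0 (circleMap 0 r θ))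
      (φ := fun ζ => ‖F ζ‖) (c := 0) (R := 1)
      (fun ζ hζ => poissonKernel_nonneg (by
        rw [show ‖ζ‖ = 1 by simpa using hζ]; exact (hlt θ).le))
      (fun _ _ => norm_nonneg _) (circleAverage_poissonKernel (hlt θ)) ik
      (CircleIntegrable.poissonKernel_smul iF (hlt θ))
      (CircleIntegrable.poissonKernel_smul hFp (hlt θ))
    rw [circleAverage_eq_integral_restrict (F := fun z => _ * ‖F z‖ ^ p), smul_eq_mul] at h1
    refine le_trans ?_ h1
    refine rpow_le_rpow (norm_nonneg _) ?_ (by linarith)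
    rw [hrep _ (hlt θ)]
    refine norm_circleAverage_le.trans (le_of_eq (circleAverage_congr_sphere fun ζ hζ => ?_))
    simp only [norm_smul, norm_eq_abs]
    rw [abs_of_nonneg (poissonKernel_nonneg (by
      rw [show ‖ζ‖ = 1 by simpa using hζ]; exact (hlt θ).le))]
  have hfc : Continuous fun θ : ℝ => ‖f (circleMap 0 r θ)‖ ^ p :=
    (continuous_comp_circleMap hf hr).norm.rpow_const fun _ => Or.inr (by linarith)
  have hfi : Integrable (fun θ : ℝ => ‖f (circleMap 0 r θ)‖ ^ p) μ :=
    (hfc.intervalIntegrable 0 (2 * π)).1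
  rw [circleAverage_eq_integral_restrict, circleAverage_eq_integral_restrict, smul_eq_mul,
    smul_eq_mul]
  have := inv_pos.2 two_pi_pos
  gcongr ?_ * ?_
  -- After the pointwise Jensen bound, Fubini's theorem integrates the kernel in `θ` first, giving
  -- `2π`.
  calc ∫ θ, ‖f (circleMap 0 r θ)‖ ^ p ∂μ
      ≤ ∫ θ, (2 * π)⁻¹ * ∫ t, k θ t * ‖F (circleMap 0 1 t)‖ ^ p ∂μ ∂μ :=
        integral_mono hfi (hprod.integral_prod_left.const_mul _) hpt
    _ = (2 * π)⁻¹ * ∫ t, ∫ θ, k θ t * ‖F (circleMap 0 1 t)‖ ^ p ∂μ ∂μ := by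
        rw [integral_const_mul, integral_integral_swap hprod]
    _ = ∫ t, ‖F (circleMap 0 1 t)‖ ^ p ∂μ := by
        simp only [integral_mul_const, hk1, integral_const_mul]
        rw [← mul_assoc, inv_mul_cancel₀ two_pi_pos.ne', one_mul]


/-! ### The Riesz type inequality -/

lemma circleIntegrable_of_continuousOn_ball {E : Type*} [NormedAddCommGroup E] {F : ℂ → E}
    (hF : ContinuousOn F (ball 0 1)) {r : ℝ} (hr : r ∈ Set.Ioo (0 : ℝ) 1) :
    CircleIntegrable F 0 r :=
  (hF.mono (sphere_subset_ball_one hr)).circleIntegrable hr.1.le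

section

variable {p : ℝ} {f g h : ℂ → ℂ}

lemma IsHardy.continuousOn (hf : IsHardy p f g h) : ContinuousOn f (ball 0 1) := by
  refine ContinuousOn.congr ?_ hf.eq_add_conj
  exact hf.holo_g.continuousOn.add
    (Complex.continuous_conj.comp_continuousOn hf.holo_h.continuousOn)

lemma IsHardy.continuousOn_norm_rpow (hf : IsHardy p f g h) (hp : 1 < p) :
    ContinuousOn (fun z => ‖f z‖ ^ p) (ball 0 1) :=
  hf.continuousOn.norm.rpow_const fun _ _ => Or.inr (by linarith)

lemma IsHardy.continuousOn_pair (hf : IsHardy p f g h) (hp : 1 < p) :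
    ContinuousOn (fun z => (‖g z‖ ^ 2 + ‖h z‖ ^ 2) ^ (p / 2)) (ball 0 1) :=
  ((hf.holo_g.continuousOn.norm.pow 2).add (hf.holo_h.continuousOn.norm.pow 2)).rpow_const
    fun _ _ => Or.inr (by linarith)

lemma rpow_one_div_rpow {x p : ℝ} (hp : 1 < p) (hx : 0 ≤ x) : (x ^ (1 / p)) ^ p = x := by
  rw [one_div, rpow_inv_rpow hx (by linarith)]

lemma IsHardy.circleAverage_le (hf : IsHardy p f g h) (hp : 1 < p) {r : ℝ}
    (hr : r ∈ Set.Ioo (0 : ℝ) 1) :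
    circleAverage (fun z => ‖f z‖ ^ p) 0 r ≤ hardyNorm p f ^ p := by
  have h0 : 0 ≤ circleAverage (fun z => ‖f z‖ ^ p) 0 r :=
    circleAverage_nonneg_of_nonneg fun z _ => by positivity
  have h1 : integralMean p f r ≤ hardyNorm p f :=
    le_csSup hf.bddAbove_means (Set.mem_image_of_mem _ hr)
  rw [← rpow_one_div_rpow hp h0]
  exact rpow_le_rpow (by positivity) h1 (by linarith)

/-- The integral form of the inequality on interior circles. -/
lemma IsHardy.circleAverage_pair_le (hf : IsHardy p f g h) (hp : 1 < p)
    (h0 : 0 ≤ (g 0 * h 0).re) {r : ℝ} (hr : r ∈ Set.Ioo (0 : ℝ) 1) :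
    circleAverage (fun z => (‖g z‖ ^ 2 + ‖h z‖ ^ 2) ^ (p / 2)) 0 r ≤
      rieszConst p ^ p * circleAverage (fun z => ‖f z‖ ^ p) 0 r := by
  obtain ⟨K, hK, hle⟩ := exists_pow_le_sub_powerSubharmonic hp
  have hgh : DifferentiableOn ℂ (fun z => g z * h z) (ball 0 1) := hf.holo_g.mul hf.holo_h
  -- The correction term averages to at least its value at the centre, which is nonnegative.
  have hV := (hasPowerSupport_powerSubharmonic hp).le_circleAverage
    (continuous_powerSubharmonic hp) hr.1 hr.2 hgh
  have hV0 := (powerSubharmonic_nonneg hp h0).trans hV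
  have iV : CircleIntegrable (fun z => powerSubharmonic p (g z * h z)) 0 r :=
    circleIntegrable_of_continuousOn_ball
      ((continuous_powerSubharmonic hp).comp_continuousOn hgh.continuousOn) hr
  have iF := circleIntegrable_of_continuousOn_ball (hf.continuousOn_norm_rpow hp) hr
  have iP := circleIntegrable_of_continuousOn_ball (hf.continuousOn_pair hp) hr
  have iF' : CircleIntegrable (fun z => rieszConst p ^ p * ‖f z‖ ^ p) 0 r := iF.const_mul _
  have iV' : CircleIntegrable (fun z => K * powerSubharmonic p (g z * h z)) 0 r := iV.const_mul _
  calc circleAverage (fun z => (‖g z‖ ^ 2 + ‖h z‖ ^ 2) ^ (p / 2)) 0 r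
      ≤ circleAverage (fun z => rieszConst p ^ p * ‖f z‖ ^ p -
          K * powerSubharmonic p (g z * h z)) 0 r := by
        refine circleAverage_mono iP (iF'.sub iV') fun z hz => ?_
        rw [abs_of_pos hr.1] at hz
        rw [hf.eq_add_conj z (sphere_subset_ball_one hr hz)]
        exact hle _ _
    _ = rieszConst p ^ p * circleAverage (fun z => ‖f z‖ ^ p) 0 r -
          K * circleAverage (fun z => powerSubharmonic p (g z * h z)) 0 r := by
        rw [circleAverage_fun_sub iF' iV']
        congr 1
        · exact circleAverage_fun_smul (a := rieszConst p ^ p)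
        · exact circleAverage_fun_smul (a := K)
    _ ≤ _ := sub_le_self _ (mul_nonneg hK hV0)

lemma rieszConst_pos (hp : 1 < p) : 0 < rieszConst p := by
  have := abs_cos_pi_div_lt_one hp
  unfold rieszConst
  have : 0 < √(1 - |cos (π / p)|) := sqrt_pos.2 (by linarith)
  positivity

lemma rpow_le_pair_rpow (hp : 1 < p) {a b : ℝ} (ha : 0 ≤ a) :
    a ^ p ≤ (a ^ 2 + b ^ 2) ^ (p / 2) := by
  calc a ^ p = (a ^ 2) ^ (p / 2) := by
        rw [← rpow_natCast, ← rpow_mul ha]; congr 1; push_cast; ring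
    _ ≤ _ := by
        refine rpow_le_rpow (by positivity) ?_ (by linarith)
        linarith [sq_nonneg b]

lemma IsHardy.pair_le (hf : IsHardy p f g h) (hp : 1 < p)
    (h0 : 0 ≤ (g 0 * h 0).re) {r : ℝ} (hr : r ∈ Set.Ioo (0 : ℝ) 1) :
    circleAverage (fun z => (‖g z‖ ^ 2 + ‖h z‖ ^ 2) ^ (p / 2)) 0 r ≤
      rieszConst p ^ p * hardyNorm p f ^ p := by
  have := rieszConst_pos hp
  exact (hf.circleAverage_pair_le hp h0 hr).trans
    (mul_le_mul_of_nonneg_left (hf.circleAverage_le hp hr) (by positivity))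

/-- The interior inequality controls each of `g` and `h` separately, which starts the boundary
theory. -/
lemma IsHardy.hasBoundedMeans_left (hf : IsHardy p f g h) (hp : 1 < p)
    (h0 : 0 ≤ (g 0 * h 0).re) :
    HasBoundedMeans p (rieszConst p ^ p * hardyNorm p f ^ p) g := by
  refine ⟨hf.holo_g, fun r hr => le_trans ?_ (hf.pair_le hp h0 hr)⟩
  refine circleAverage_mono (circleIntegrable_of_continuousOn_ball
    (hf.holo_g.continuousOn.norm.rpow_const fun _ _ => Or.inr (by linarith)) hr)
    (circleIntegrable_of_continuousOn_ball (hf.continuousOn_pair hp) hr) fun z _ => ?_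
  exact rpow_le_pair_rpow hp (norm_nonneg _)

lemma IsHardy.hasBoundedMeans_right (hf : IsHardy p f g h) (hp : 1 < p)
    (h0 : 0 ≤ (g 0 * h 0).re) :
    HasBoundedMeans p (rieszConst p ^ p * hardyNorm p f ^ p) h := by
  refine ⟨hf.holo_h, fun r hr => le_trans ?_ (hf.pair_le hp h0 hr)⟩
  refine circleAverage_mono (circleIntegrable_of_continuousOn_ball
    (hf.holo_h.continuousOn.norm.rpow_const fun _ _ => Or.inr (by linarith)) hr)
    (circleIntegrable_of_continuousOn_ball (hf.continuousOn_pair hp) hr) fun z _ => ?_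
  rw [add_comm]
  exact rpow_le_pair_rpow hp (norm_nonneg _)

lemma IsHardy.tendsto_of_tendsto (hf : IsHardy p f g h) {θ : ℝ} {a b : ℂ}
    (ha : Tendsto (fun r : ℝ => g (r * circleMap 0 1 θ)) (𝓝[<] 1) (𝓝 a))
    (hb : Tendsto (fun r : ℝ => h (r * circleMap 0 1 θ)) (𝓝[<] 1) (𝓝 b)) :
    Tendsto (fun r : ℝ => f (r * circleMap 0 1 θ)) (𝓝[<] 1) (𝓝 (a + (starRingEnd ℂ) b)) := by
  refine (ha.add ((Complex.continuous_conj.tendsto b).comp hb)).congr' ?_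
  filter_upwards [Ioo_mem_nhdsLT (show (0 : ℝ) < 1 by norm_num)] with r hr
  refine (hf.eq_add_conj _ ?_).symm
  rw [← circleMap_zero_eq]
  exact circleMap_mem_ball_one ⟨hr.1.le, hr.2⟩ θ

lemma IsHardy.hasRadialLimits (hf : IsHardy p f g h) (hg : HasRadialLimits g)
    (hh : HasRadialLimits h) : HasRadialLimits f := by
  filter_upwards [hg, hh] with θ ⟨a, ha⟩ ⟨b, hb⟩
  exact ⟨_, hf.tendsto_of_tendsto ha hb⟩

lemma IsHardy.boundaryValue_eq (hf : IsHardy p f g h) (hg : HasRadialLimits g)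
    (hh : HasRadialLimits h) : ∀ᵐ θ : ℝ, boundaryValue f (circleMap 0 1 θ) =
      boundaryValue g (circleMap 0 1 θ) + (starRingEnd ℂ) (boundaryValue h (circleMap 0 1 θ)) := by
  filter_upwards [hg.tendsto_boundaryValue, hh.tendsto_boundaryValue] with θ ha hb
  exact (hf.tendsto_of_tendsto ha hb).limUnder_eq

lemma circleAverage_conj {F : ℂ → ℂ} (hF : CircleIntegrable F 0 1) :
    circleAverage (fun z => (starRingEnd ℂ) (F z)) 0 1 = (starRingEnd ℂ) (circleAverage F 0 1) :=
  (Complex.conjCLE : ℂ →L[ℝ] ℂ).circleAverage_comp_comm hF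

/-- The Poisson representation of a harmonic Hardy function. -/
lemma IsHardy.eq_circleAverage {A : ℝ} (hf : IsHardy p f g h) (hp : 1 < p)
    (hg : HasBoundedMeans p A g) (hh : HasBoundedMeans p A h) :
    CircleIntegrable (boundaryValue f) 0 1 ∧ ∀ z, ‖z‖ < 1 →
      f z = circleAverage (fun ζ => poissonKernel 0 z ζ • boundaryValue f ζ) 0 1 := by
  have ig := (hg.tendsto_integral_sub hp).1
  have ih := (hh.tendsto_integral_sub hp).1
  have ihc : CircleIntegrable (fun ζ => (starRingEnd ℂ) (boundaryValue h ζ)) 0 1 :=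
    circleIntegrable_iff_integrable.2 <|
      (Complex.conjCLE : ℂ →L[ℝ] ℂ).integrable_comp (circleIntegrable_iff_integrable.1 ih)
  have hbv := hf.boundaryValue_eq (hg.hasRadialLimits hp) (hh.hasRadialLimits hp)
  refine ⟨?_, fun z hz => ?_⟩
  · refine circleIntegrable_iff_integrable.2 ((circleIntegrable_iff_integrable.1
      (ig.add ihc)).congr ?_)
    refine ae_restrict_of_ae ?_
    filter_upwards [hbv] with θ hθ
    exact hθ.symm
  · have e : circleAverage (fun ζ => poissonKernel 0 z ζ • boundaryValue f ζ) 0 1 =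
        circleAverage (fun ζ => poissonKernel 0 z ζ • boundaryValue g ζ +
          poissonKernel 0 z ζ • (starRingEnd ℂ) (boundaryValue h ζ)) 0 1 := by
      rw [circleAverage_eq_integral_restrict, circleAverage_eq_integral_restrict]
      congr 1
      refine integral_congr_ae (ae_restrict_of_ae ?_)
      filter_upwards [hbv] with θ hθ
      simp only [hθ, smul_add]
    rw [e, circleAverage_fun_add (CircleIntegrable.poissonKernel_smul ig hz)
      (CircleIntegrable.poissonKernel_smul ihc hz), ← hg.eq_circleAverage hp hz,
      hf.eq_add_conj z (by simpa using hz), hh.eq_circleAverage hp hz,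
      ← circleAverage_conj (CircleIntegrable.poissonKernel_smul ih hz)]
    simp

/-- Poisson representation and Jensen's inequality bound the interior means by the boundary mean;
Fatou's lemma gives the converse. Fatou's lemma for the pair then uses the interior inequality with
the boundary mean of `f` on the right. -/
theorem IsHardy.riesz_inequality (hf : IsHardy p f g h) (hp : 1 < p)
    (h0 : 0 ≤ (g 0 * h 0).re) :
    HasRadialLimits f ∧ HasRadialLimits g ∧ HasRadialLimits h ∧
      CircleIntegrable (boundaryPow p f) 0 1 ∧ CircleIntegrable (boundaryPairPow p g h) 0 1 ∧
      hardyNorm p f = boundaryNorm p f ∧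
      boundaryPairNorm p g h ≤ rieszConst p * boundaryNorm p f := by
  have hp0 : 0 < p := by linarith
  have hg := hf.hasBoundedMeans_left hp h0
  have hh := hf.hasBoundedMeans_right hp h0
  have lg := hg.hasRadialLimits hp
  have lh := hh.hasRadialLimits hp
  have lf := hf.hasRadialLimits lg lh
  obtain ⟨iF, hrep⟩ := hf.eq_circleAverage hp hg hh
  have hH0 : 0 ≤ hardyNorm p f := by
    refine le_trans ?_ (le_csSup hf.bddAbove_means (Set.mem_image_of_mem _
      (show (1 / 2 : ℝ) ∈ Set.Ioo (0 : ℝ) 1 by norm_num)))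
    exact rpow_nonneg (circleAverage_nonneg_of_nonneg fun z _ => by positivity) _
  obtain ⟨iP, hP⟩ := circleIntegrable_of_tendsto (ψ := boundaryPow p f)
    (hf.continuousOn_norm_rpow hp) (fun _ => by positivity)
    (fun _ => by unfold boundaryPow; positivity)
    (by
      filter_upwards [lf.tendsto_radius] with θ hθ
      exact hθ.norm.rpow_const (Or.inr hp0.le))
    (fun r hr => hf.circleAverage_le hp hr)
  have hA0 : 0 ≤ circleAverage (boundaryPow p f) 0 1 :=
    circleAverage_nonneg_of_nonneg fun z _ => by unfold boundaryPow; positivity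
  have hmean : ∀ r ∈ Set.Ioo (0 : ℝ) 1,
      circleAverage (fun z => ‖f z‖ ^ p) 0 r ≤ circleAverage (boundaryPow p f) 0 1 :=
    fun r hr => circleAverage_rpow_le_of_poisson hp hf.continuousOn iF iP hrep hr
  have hR := rieszConst_pos hp
  obtain ⟨iQ, hQ⟩ := circleIntegrable_of_tendsto (ψ := boundaryPairPow p g h)
    (hf.continuousOn_pair hp) (fun _ => by positivity)
    (fun _ => by unfold boundaryPairPow; positivity)
    (by
      filter_upwards [lg.tendsto_radius, lh.tendsto_radius] with θ hθ1 hθ2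
      exact ((hθ1.norm.pow 2).add (hθ2.norm.pow 2)).rpow_const (Or.inr (by positivity)))
    (fun r hr => (hf.circleAverage_pair_le hp h0 hr).trans
      (mul_le_mul_of_nonneg_left (hmean r hr) (by positivity)))
  refine ⟨lf, lg, lh, iP, iQ, le_antisymm ?_ ?_, ?_⟩
  · refine csSup_le ((Set.nonempty_Ioo.2 one_pos).image _) ?_
    rintro _ ⟨r, hr, rfl⟩
    exact rpow_le_rpow (circleAverage_nonneg_of_nonneg fun z _ => by positivity) (hmean r hr)
      (by positivity)
  · calc boundaryNorm p f ≤ (hardyNorm p f ^ p) ^ (1 / p) := rpow_le_rpow hA0 hP (by positivity)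
      _ = hardyNorm p f := by rw [one_div, rpow_rpow_inv hH0 hp0.ne']
  · calc boundaryPairNorm p g h
        ≤ (rieszConst p ^ p * circleAverage (boundaryPow p f) 0 1) ^ (1 / p) :=
          rpow_le_rpow (circleAverage_nonneg_of_nonneg fun z _ => by
            unfold boundaryPairPow; positivity) hQ (by positivity)
      _ = rieszConst p * boundaryNorm p f := by
          rw [mul_rpow (by positivity) hA0, one_div, rpow_rpow_inv hR.le hp0.ne', boundaryNorm,
            one_div]

end


/-! ### Sharpness -/

/-- The Cayley transform of the unit disk onto the right half plane. -/
def cayley (z : ℂ) : ℂ := (1 + z) / (1 - z)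

lemma cayley_re (z : ℂ) : (cayley z).re = (1 - ‖z‖ ^ 2) / ‖1 - z‖ ^ 2 := by
  rw [cayley, Complex.div_re, ← Complex.normSq_eq_norm_sq, ← Complex.normSq_eq_norm_sq, ← add_div]
  congr 1
  simp [Complex.normSq_apply]
  ring

lemma ne_one_of_mem_ball {z : ℂ} (hz : z ∈ ball (0 : ℂ) 1) : 1 - z ≠ 0 := by
  rw [sub_ne_zero]
  rintro rfl
  simp at hz

lemma cayley_re_pos {z : ℂ} (hz : z ∈ ball (0 : ℂ) 1) : 0 < (cayley z).re := by
  have h1 := ne_one_of_mem_ball hz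
  rw [mem_ball_zero_iff] at hz
  rw [cayley_re]
  have : 0 < 1 - ‖z‖ ^ 2 := by nlinarith [norm_nonneg z]
  have := norm_pos_iff.2 h1
  positivity

lemma differentiableAt_cayley {z : ℂ} (hz : 1 - z ≠ 0) : DifferentiableAt ℂ cayley z :=
  DifferentiableAt.div (by fun_prop) (by fun_prop) hz

lemma differentiableOn_cayley_cpow (s : ℝ) :
    DifferentiableOn ℂ (fun z => cayley z ^ (s : ℂ)) (ball 0 1) := fun _ hz =>
  ((differentiableAt_cayley (ne_one_of_mem_ball hz)).cpow_const
    (Or.inl (cayley_re_pos hz))).differentiableWithinAt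

/-- With `u = cayley z` in the right half-plane, `|arg (u^s)| ≤ sπ/2`, so `|u|^s ≤ Re (u^s) / cos
(sπ/2)`; the harmonic function `Re (u^s)` has mean `1`. -/
lemma circleAverage_norm_cayley_rpow_le {s : ℝ} (hs : 0 < s) (hs1 : s < 1) {r : ℝ}
    (hr : r ∈ Set.Ioo (0 : ℝ) 1) :
    circleAverage (fun z => ‖cayley z‖ ^ s) 0 r ≤ 1 / cos (s * (π / 2)) := by
  have hpi := pi_pos
  have hc : 0 < cos (s * (π / 2)) := by
    refine cos_pos_of_mem_Ioo ⟨?_, ?_⟩ <;> nlinarith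
  have hd := differentiableOn_cayley_cpow s
  have iG := circleIntegrable_of_continuousOn_ball hd.continuousOn hr
  have hmean : circleAverage (fun z => (cayley z ^ (s : ℂ)).re) 0 r = 1 := by
    have h1 : circleAverage (fun z => cayley z ^ (s : ℂ)) 0 r = 1 := by
      rw [DiffContOnCl.circleAverage]
      · simp [cayley]
      · refine (hd.mono ?_).diffContOnCl
        rw [abs_of_pos hr.1, closure_ball _ hr.1.ne']
        exact closedBall_subset_ball hr.2
    have := Complex.reCLM.circleAverage_comp_comm iG
    rw [h1] at this
    exact this
  rw [← hmean, ← inv_mul_eq_div]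
  have hn : ContinuousOn (fun z => ‖cayley z‖ ^ s) (ball 0 1) := by
    refine hd.continuousOn.norm.congr fun z _ => ?_
    exact (Complex.norm_cpow_real _ _).symm
  have i1 := circleIntegrable_of_continuousOn_ball
    (Complex.continuous_re.comp_continuousOn hd.continuousOn) hr
  rw [← smul_eq_mul, ← circleAverage_fun_smul]
  refine circleAverage_mono (circleIntegrable_of_continuousOn_ball hn hr) (i1.const_mul _)
    fun z hz => ?_
  rw [abs_of_pos hr.1] at hz
  have hz' := sphere_subset_ball_one hr hz
  rw [smul_eq_mul, Complex.cpow_ofReal_re, inv_mul_eq_div, le_div_iff₀ hc]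
  gcongr
  have harg := Complex.abs_arg_le_pi_div_two_iff.2 (cayley_re_pos hz').le
  rw [← cos_abs (_ * s), abs_mul, abs_of_pos hs]
  refine cos_le_cos_of_nonneg_of_le_pi (by positivity) (by nlinarith) ?_
  rw [mul_comm]
  gcongr

/-- The analytic part of the extremal functions. -/
def extremalPart (γ : ℝ) (z : ℂ) : ℂ := cayley z ^ (γ : ℂ) - 1

/-- The extremal functions. -/
def extremal (ε γ : ℝ) (z : ℂ) : ℂ :=
  extremalPart γ z + (starRingEnd ℂ) (ε * extremalPart γ z)

/-- The subtraction of `1` in `extremalPart` serves this normalization, which makes `g(0)h(0) = 0`.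
-/
lemma extremalPart_zero (γ : ℝ) : extremalPart γ 0 = 0 := by
  simp [extremalPart, cayley]

lemma norm_extremalPart_le (γ : ℝ) (z : ℂ) : ‖extremalPart γ z‖ ≤ ‖cayley z‖ ^ γ + 1 := by
  rw [← Complex.norm_cpow_real, extremalPart]
  simpa using norm_sub_le (cayley z ^ (γ : ℂ)) 1

lemma le_norm_extremalPart (γ : ℝ) (z : ℂ) : ‖cayley z‖ ^ γ - 1 ≤ ‖extremalPart γ z‖ := by
  rw [← Complex.norm_cpow_real, extremalPart]
  simpa using norm_sub_norm_le (cayley z ^ (γ : ℂ)) 1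

lemma norm_extremal_le {ε : ℝ} (hε : |ε| = 1) (γ : ℝ) (z : ℂ) :
    ‖extremal ε γ z‖ ≤ 2 * (‖cayley z‖ ^ γ + 1) := by
  have h := norm_extremalPart_le γ z
  refine (norm_add_le _ _).trans ?_
  rw [RCLike.norm_conj, norm_mul, Complex.norm_real, norm_eq_abs, hε]
  linarith

lemma isHardy_extremal {p γ ε : ℝ} (hp : 1 < p) (hγ : 0 < γ) (hγp : γ * p < 1) (hε : |ε| = 1) :
    IsHardy p (extremal ε γ) (extremalPart γ) (fun z => ε * extremalPart γ z) := by
  have hp0 : 0 < p := by linarith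
  have hd : DifferentiableOn ℂ (extremalPart γ) (ball 0 1) :=
    (differentiableOn_cayley_cpow γ).sub_const 1
  have hd' : DifferentiableOn ℂ (fun z => ε * extremalPart γ z) (ball 0 1) := hd.const_mul _
  refine ⟨hd, hd', fun _ _ => rfl, ?_⟩
  refine ⟨(4 ^ p * (1 / cos (γ * p * (π / 2)) + 1)) ^ (1 / p), ?_⟩
  rintro _ ⟨r, hr, rfl⟩
  refine rpow_le_rpow (circleAverage_nonneg_of_nonneg fun z _ => by positivity) ?_ (by positivity)
  have hcf : ContinuousOn (extremal ε γ) (ball 0 1) :=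
    hd.continuousOn.add (Complex.continuous_conj.comp_continuousOn hd'.continuousOn)
  have i1 := circleIntegrable_of_continuousOn_ball
    (hcf.norm.rpow_const (p := p) fun _ _ => Or.inr hp0.le) hr
  have hn : ContinuousOn (fun z => ‖cayley z‖ ^ (γ * p)) (ball 0 1) := by
    refine (differentiableOn_cayley_cpow (γ * p)).continuousOn.norm.congr fun z _ => ?_
    exact (Complex.norm_cpow_real _ _).symm
  have i2 := circleIntegrable_of_continuousOn_ball hn hr
  have i3 : CircleIntegrable (fun z => ‖cayley z‖ ^ (γ * p) + 1) 0 r :=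
    i2.add (circleIntegrable_const 1 0 r)
  calc circleAverage (fun z => ‖extremal ε γ z‖ ^ p) 0 r
      ≤ circleAverage (fun z => (4 : ℝ) ^ p • (‖cayley z‖ ^ (γ * p) + 1)) 0 r := by
        refine circleAverage_mono i1 (i3.const_mul _) fun z _ => ?_
        rw [smul_eq_mul, rpow_mul (norm_nonneg _)]
        set t := ‖cayley z‖ ^ γ
        have ht : 0 ≤ t := by positivity
        have h1 : ‖extremal ε γ z‖ ≤ 2 * (t + 1) := norm_extremal_le hε γ z
        have htp : 0 ≤ t ^ p := by positivity
        rcases le_total t 1 with h | h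
        · calc ‖extremal ε γ z‖ ^ p ≤ 4 ^ p :=
                rpow_le_rpow (norm_nonneg _) (by linarith) hp0.le
            _ ≤ _ := le_mul_of_one_le_right (by positivity) (by linarith)
        · calc ‖extremal ε γ z‖ ^ p ≤ (4 * t) ^ p :=
                rpow_le_rpow (norm_nonneg _) (by linarith) hp0.le
            _ = 4 ^ p * t ^ p := mul_rpow (by norm_num) ht
            _ ≤ _ := by gcongr; linarith
    _ = 4 ^ p * (circleAverage (fun z => ‖cayley z‖ ^ (γ * p)) 0 r + 1) := by
        rw [circleAverage_fun_smul, circleAverage_fun_add i2 (circleIntegrable_const 1 0 r),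
          circleAverage_const, smul_eq_mul]
    _ ≤ _ := by
        have := circleAverage_norm_cayley_rpow_le (s := γ * p) (by positivity) hγp hr
        gcongr

lemma boundaryValue_eq_of_continuousAt {F : ℂ → ℂ} {ζ : ℂ} (hF : ContinuousAt F ζ) :
    boundaryValue F ζ = F ζ := by
  refine Tendsto.limUnder_eq ?_
  have h1 : Tendsto (fun r : ℝ => (r : ℂ) * ζ) (𝓝[<] 1) (𝓝 ζ) := by
    have : Continuous fun r : ℝ => (r : ℂ) * ζ := by fun_prop
    have h := (this.tendsto 1).mono_left (nhdsWithin_le_nhds (s := Set.Iio 1))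
    simpa using h
  exact hF.tendsto.comp h1

lemma ae_circleMap_ne : ∀ᵐ θ : ℝ, circleMap 0 1 θ ≠ 1 ∧ circleMap 0 1 θ ≠ -1 := by
  have h : ((circleMap 0 1) ⁻¹' ({1, -1} : Set ℂ)).Countable :=
    (Set.toFinite ({1, -1} : Set ℂ)).countable.preimage_circleMap 0 one_ne_zero
  filter_upwards [h.ae_notMem volume] with θ hθ
  simpa [not_or] using hθ

lemma cayley_circleMap_re (θ : ℝ) : (cayley (circleMap 0 1 θ)).re = 0 := by
  simp [cayley_re]

lemma continuousAt_extremalPart (γ : ℝ) {θ : ℝ} (h1 : circleMap 0 1 θ ≠ 1)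
    (h2 : circleMap 0 1 θ ≠ -1) : ContinuousAt (extremalPart γ) (circleMap 0 1 θ) := by
  have h1' : 1 - circleMap 0 1 θ ≠ 0 := sub_ne_zero.2 h1.symm
  have h2' : 1 + circleMap 0 1 θ ≠ 0 := fun h => h2 (by linear_combination h)
  refine ((differentiableAt_cayley h1').cpow_const ?_).continuousAt.sub continuousAt_const
  refine Complex.mem_slitPlane_iff.2 (Or.inr fun him => ?_)
  exact div_ne_zero h2' h1' (Complex.ext (cayley_circleMap_re θ) him)

/-- Since `‖1 - e^{iθ}‖ ≤ θ` and `‖1 + e^{iθ}‖ ≥ 1`. This makes the boundary integral of `‖cayley‖ ^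
(γ p)` blow up as `γ → 1/p`. -/
lemma inv_le_norm_cayley {θ : ℝ} (h0 : 0 < θ) (h1 : θ ≤ 1) (hne : circleMap 0 1 θ ≠ 1) :
    θ⁻¹ ≤ ‖cayley (circleMap 0 1 θ)‖ := by
  have h : ‖1 - circleMap 0 1 θ‖ ≤ θ := by
    have := norm_exp_I_mul_ofReal_sub_one_le (x := θ)
    rw [norm_eq_abs, abs_of_pos h0] at this
    rw [norm_sub_rev]
    simpa [circleMap, mul_comm] using this
  have hpos : 0 < ‖1 - circleMap 0 1 θ‖ := norm_pos_iff.2 (sub_ne_zero.2 hne.symm)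
  have h2 : 1 ≤ ‖1 + circleMap 0 1 θ‖ := by
    have := norm_sub_norm_le (2 : ℂ) (1 - circleMap 0 1 θ)
    rw [show (2 : ℂ) - (1 - circleMap 0 1 θ) = 1 + circleMap 0 1 θ by ring] at this
    simp only [Complex.norm_ofNat] at this
    linarith
  rw [cayley, norm_div, inv_eq_one_div]
  gcongr

/-- The elementary inequality behind the sharpness of the constant. -/
lemma exists_rpow_lower_bound {p C k : ℝ} (hp : 1 < p) (hC : 0 ≤ C) (hk : 2 * C * k < √2) :
    ∃ δ M : ℝ, 0 < δ ∧ 0 ≤ M ∧ ∀ κ ≤ k + δ, ∀ t a b : ℝ, 0 ≤ t → 0 ≤ a → 0 ≤ b → t - 1 ≤ a →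
      b ≤ 2 * (t + 1) → b ≤ 2 * κ * t + 2 →
        C ^ p * b ^ p + δ ^ p * t ^ p - M ≤ (√2 * a) ^ p := by
  have hp0 : 0 < p := by linarith
  -- The slack `√2 - 2Ck` is split into `2Cδ` for replacing `k` by `k + δ`, one `δ` for the term `δ
  -- t`, and one `δ` that absorbs the constants `√2 + 2C` once `t ≥ T`.
  set δ := (√2 - 2 * C * k) / (2 * C + 2) with hδ
  have hδ0 : 0 < δ := div_pos (by linarith) (by linarith)
  have hδe : δ * (2 * C + 2) = √2 - 2 * C * k := by rw [hδ]; field_simp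
  have hs2 : 0 ≤ √2 := sqrt_nonneg 2
  set T := (√2 + 2 * C) / δ with hT
  have hT0 : 0 ≤ T := by positivity
  have hTe : δ * T = √2 + 2 * C := by rw [hT]; field_simp
  refine ⟨δ, C ^ p * (2 * (T + 1)) ^ p + δ ^ p * T ^ p, hδ0, by positivity,
    fun κ hκ t a b ht ha hb hta hb1 hb2 => ?_⟩
  rcases le_total t T with h | h
  · have e1 : b ^ p ≤ (2 * (T + 1)) ^ p := rpow_le_rpow hb (by linarith) hp0.le
    have e2 : t ^ p ≤ T ^ p := rpow_le_rpow ht h hp0.le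
    have e3 : C ^ p * b ^ p ≤ C ^ p * (2 * (T + 1)) ^ p := by gcongr
    have e4 : δ ^ p * t ^ p ≤ δ ^ p * T ^ p := by gcongr
    have e5 : 0 ≤ (√2 * a) ^ p := by positivity
    linarith
  -- For large `t` the sum of `p`-th powers is at most the `p`-th power of the sum, which leaves a
  -- linear inequality.
  · have hM : 0 ≤ C ^ p * (2 * (T + 1)) ^ p + δ ^ p * T ^ p := by positivity
    refine (sub_le_self _ hM).trans ?_
    rw [← mul_rpow hC hb, ← mul_rpow hδ0.le ht]
    refine (add_rpow_le_rpow_add (by positivity) (by positivity) hp.le).trans ?_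
    refine rpow_le_rpow (by positivity) ?_ hp0.le
    have e1 : C * b ≤ C * (2 * (k + δ) * t + 2) := by
      refine mul_le_mul_of_nonneg_left (hb2.trans ?_) hC
      nlinarith
    have e2 : √2 * (t - 1) ≤ √2 * a := by gcongr
    have e3 : δ * T ≤ δ * t := by gcongr
    have e4 : δ * (2 * C + 2) * t = (√2 - 2 * C * k) * t := by rw [hδe]
    nlinarith

/-- With `u` the Cayley transform, on the circle `‖f‖ ≤ 2κ(γ)|u|^γ + 2`, while `(‖g‖² + ‖h‖²)^(1/2)
= √2 ‖g‖ ≥ √2 (|u|^γ - 1)`. The errors stay bounded as the integral of `|u|^(γp)` diverges, so every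
`C` below `√2 / (2k)` is exceeded. -/
lemma exists_sharp_of_bound {p ε k : ℝ} {κ : ℝ → ℝ} (hp : 1 < p) (hε : |ε| = 1)
    (hκ : Continuous κ) (hκk : κ (1 / p) = k)
    (hbound : ∀ (γ : ℝ) (u : ℂ), u.re = 0 → u ≠ 0 →
      ‖u ^ (γ : ℂ) + ε * (starRingEnd ℂ) (u ^ (γ : ℂ))‖ ≤ 2 * κ γ * ‖u‖ ^ γ)
    {C : ℝ} (hC : 0 ≤ C) (hCk : 2 * C * k < √2) :
    ∃ f g h : ℂ → ℂ, IsHardy p f g h ∧ (g 0 * h 0).re = 0 ∧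
      C * boundaryNorm p f < boundaryPairNorm p g h := by
  have hp0 : 0 < p := by linarith
  have hpi := pi_pos
  obtain ⟨δ, M, hδ, hM, hmain⟩ := exists_rpow_lower_bound hp hC hCk
  -- Just below `1 / p`, the integral `1 / (1 - γ * p)` of `θ ^ (-(γ * p))` over `(0, 1]` outweighs
  -- the bounded error.
  obtain ⟨γ, hγ0, hγp, hγk, hγM⟩ : ∃ γ : ℝ, 0 < γ ∧ γ * p < 1 ∧ κ γ ≤ k + δ ∧
      2 * π * M < δ ^ p * (1 / (1 - γ * p)) := by
    have hp1 : (0 : ℝ) < 1 / p := by positivity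
    have e1 : ∀ᶠ γ in 𝓝[<] (1 / p), κ γ ≤ k + δ := by
      refine nhdsWithin_le_nhds ((hκ.tendsto (1 / p)).eventually_le_const ?_)
      rw [hκk]; linarith
    have e2 : ∀ᶠ γ in 𝓝[<] (1 / p), γ ∈ Set.Ioo 0 (1 / p) := Ioo_mem_nhdsLT hp1
    have e3 : ∀ᶠ γ in 𝓝[<] (1 / p), (1 - γ * p) * (2 * π * M) < δ ^ p := by
      refine nhdsWithin_le_nhds (Tendsto.eventually_lt_const (u := δ ^ p)
        (v := (1 - 1 / p * p) * (2 * π * M)) ?_ ?_)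
      · rw [one_div_mul_cancel hp0.ne', sub_self, zero_mul]; positivity
      · exact Continuous.tendsto (by fun_prop) _
    obtain ⟨γ, h1, h2, h3⟩ := (e1.and (e2.and e3)).exists
    have h4 : γ * p < 1 := by
      have := h2.2
      rwa [lt_div_iff₀ hp0] at this
    refine ⟨γ, h2.1, h4, h1, ?_⟩
    have h5 : 0 < 1 - γ * p := by linarith
    rw [mul_one_div, lt_div_iff₀ h5]
    linarith
  have hH := isHardy_extremal hp hγ0 hγp hε
  have hzero : (extremalPart γ 0 * (ε * extremalPart γ 0)).re = 0 := by simp [extremalPart_zero]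
  refine ⟨_, _, _, hH, hzero, ?_⟩
  obtain ⟨-, -, -, iF, iP, -, -⟩ := hH.riesz_inequality hp hzero.ge
  set f := extremal ε γ
  set g := extremalPart γ
  set h : ℂ → ℂ := fun z => ε * extremalPart γ z
  set μ : Measure ℝ := volume.restrict (Set.Ioc 0 (2 * π)) with hμ
  have iF' := circleIntegrable_iff_integrable.1 iF
  have iP' := circleIntegrable_iff_integrable.1 iP
  set s := γ * p with hs
  -- An integrable minorant of `‖cayley‖ ^ (γ * p)` with explicit integral.
  set U : ℝ → ℝ := (Set.Ioc 0 1).indicator fun θ => θ ^ (-s) with hU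
  have h2pi : (1 : ℝ) ≤ 2 * π := by linarith [pi_gt_three]
  have hsub : Set.Ioc (0 : ℝ) 1 ⊆ Set.Ioc 0 (2 * π) := Set.Ioc_subset_Ioc_right h2pi
  have hUon : IntegrableOn (fun θ : ℝ => θ ^ (-s)) (Set.Ioc 0 1) :=
    (intervalIntegral.intervalIntegrable_rpow' (a := 0) (b := 1) (by linarith)).1
  have iU : Integrable U μ := by
    have : Integrable U := hUon.integrable_indicator measurableSet_Ioc
    exact this.integrableOn
  have hUint : ∫ θ, U θ ∂μ = 1 / (1 - s) := by
    rw [hU, integral_indicator measurableSet_Ioc, hμ, Measure.restrict_restrict measurableSet_Ioc,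
      Set.inter_eq_left.2 hsub, ← intervalIntegral.integral_of_le zero_le_one,
      integral_rpow (Or.inl (by linarith)), one_rpow, zero_rpow (by linarith)]
    congr 1 <;> ring
  have hpt : ∀ᵐ θ ∂μ, C ^ p * boundaryPow p f (circleMap 0 1 θ) + δ ^ p * U θ - M ≤
      boundaryPairPow p g h (circleMap 0 1 θ) := by
    refine ae_restrict_of_ae ?_
    filter_upwards [ae_circleMap_ne] with θ ⟨hne1, hne2⟩
    set ζ := circleMap 0 1 θ with hζ
    have cg : ContinuousAt g ζ := continuousAt_extremalPart γ hne1 hne2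
    have ch : ContinuousAt h ζ := continuousAt_const.mul cg
    have cf : ContinuousAt f ζ := cg.add (Complex.continuous_conj.continuousAt.comp ch)
    have hne : cayley ζ ≠ 0 :=
      div_ne_zero (fun h => hne2 (by linear_combination h)) (sub_ne_zero.2 hne1.symm)
    rw [boundaryPow, boundaryPairPow, boundaryValue_eq_of_continuousAt cf,
      boundaryValue_eq_of_continuousAt cg, boundaryValue_eq_of_continuousAt ch]
    have e1 : (‖g ζ‖ ^ 2 + ‖h ζ‖ ^ 2) ^ (p / 2) = (√2 * ‖g ζ‖) ^ p := by
      have : ‖h ζ‖ = ‖g ζ‖ := by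
        simp only [h, norm_mul, Complex.norm_real, norm_eq_abs, hε, one_mul]; rfl
      rw [this, ← two_mul, mul_rpow (by positivity) (by positivity),
        mul_rpow (by positivity) (by positivity), sqrt_eq_rpow, ← rpow_mul (by norm_num),
        ← rpow_natCast, ← rpow_mul (norm_nonneg _)]
      congr 2 <;> push_cast <;> ring
    rw [e1]
    have e2 : ‖f ζ‖ ≤ 2 * κ γ * ‖cayley ζ‖ ^ γ + 2 := by
      have : f ζ = (cayley ζ ^ (γ : ℂ) + ε * (starRingEnd ℂ) (cayley ζ ^ (γ : ℂ))) - (1 + ε) := by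
        simp only [f, extremal, extremalPart, map_mul, map_sub, map_one, Complex.conj_ofReal]
        ring
      rw [this]
      refine (norm_sub_le _ _).trans (add_le_add (hbound γ _ (cayley_circleMap_re θ) hne) ?_)
      refine (norm_add_le _ _).trans ?_
      rw [norm_one, Complex.norm_real, norm_eq_abs, hε]
      norm_num
    have e3 : U θ ≤ (‖cayley ζ‖ ^ γ) ^ p := by
      rw [← rpow_mul (norm_nonneg _)]
      by_cases hθ : θ ∈ Set.Ioc (0 : ℝ) 1
      · rw [hU, Set.indicator_of_mem hθ, rpow_neg hθ.1.le, ← inv_rpow hθ.1.le]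
        exact rpow_le_rpow (inv_nonneg.2 hθ.1.le) (inv_le_norm_cayley hθ.1 hθ.2 hne1)
          (by positivity)
      · rw [hU, Set.indicator_of_notMem hθ]; positivity
    refine le_trans ?_ (hmain (κ γ) hγk (‖cayley ζ‖ ^ γ) ‖g ζ‖ ‖f ζ‖ (by positivity)
      (norm_nonneg _) (norm_nonneg _) (le_norm_extremalPart γ ζ) (norm_extremal_le hε γ ζ) e2)
    gcongr
  have hint : C ^ p * ∫ θ, boundaryPow p f (circleMap 0 1 θ) ∂μ <
      ∫ θ, boundaryPairPow p g h (circleMap 0 1 θ) ∂μ := by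
    have i1 : Integrable (fun θ => C ^ p * boundaryPow p f (circleMap 0 1 θ) + δ ^ p * U θ) μ :=
      (iF'.const_mul (C ^ p)).add (iU.const_mul (δ ^ p))
    have h1 := integral_mono_ae (i1.sub (integrable_const M)) iP' hpt
    simp only [Pi.sub_apply] at h1
    rw [integral_sub i1 (integrable_const M),
      integral_add (iF'.const_mul (C ^ p)) (iU.const_mul (δ ^ p)), integral_const_mul,
      integral_const_mul, hUint, integral_const] at h1
    have hvol : μ.real Set.univ = 2 * π := by
      simp [hμ, measureReal_def, hpi.le]
    rw [hvol, smul_eq_mul] at h1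
    linarith
  have hF0 : 0 ≤ circleAverage (boundaryPow p f) 0 1 :=
    circleAverage_nonneg_of_nonneg fun z _ => by unfold boundaryPow; positivity
  have havg : C ^ p * circleAverage (boundaryPow p f) 0 1 <
      circleAverage (boundaryPairPow p g h) 0 1 := by
    rw [circleAverage_eq_integral_restrict, circleAverage_eq_integral_restrict, smul_eq_mul,
      smul_eq_mul, mul_left_comm]
    exact mul_lt_mul_of_pos_left hint (inv_pos.2 two_pi_pos)
  calc C * boundaryNorm p f = (C ^ p * circleAverage (boundaryPow p f) 0 1) ^ (1 / p) := by
        rw [mul_rpow (by positivity) hF0, one_div, rpow_rpow_inv hC hp0.ne', boundaryNorm, one_div]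
    _ < boundaryPairNorm p g h :=
        rpow_lt_rpow (by positivity) havg (by positivity)

lemma abs_arg_eq_pi_div_two {u : ℂ} (h : u.re = 0) (hu : u ≠ 0) : |u.arg| = π / 2 := by
  have hpi := pi_pos
  have him : u.im ≠ 0 := fun h' => hu (Complex.ext h h')
  rcases him.lt_or_gt with h' | h'
  · rw [Complex.arg_eq_neg_pi_div_two_iff.2 ⟨h, h'⟩, abs_neg, abs_of_pos (by positivity)]
  · rw [Complex.arg_eq_pi_div_two_iff.2 ⟨h, h'⟩, abs_of_pos (by positivity)]

/-- As `arg u = ±π/2`, the sum is `2 Re (u^γ) = 2 |u|^γ cos (γπ/2)`; with the minus sign below, the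
imaginary part brings in the sine. -/
lemma norm_cpow_add_conj {u : ℂ} (h : u.re = 0) (hu : u ≠ 0) (γ : ℝ) :
    ‖u ^ (γ : ℂ) + (1 : ℝ) * (starRingEnd ℂ) (u ^ (γ : ℂ))‖ ≤
      2 * |cos (π / 2 * γ)| * ‖u‖ ^ γ := by
  have habs : |cos (u.arg * γ)| = |cos (π / 2 * γ)| := by
    rcases abs_eq (by positivity) |>.1 (abs_arg_eq_pi_div_two h hu) with e | e
    · rw [e]
    · rw [e, neg_mul, cos_neg]
  rw [Complex.ofReal_one, one_mul, Complex.add_conj, Complex.norm_real, norm_eq_abs,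
    Complex.cpow_ofReal_re, abs_mul, abs_mul, habs, abs_of_nonneg (by positivity : 0 ≤ ‖u‖ ^ γ)]
  norm_num
  linarith

lemma norm_cpow_sub_conj {u : ℂ} (h : u.re = 0) (hu : u ≠ 0) (γ : ℝ) :
    ‖u ^ (γ : ℂ) + (-1 : ℝ) * (starRingEnd ℂ) (u ^ (γ : ℂ))‖ ≤
      2 * |sin (π / 2 * γ)| * ‖u‖ ^ γ := by
  have habs : |sin (u.arg * γ)| = |sin (π / 2 * γ)| := by
    rcases abs_eq (by positivity) |>.1 (abs_arg_eq_pi_div_two h hu) with e | e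
    · rw [e]
    · rw [e, neg_mul, sin_neg, abs_neg]
  rw [Complex.ofReal_neg, Complex.ofReal_one, neg_one_mul, ← sub_eq_add_neg, Complex.sub_conj,
    norm_mul, Complex.norm_I, mul_one, Complex.norm_real, norm_eq_abs,
    Complex.cpow_ofReal_im, abs_mul, abs_mul, habs, abs_of_nonneg (by positivity : 0 ≤ ‖u‖ ^ γ)]
  norm_num
  linarith

lemma two_mul_mul_lt_sqrt_two {p C k : ℝ} (hC : C < rieszConst p) (hk : 0 < k)
    (hk2 : 1 - |cos (π / p)| = 2 * k ^ 2) : 2 * C * k < √2 := by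
  have h1 : rieszConst p = 1 / (√2 * k) := by
    rw [rieszConst, hk2, sqrt_mul (by norm_num), sqrt_sq hk.le]
  have hs : 0 < √2 := by positivity
  rw [h1, lt_div_iff₀ (by positivity)] at hC
  have := mul_self_sqrt (show (0 : ℝ) ≤ 2 by norm_num)
  nlinarith

/-- The sign of `h = ±g` is chosen so that `k` is the smaller of `cos (π/2p)` and `sin (π/2p)`; the
half-angle formula then gives `1 - |cos (π/p)| = 2k²`, so that `rieszConst p = √2 / (2k)`. -/
theorem exists_sharp {p : ℝ} (hp : 1 < p) {C : ℝ} (hC : 0 ≤ C) (hCp : C < rieszConst p) :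
    ∃ f g h : ℂ → ℂ, IsHardy p f g h ∧ (g 0 * h 0).re = 0 ∧
      C * boundaryNorm p f < boundaryPairNorm p g h := by
  have hpi := pi_pos
  have hp0 : 0 < p := by linarith
  have hx : π / p = 2 * (π / 2 * (1 / p)) := by field_simp
  have hx0 : 0 < π / 2 * (1 / p) := by positivity
  have hx1 : π / 2 * (1 / p) < π / 2 := by
    have : 1 / p < 1 := by rwa [div_lt_one hp0]
    nlinarith
  rcases le_total p 2 with h | h
  · refine exists_sharp_of_bound (ε := 1) (κ := fun γ => |cos (π / 2 * γ)|) hp (by simp)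
      (by fun_prop) rfl (fun γ u hu hu0 => norm_cpow_add_conj hu hu0 γ) hC ?_
    have hcos := cos_pos_of_mem_Ioo (x := π / 2 * (1 / p)) ⟨by linarith, hx1⟩
    refine two_mul_mul_lt_sqrt_two hCp (abs_pos.2 hcos.ne') ?_
    rw [abs_of_nonpos (cos_pi_div_nonpos hp h), sq_abs, hx, cos_two_mul]
    ring
  · refine exists_sharp_of_bound (ε := -1) (κ := fun γ => |sin (π / 2 * γ)|) hp (by simp)
      (by fun_prop) rfl (fun γ u hu hu0 => norm_cpow_sub_conj hu hu0 γ) hC ?_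
    have hsin := sin_pos_of_pos_of_lt_pi hx0 (by linarith)
    refine two_mul_mul_lt_sqrt_two hCp (abs_pos.2 hsin.ne') ?_
    rw [abs_of_nonneg (cos_pi_div_nonneg h), sq_abs, hx, cos_two_mul, cos_sq']
    ring

end HarmonicHardy

end

theorem theorem2p1 (p : ℝ) (hp : 1 < p) :
    (∀ f g h : ℂ → ℂ, HarmonicHardy.IsHardy p f g h →
      ((g 0 * h 0).re = 0 ∨ (p ≤ 3 ∧ 0 ≤ (g 0 * h 0).re)) →
        HarmonicHardy.HasRadialLimits f ∧
        HarmonicHardy.HasRadialLimits g ∧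
        HarmonicHardy.HasRadialLimits h ∧
        CircleIntegrable (HarmonicHardy.boundaryPow p f) 0 1 ∧
        CircleIntegrable (HarmonicHardy.boundaryPairPow p g h) 0 1 ∧
        HarmonicHardy.hardyNorm p f = HarmonicHardy.boundaryNorm p f ∧
        HarmonicHardy.boundaryPairNorm p g h ≤
          HarmonicHardy.rieszConst p * HarmonicHardy.boundaryNorm p f) ∧
    (∀ C : ℝ, C < HarmonicHardy.rieszConst p →
      ∃ f g h : ℂ → ℂ, HarmonicHardy.IsHardy p f g h ∧ (g 0 * h 0).re = 0 ∧
        C * HarmonicHardy.boundaryNorm p f < HarmonicHardy.boundaryPairNorm p g h) := by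
  refine ⟨fun f g h hf h0 => hf.riesz_inequality hp ?_, fun C hC => ?_⟩
  · rcases h0 with h0 | ⟨-, h0⟩
    · exact h0.ge
    · exact h0
  -- A negative `C` is replaced by `0`, which only strengthens the claim.
  · obtain ⟨f, g, h, hf, h0, hlt⟩ := HarmonicHardy.exists_sharp hp (le_max_right C 0)
      (max_lt hC (HarmonicHardy.rieszConst_pos hp))
    refine ⟨f, g, h, hf, h0, lt_of_le_of_lt ?_ hlt⟩
    refine mul_le_mul_of_nonneg_right (le_max_left C 0) (rpow_nonneg ?_ _)
    exact circleAverage_nonneg_of_nonneg fun z _ => by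
      unfold HarmonicHardy.boundaryPow; positivity
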